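/- Let $\mathcal H,\mathcal G$ be complex Hilbert spaces. **(A)** Let $\mathcal A:\mathcal D(\mathcal A)\subset\mathcal H\to\mathcal H$ be self-adjoint (hence closed and densely defined), with compact resolvent, and semibounded: $\langle \mathcal A u,u\rangle\ge -c\|u\|^2$ for some $c>0$ and all $u\in\mathcal D(\mathcal A)$. Let $\mathcal H^1=\mathcal D(|\mathcal A|^{1/2})$ with $\|x\|_1^2=\|x\|^2+\||\mathcal A|^{1/2}x\|^2$ (the completion of $\mathcal D(\mathcal A)$ in this norm), and $\|(w_0,w_1)\|_{\mathcal H^1\times\mathcal H}^2=\|w_0\|_1^2+\|w_1\|^2$. For $T>0$, $M\in L^2((0,T);\mathbb C)$, $w_0\in\mathcal H^1$, $w_1\in\mathcal H$, a solution of $$w''(t)+\mathcal A w(t)=\int_0^t M(t-s)\,\mathcal A w(s)\,ds\quad(t\in[0,T]),\qquad w(0)=w_0,\quad w'(0)=w_1\tag{1}$$ is a function $w\in C^1([0,T];\mathcal H)$ with these initial values such that for every $v\in\mathcal D(\mathcal A)$ and $t\in[0,T]$, $$\frac{d}{dt}\langle w'(t),v\rangle=-\langle w(t),\mathcal A v\rangle+\int_0^t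 M(t-s)\langle w(s),\mathcal A v\rangle\,ds.$$ **(B)** Let $\mathcal B:\mathcal D(\mathcal B)\subset\mathcal H\to\mathcal G$ be a linear operator that is closed, or, more generally, closed relative to $\mathcal A$: if $u_n\in\mathcal D(\mathcal A)\cap\mathcal D(\mathcal B)$ and $u_n\to u$, $\mathcal A u_n\to f$, $\mathcal B u_n\to g$, then $u\in\mathcal D(\mathcal A)\cap\mathcal D(\mathcal B)$, $\mathcal Au=f$ and $\mathcal B u=g$. For a solution $w$ and $y\in L^2(0,T;\mathcal G)$ write $\mathcal B w=y$ if $\int_0^t w\,ds\in\mathcal D(\mathcal B)$ and $\mathcal B\int_0^t w\,ds=\int_0^t y\,ds$ for all $t\in[0,T]$ (if $\mathcal B$ is closed, this means exactly that $w(t)\in\mathcal D(\mathcal B)$ and $\mathcal B w(t)=y(t)$ for almost every $t\in[0,T]$). Assume that there is $T_0\ge 0$ such that for every $T>T_0$ there is $C>0$ such that for all $(w_0,w_1)\in\mathcal H^1\times\mathcal H$, if $w$ solves (1) with $M=0$, then $\mathcal Bw\in L^2(0,T;\mathcal G)$ exists and $$C^{-1}\|(w_0,w_1)\|_{\mathcal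 H^1\times\mathcal H}\le\|\mathcal Bw\|_{L^2(0,T;\mathcal G)}\le C\|(w_0,w_1)\|_{\mathcal H^1\times\mathcal H}.$$ **Theorem.** Assume (A) and (B). Let $T>T_0$ and let $M\in H^2((0,T);\mathbb C)$. Then there exists $C>0$ such that for all $(w_0,w_1)\in\mathcal H^1\times\mathcal H$, if $w$ solves (1), then $\mathcal Bw\in L^2(0,T;\mathcal G)$ exists and $$\|(w_0,w_1)\|_{\mathcal H^1\times\mathcal H}\le C\,\|\mathcal Bw\|_{L^2(0,T;\mathcal G)}.$$ -/

import Mathlib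

open MeasureTheory Set Filter Topology
open scoped ENNReal ContDiff InnerProductSpace

noncomputable section

namespace Visco

/-! ### Square-integrable functions and the Sobolev space of order two on an interval -/

/-- Lebesgue measure on `[0, T]`. -/
abbrev vol (T : ℝ) : Measure ℝ := volume.restrict (Icc 0 T)

/-- `g` is the weak derivative of `f` on the open interval `(0, T)`. -/
def IsWeakDeriv (T : ℝ) (f g : ℝ → ℂ) : Prop :=
  ∀ φ : ℝ → ℂ, ContDiff ℝ ∞ φ → HasCompactSupport φ → tsupport φ ⊆ Ioo 0 T →
    ∫ t in Icc 0 T, f t * deriv φ t = - ∫ t in Icc 0 T, g t * φ t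

/-- `M` belongs to `H²(0, T)`: it is square integrable, with square-integrable weak derivatives
of orders one and two. -/
def MemH2 (T : ℝ) (M : ℝ → ℂ) : Prop :=
  ∃ M₁ M₂ : ℝ → ℂ, MemLp M 2 (vol T) ∧ MemLp M₁ 2 (vol T) ∧ MemLp M₂ 2 (vol T) ∧
    IsWeakDeriv T M M₁ ∧ IsWeakDeriv T M₁ M₂

variable {H G : Type*} [NormedAddCommGroup H] [InnerProductSpace ℂ H]
  [NormedAddCommGroup G] [InnerProductSpace ℂ G]

/-! ### The operator `A` and its energy space -/

/-- The bounded operator `R` is the inverse of `A - z`. -/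
def IsResolventAt (A : H →ₗ.[ℂ] H) (z : ℂ) (R : H →L[ℂ] H) : Prop :=
  (∀ f : H, ∃ h : R f ∈ A.domain, A ⟨R f, h⟩ - z • R f = f) ∧
    ∀ u : A.domain, R (A u - z • (u : H)) = u

/-- `A` has compact resolvent. -/
def HasCompactResolvent (A : H →ₗ.[ℂ] H) : Prop :=
  ∃ (z : ℂ) (R : H →L[ℂ] H), IsResolventAt A z R ∧ IsCompactOperator R

/-- `A` is semibounded: `⟪A u, u⟫ ≥ -c ‖u‖²` on the domain, for some `c > 0`. -/
def IsSemibounded (A : H →ₗ.[ℂ] H) : Prop :=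
  ∃ c : ℝ, 0 < c ∧ ∀ u : A.domain, -c * ‖(u : H)‖ ^ 2 ≤ (⟪A u, (u : H)⟫_ℂ).re

/-- Assumption (A): `A` is self-adjoint (in particular closed and densely defined), semibounded,
with compact resolvent. -/
structure AssumptionA [CompleteSpace H] (A : H →ₗ.[ℂ] H) : Prop where
  selfAdjoint : IsSelfAdjoint A
  compactResolvent : HasCompactResolvent A
  semibounded : IsSemibounded A

/-- The eigenspace `{u ∈ D(A) : A u = μ u}`. -/
def eigenspace (A : H →ₗ.[ℂ] H) (μ : ℝ) : Submodule ℂ H :=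
  A.graph.comap (LinearMap.id.prod ((μ : ℂ) • LinearMap.id))

/-- The spectral projection of `A` at the real number `μ`, i.e. the orthogonal projection onto the
eigenspace. (The eigenspace of a closed operator is closed; the closure is taken so that the
projection makes sense for every `A`.) -/
def eigenproj [CompleteSpace H] (A : H →ₗ.[ℂ] H) (μ : ℝ) : H →L[ℂ] H :=
  (eigenspace A μ).topologicalClosure.starProjection

/-- `x` belongs to `H¹ = D(|A|^{1/2})`. A self-adjoint `A` with compact resolvent has pure point
spectrum, so `|A|^{1/2}` acts as `|μ|^{1/2}` on the `μ`-eigenspace and `x` is in its domain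
if and only if `∑_μ |μ| ‖P_μ x‖²` is finite. (This is also the completion of `D(A)` in the
norm of `H¹`, realized inside `H`.) -/
def MemH1 [CompleteSpace H] (A : H →ₗ.[ℂ] H) (x : H) : Prop :=
  Summable fun μ : ℝ => |μ| * ‖eigenproj A μ x‖ ^ 2

/-- `‖ |A|^{1/2} x ‖² = ∑_μ |μ| ‖P_μ x‖²`, for `x ∈ H¹`. -/
def absSqrtNormSq [CompleteSpace H] (A : H →ₗ.[ℂ] H) (x : H) : ℝ :=
  ∑' μ : ℝ, |μ| * ‖eigenproj A μ x‖ ^ 2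

/-- The norm of `(w₀, w₁)` in `H¹ × H`, where `‖x‖₁² = ‖x‖² + ‖ |A|^{1/2} x ‖²`. -/
def energyNorm [CompleteSpace H] (A : H →ₗ.[ℂ] H) (w₀ w₁ : H) : ℝ :=
  √(‖w₀‖ ^ 2 + absSqrtNormSq A w₀ + ‖w₁‖ ^ 2)

/-! ### Solutions -/

/-- `w : [0, T] → H` is the (weak) solution of
`w'' + A w = ∫₀ᵗ M(t - s) A w(s) ds`, `w(0) = w₀`, `w'(0) = w₁`:
it is continuously differentiable into `H`, has the given initial data, and satisfies the equation
on `[0, T]` after taking the inner product with an arbitrary element `v` of `D(A)` and moving the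
self-adjoint operator `A` onto `v`. -/
def IsSolution (A : H →ₗ.[ℂ] H) (M : ℝ → ℂ) (T : ℝ) (w₀ w₁ : H) (w : ℝ → H) : Prop :=
  ∃ w' : ℝ → H,
    (∀ t ∈ Icc 0 T, HasDerivWithinAt w (w' t) (Icc 0 T) t) ∧
    ContinuousOn w' (Icc 0 T) ∧
    w 0 = w₀ ∧ w' 0 = w₁ ∧
    ∀ v : A.domain, ∀ t ∈ Icc 0 T,
      HasDerivWithinAt (fun r => ⟪(v : H), w' r⟫_ℂ)
        (-⟪A v, w t⟫_ℂ + ∫ s in (0 : ℝ)..t, M (t - s) * ⟪A v, w s⟫_ℂ) (Icc 0 T) t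

/-! ### Observation -/

/-- `y` is the observation `B w` of the trajectory `w` on `[0, T]`: for every `t ∈ [0, T]`
the vector `∫₀ᵗ w` lies in `D(B)` and `B ∫₀ᵗ w = ∫₀ᵗ y`. For closed `B` this says exactly that
`w(t) ∈ D(B)` and `B w(t) = y(t)` for almost every `t`, see `isObservation_iff_ae`; this form makes
sense also for observations such as boundary traces of finite-energy solutions, which are not
defined pointwise in time. -/
def IsObservation (B : H →ₗ.[ℂ] G) (T : ℝ) (w : ℝ → H) (y : ℝ → G) : Prop :=
  ∀ t ∈ Icc 0 T, (∫ s in (0 : ℝ)..t, w s, ∫ s in (0 : ℝ)..t, y s) ∈ B.graph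

/-- `B` is closed relative to `A`: its restriction to `D(A) ∩ D(B)` is closed when the domain
carries the graph norm of `A`. That is, if `uₙ ∈ D(A) ∩ D(B)` with `uₙ → u`, `A uₙ → f`,
`B uₙ → g`, then `u ∈ D(A) ∩ D(B)`, `A u = f`, `B u = g`. -/
def IsRelClosed (A : H →ₗ.[ℂ] H) (B : H →ₗ.[ℂ] G) : Prop :=
  IsClosed {p : H × H × G | (p.1, p.2.1) ∈ A.graph ∧ (p.1, p.2.2) ∈ B.graph}

/-- The observability-regularity inequality for the memoryless system on `[0, T]`: there is `C > 0`
such that for all data in `H¹ × H` the solution `w` with `M = 0` has an observation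
`B w ∈ L²(0, T; G)`, and `C⁻¹ ‖(w₀, w₁)‖ ≤ ‖B w‖ ≤ C ‖(w₀, w₁)‖`. -/
def ObservabilityRegularity [CompleteSpace H] (A : H →ₗ.[ℂ] H) (B : H →ₗ.[ℂ] G) (T : ℝ) : Prop :=
  ∃ C : ℝ, 0 < C ∧ ∀ (w₀ w₁ : H) (w : ℝ → H), MemH1 A w₀ → IsSolution A 0 T w₀ w₁ w →
    ∃ y : Lp G 2 (vol T), IsObservation B T w y ∧
      C⁻¹ * energyNorm A w₀ w₁ ≤ ‖y‖ ∧ ‖y‖ ≤ C * energyNorm A w₀ w₁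

/-- Assumption (B), with the time `T₀`. -/
structure AssumptionB [CompleteSpace H] (A : H →ₗ.[ℂ] H) (B : H →ₗ.[ℂ] G) (T₀ : ℝ) : Prop where
  relClosed : IsRelClosed A B
  nonneg : 0 ≤ T₀
  obsReg : ∀ T : ℝ, T₀ < T → ObservabilityRegularity A B T

/-! ### Consistency with the pointwise notions for closed `B` -/

/-- A closed operator is closed relative to every closed operator. -/
theorem IsRelClosed.of_isClosed {A : H →ₗ.[ℂ] H} {B : H →ₗ.[ℂ] G}
    (hA : A.IsClosed) (hB : B.IsClosed) : IsRelClosed A B := by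
  have hA' : IsClosed (A.graph : Set (H × H)) := hA
  have hB' : IsClosed (B.graph : Set (H × G)) := hB
  exact (hA'.preimage (f := fun p : H × H × G => (p.1, p.2.1)) (by fun_prop)).inter
    (hB'.preimage (f := fun p : H × H × G => (p.1, p.2.2)) (by fun_prop))

/-- For closed `B`, `y = B w` if and only if `w(t) ∈ D(B)` and `B w(t) = y(t)` for almost every
`t ∈ [0, T]`. -/
theorem isObservation_iff_ae [CompleteSpace H] [CompleteSpace G] {B : H →ₗ.[ℂ] G}
    (hB : B.IsClosed) {T : ℝ} {w : ℝ → H} (hw : ContinuousOn w (Icc 0 T))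
    (y : Lp G 2 (vol T)) :
    IsObservation B T w y ↔ ∀ᵐ t ∂(vol T), (w t, y t) ∈ B.graph := by
  have hwi : IntegrableOn w (Icc 0 T) := hw.integrableOn_Icc
  have hyi : IntegrableOn y (Icc 0 T) := (Lp.memLp y).integrable (by norm_num)
  have hB' : IsClosed (B.graph : Set (H × G)) := hB
  have hsub : ∀ t ∈ Icc 0 T, Ioc 0 t ⊆ Icc 0 T := fun t ht s hs => ⟨hs.1.le, hs.2.trans ht.2⟩
  constructor
  · intro h
    rcases lt_or_ge 0 T with hT | hT
    swap
    · have hnull : vol T = 0 := by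
        rw [Measure.restrict_eq_zero, Real.volume_Icc]
        simpa using hT
      have hz : ∀ s, vol T s = 0 := fun s => by rw [hnull]; rfl
      exact ae_iff.2 (hz _)
    have hwI : IntervalIntegrable w volume 0 T :=
      (intervalIntegrable_iff_integrableOn_Icc_of_le hT.le).2 hwi
    have hyI : IntervalIntegrable y volume 0 T :=
      (intervalIntegrable_iff_integrableOn_Icc_of_le hT.le).2 hyi
    have hne : ∀ᵐ t : ℝ ∂volume, t ≠ 0 ∧ t ≠ T := by
      have h0 : ∀ᵐ t : ℝ ∂volume, t ≠ 0 := by simp [ae_iff]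
      have h1 : ∀ᵐ t : ℝ ∂volume, t ≠ T := by simp [ae_iff]
      filter_upwards [h0, h1] with t a b using ⟨a, b⟩
    rw [ae_restrict_iff' measurableSet_Icc]
    filter_upwards [hwI.ae_hasDerivAt_integral, hyI.ae_hasDerivAt_integral, hne]
      with t h1 h2 h3 ht
    have hmem : t ∈ uIcc 0 T := by rwa [uIcc_of_le hT.le]
    have h0 : (0 : ℝ) ∈ uIcc 0 T := left_mem_uIcc
    have hd := (h1 hmem 0 h0).prodMk (h2 hmem 0 h0)
    have hlim := hasDerivAt_iff_tendsto_slope.1 hd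
    refine hB'.mem_of_tendsto hlim ?_
    have hnhds : ∀ᶠ r in 𝓝[≠] t, r ∈ Icc 0 T :=
      nhdsWithin_le_nhds (Icc_mem_nhds (lt_of_le_of_ne ht.1 (Ne.symm h3.1))
        (lt_of_le_of_ne ht.2 h3.2))
    filter_upwards [hnhds] with r hr
    rw [slope_def_module]
    exact (B.graph.restrictScalars ℝ).smul_mem (r - t)⁻¹ (B.graph.sub_mem (h r hr) (h t ht))
  · intro h t ht
    rcases ht.1.eq_or_lt with h0 | h0
    · subst h0
      simp
    have h1 : IntegrableOn w (Ioc 0 t) := hwi.mono_set (hsub t ht)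
    have h2 : IntegrableOn y (Ioc 0 t) := hyi.mono_set (hsub t ht)
    have hconv : Convex ℝ (B.graph : Set (H × G)) := (B.graph.restrictScalars ℝ).convex
    have hav := hconv.set_average_mem hB' (μ := volume) (t := Ioc 0 t)
      (f := fun s => (w s, y s)) (by simp [h0]) (by simp)
      (ae_mono (Measure.restrict_mono (hsub t ht) le_rfl) h) (h1.prodMk h2)
    rw [setAverage_eq, integral_pair h1 h2] at hav
    have hav' := (B.graph.restrictScalars ℝ).smul_mem t hav
    rw [intervalIntegral.integral_of_le h0.le, intervalIntegral.integral_of_le h0.le]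
    have ht' : t • ((volume.real (Ioc 0 t))⁻¹ •
        ((∫ s in Ioc 0 t, w s, ∫ s in Ioc 0 t, y s) : H × G)) =
        (∫ s in Ioc 0 t, w s, ∫ s in Ioc 0 t, y s) := by
      rw [Real.volume_real_Ioc_of_le h0.le, sub_zero, smul_smul, mul_inv_cancel₀ h0.ne', one_smul]
    rw [← ht']
    exact hav'

end Visco

end

set_option linter.unusedSectionVars false

noncomputable section

namespace Visco

/-! ### Causal convolution on an interval -/

section Convolution


variable {E : Type*} [NormedAddCommGroup E] [NormedSpace ℂ E]

/-! An orthonormal eigenbasis `e i` of `A` reduces the equation to scalar modes `U'' + λ U = λ (m *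
U)`, with `m` the continuous representative of `M`. Multiplying by `exp (a₀ t / 2)`, where `a₀ = m
0`, turns `U` into `z` and `m` into a kernel `μ`, and `u = z - μ * z` solves `u'' + λ u = β z + κ *
z` with `κ = -μ''`. Differentiating the convolution twice produces a term `-a₀ z'`, which the
exponential factor cancels exactly, so no derivative of `z` is left on the right
(`IsMode.aux_deriv_eq_primitive`). The system with memory is thus a free wave equation with lower
order forcing, seen through the Volterra operator `1 - μ *`, which is boundedly invertible in L² by
Gronwall (`memory_nsq_bounds`).

Assumption (B) on finite sums of eigenvectors is `FreeObs`. Its upper estimate and Duhamel's formula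
bound the observed forcing by a norm one order weaker than the energy (`force_bound`). Hence the
lower estimate holds for modes with memory up to a weaker norm and, since only finitely many
eigenvalues lie below any bound, up to finitely many coefficients (`exists_finite_defect`). An
operator on ℓ² that is bounded below modulo finite rank is bounded below once it is injective
(`bounded_below_of_injective`).

Injectivity is a unique continuation property (`obsKernel_eq_bot`). Let `N` be the
finite-dimensional space of data with vanishing observation. For such data the observed free part is
minus an observed forced part that has a time derivative; observability of difference quotients, on
an interval slightly shorter than `T` but still longer than `T₀`, shows that the data are smoother
(`free_regularity`). After two such gains the vanishing observation may be differentiated twice, and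
the equation shows that `N` is invariant under multiplication of the coefficients by the eigenvalues
(`kernel_invariant`). If `N` were nonzero it would contain an eigenvector, that is, data living on a
single eigenspace of `A`. For those, vanishing of the observation with memory forces vanishing of
the free observation, against (B).

The estimates for finite sums then pass to the limit. Relative closedness of `B` is applicable
because `∫₀ᵗ w` lies in the domain of `A` (`IsMemoryMode.exists_bound_integral`,
`IsEigenbasis.isObservation`). -/

theorem MemLp.intervalIntegrable {f : ℝ → E} {t : ℝ} (ht : 0 ≤ t) (hf : MemLp f 2 (vol t)) :
    IntervalIntegrable f volume 0 t := by
  exact (intervalIntegrable_iff_integrableOn_Icc_of_le ht).2 (hf.integrable (by norm_num))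

/-- The convolution `∫₀ᵗ k(t - s) f(s) ds`. -/
def conv (k : ℝ → ℂ) (f : ℝ → E) (t : ℝ) : E := ∫ s in (0 : ℝ)..t, k (t - s) • f s

theorem conv_comm (k f : ℝ → ℂ) (t : ℝ) : conv k f t = conv f k t := by
  have := intervalIntegral.integral_comp_sub_left (a := 0) (b := t) (fun s => f (t - s) • k s) t
  simp only [sub_sub_cancel, sub_self, sub_zero] at this
  rw [conv, conv, ← this]
  simp only [smul_eq_mul, mul_comm]

theorem conv_congr {k k' : ℝ → ℂ} {f f' : ℝ → E} {t : ℝ} (ht : 0 ≤ t)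
    (hk : ∀ s ∈ Icc 0 t, k s = k' s) (hf : ∀ s ∈ Icc 0 t, f s = f' s) :
    conv k f t = conv k' f' t := by
  refine intervalIntegral.integral_congr fun s hs => ?_
  rw [uIcc_of_le ht] at hs
  rw [hk _ ⟨sub_nonneg.2 hs.2, by linarith [hs.1]⟩, hf s hs]

theorem conv_integrand {k : ℝ → ℂ} {f : ℝ → E} {t : ℝ} (ht : 0 ≤ t)
    (hk : IntervalIntegrable k volume 0 t) (hf : ContinuousOn f (Icc 0 t)) :
    IntervalIntegrable (fun s => k (t - s) • f s) volume 0 t := by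
  have h := hk.comp_sub_left t
  rw [sub_zero, sub_self] at h
  exact h.symm.smul_continuousOn (by rwa [uIcc_of_le ht])

theorem conv_integrand' {k : ℝ → ℂ} {f : ℝ → E} {t : ℝ} (ht : 0 ≤ t)
    (hk : ContinuousOn k (Icc 0 t)) (hf : IntervalIntegrable f volume 0 t) :
    IntervalIntegrable (fun s => k (t - s) • f s) volume 0 t := by
  refine hf.continuousOn_smul ?_
  rw [uIcc_of_le ht]
  exact hk.comp (by fun_prop) fun s hs => ⟨sub_nonneg.2 hs.2, by linarith [hs.1]⟩

theorem conv_const_one (f : ℝ → E) (t : ℝ) : conv (fun _ => 1) f t = ∫ s in (0 : ℝ)..t, f s := by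
  simp [conv]

/-- The convolution as an integral over the line of truncated functions. -/
theorem conv_eq_integral_indicator {k : ℝ → ℂ} {f : ℝ → E} {σ t : ℝ} (h0 : 0 ≤ σ) (h1 : σ ≤ t) :
    conv k f σ = ∫ s, (Ioc 0 t).indicator k (σ - s) • (Ioc 0 t).indicator f s := by
  -- At `s = σ` the truncated kernel is evaluated at `0`, outside `Ioc 0 t`; this endpoint is
  -- removed before the integrands are compared.
  rw [conv, intervalIntegral.integral_of_le h0, integral_Ioc_eq_integral_Ioo,
    ← integral_indicator measurableSet_Ioo]
  congr 1
  ext s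
  by_cases hs : s ∈ Ioo 0 σ
  · rw [indicator_of_mem hs, indicator_of_mem (show σ - s ∈ Ioc 0 t from ⟨by linarith [hs.2],
      by linarith [hs.1]⟩), indicator_of_mem (show s ∈ Ioc 0 t from ⟨hs.1, by linarith [hs.2]⟩)]
  · rw [indicator_of_notMem hs]
    by_cases h2 : s ∈ Ioc 0 t
    · rw [indicator_of_notMem (show σ - s ∉ Ioc 0 t from fun h => hs ⟨h2.1, by linarith [h.1]⟩),
        zero_smul]
    · rw [indicator_of_notMem h2, smul_zero]

theorem conv_integrable_prod {k : ℝ → ℂ} {f : ℝ → E} {t : ℝ}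
    (ht : 0 ≤ t) (hk : IntervalIntegrable k volume 0 t) (hf : IntervalIntegrable f volume 0 t) : Integrable (fun p : ℝ × ℝ => (Ioc 0 t).indicator k (p.1 - p.2) •
      (Ioc 0 t).indicator f p.2) (volume.prod volume) := by
  have h1 : Integrable ((Ioc 0 t).indicator k) := by
    rw [integrable_indicator_iff measurableSet_Ioc]
    exact (intervalIntegrable_iff_integrableOn_Ioc_of_le ht).1 hk
  have h2 : Integrable ((Ioc 0 t).indicator f) := by
    rw [integrable_indicator_iff measurableSet_Ioc]
    exact (intervalIntegrable_iff_integrableOn_Ioc_of_le ht).1 hf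
  exact h2.convolution_integrand (ContinuousLinearMap.lsmul ℂ ℂ).flip h1

theorem conv_intervalIntegrable {k : ℝ → ℂ} {f : ℝ → E} {t : ℝ}
    (ht : 0 ≤ t) (hk : IntervalIntegrable k volume 0 t) (hf : IntervalIntegrable f volume 0 t) : IntervalIntegrable (conv k f) volume 0 t := by
  rw [intervalIntegrable_iff_integrableOn_Ioc_of_le ht]
  have := (conv_integrable_prod ht hk hf).integral_prod_left
  refine (this.integrableOn (s := Ioc 0 t)).congr_fun (fun σ hσ => ?_) measurableSet_Ioc
  exact (conv_eq_integral_indicator hσ.1.le hσ.2).symm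

/-- Integrating a convolution integrates its kernel. -/
theorem integral_conv [CompleteSpace E] {k : ℝ → ℂ} {f : ℝ → E} {t : ℝ}
    (ht : 0 ≤ t) (hk : IntervalIntegrable k volume 0 t) (hf : IntervalIntegrable f volume 0 t) :
    ∫ σ in (0 : ℝ)..t, conv k f σ = conv (fun r => ∫ s in (0 : ℝ)..r, k s) f t := by
  have h1 : ∫ σ in (0 : ℝ)..t, conv k f σ = ∫ σ in Ioc 0 t, ∫ s,
      (Ioc 0 t).indicator k (σ - s) • (Ioc 0 t).indicator f s := by
    rw [intervalIntegral.integral_of_le ht]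
    exact setIntegral_congr_fun measurableSet_Ioc fun σ hσ =>
      conv_eq_integral_indicator hσ.1.le hσ.2
  have hint := conv_integrable_prod ht hk hf
  have hint' : Integrable (Function.uncurry fun σ s : ℝ => (Ioc 0 t).indicator k (σ - s) •
      (Ioc 0 t).indicator f s) ((volume.restrict (Ioc 0 t)).prod volume) :=
    hint.mono_measure (by
      rw [Measure.restrict_prod_eq_prod_univ]; exact Measure.restrict_le_self)
  rw [h1, integral_integral_swap hint', conv, intervalIntegral.integral_of_le ht,
    ← integral_indicator measurableSet_Ioc]
  congr 1
  ext s
  rw [integral_smul_const]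
  by_cases hs : s ∈ Ioc 0 t
  · rw [indicator_of_mem hs, indicator_of_mem hs]
    congr 1
    rw [← intervalIntegral.integral_of_le ht,
      intervalIntegral.integral_comp_sub_right (fun x => (Ioc 0 t).indicator k x) s]
    have hii : ∀ a b, IntervalIntegrable ((Ioc 0 t).indicator k) volume a b := fun a b =>
      ((integrable_indicator_iff measurableSet_Ioc).2
        ((intervalIntegrable_iff_integrableOn_Ioc_of_le ht).1 hk)).intervalIntegrable
    -- Causality: the truncated kernel vanishes on the negative half-line, so only `[0, t - s]`
    -- contributes.
    rw [← intervalIntegral.integral_add_adjacent_intervals (hii (0 - s) 0) (hii 0 (t - s))]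
    have ha : ∫ x in (0 - s)..0, (Ioc 0 t).indicator k x = 0 := by
      rw [intervalIntegral.integral_of_le (by linarith [hs.1])]
      refine setIntegral_eq_zero_of_forall_eq_zero fun x hx => ?_
      exact indicator_of_notMem (fun h => absurd h.1 (not_lt.2 hx.2)) _
    rw [ha, zero_add]
    refine intervalIntegral.integral_congr_ae (Eventually.of_forall fun x hx => ?_)
    rw [uIoc_of_le (by linarith [hs.2])] at hx
    exact indicator_of_mem (show x ∈ Ioc 0 t from ⟨hx.1, by linarith [hx.2, hs.1]⟩) _
  · rw [indicator_of_notMem hs, indicator_of_notMem hs, smul_zero]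

theorem conv_primitive {k f : ℝ → ℂ} {t : ℝ} (ht : 0 ≤ t)
    (hk : IntervalIntegrable k volume 0 t) (hf : IntervalIntegrable f volume 0 t) :
    conv k (fun r => ∫ s in (0 : ℝ)..r, f s) t = ∫ s in (0 : ℝ)..t, conv k f s := by
  rw [conv_comm, ← integral_conv ht hf hk]
  exact intervalIntegral.integral_congr fun s _ => conv_comm f k s

theorem conv_add_right {k : ℝ → ℂ} {f g : ℝ → E} {t : ℝ}
    (hf : IntervalIntegrable (fun s => k (t - s) • f s) volume 0 t)
    (hg : IntervalIntegrable (fun s => k (t - s) • g s) volume 0 t) :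
    conv k (fun s => f s + g s) t = conv k f t + conv k g t := by
  simp only [conv, smul_add]
  exact intervalIntegral.integral_add hf hg

theorem conv_const_mul_right (k f : ℝ → ℂ) (c : ℂ) (t : ℝ) :
    conv k (fun s => c * f s) t = c * conv k f t := by
  simp only [conv, smul_eq_mul]
  rw [← intervalIntegral.integral_const_mul]
  congr 1; ext s; ring

theorem conv_const_mul_left (k f : ℝ → ℂ) (c : ℂ) (t : ℝ) :
    conv (fun s => c * k s) f t = c * conv k f t := by
  simp only [conv, smul_eq_mul]
  rw [← intervalIntegral.integral_const_mul]
  congr 1; ext s; ring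

theorem conv_const_right (k : ℝ → ℂ) (c : ℂ) (t : ℝ) :
    conv k (fun _ => c) t = c * ∫ s in (0 : ℝ)..t, k s := by
  rw [conv_comm, conv, ← intervalIntegral.integral_const_mul]
  rfl

theorem continuousOn_primitive_Icc {k : ℝ → E} {t : ℝ} (ht : 0 ≤ t)
    (hk : IntervalIntegrable k volume 0 t) :
    ContinuousOn (fun r => ∫ s in (0 : ℝ)..r, k s) (Icc 0 t) := by
  have := intervalIntegral.continuousOn_primitive_interval' hk left_mem_uIcc
  rwa [uIcc_of_le ht] at this

/-- Convolution with an absolutely continuous function is absolutely continuous. -/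
theorem conv_affine_primitive {k f f₁ : ℝ → ℂ} {c : ℂ} {t : ℝ} (ht : 0 ≤ t)
    (hk : IntervalIntegrable k volume 0 t) (hf : IntervalIntegrable f₁ volume 0 t)
    (h : ∀ r ∈ Icc 0 t, f r = c + ∫ s in (0 : ℝ)..r, f₁ s) :
    conv k f t = ∫ s in (0 : ℝ)..t, (c * k s + conv k f₁ s) := by
  have h1 : conv k f t = conv k (fun r => c + ∫ s in (0 : ℝ)..r, f₁ s) t :=
    conv_congr ht (fun _ _ => rfl) h
  rw [h1, conv_add_right (conv_integrand ht hk continuousOn_const)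
    (conv_integrand ht hk (continuousOn_primitive_Icc ht hf)), conv_const_right,
    conv_primitive ht hk hf,
    intervalIntegral.integral_add (hk.const_mul c) (conv_intervalIntegrable ht hk hf),
    intervalIntegral.integral_const_mul]

theorem conv_affine_primitive_left {k k₁ : ℝ → ℂ} {f : ℝ → ℂ} {c : ℂ} {t : ℝ} (ht : 0 ≤ t)
    (hk : IntervalIntegrable k₁ volume 0 t) (hf : IntervalIntegrable f volume 0 t)
    (h : ∀ r ∈ Icc 0 t, k r = c + ∫ s in (0 : ℝ)..r, k₁ s) :
    conv k f t = ∫ s in (0 : ℝ)..t, (c * f s + conv k₁ f s) := by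
  rw [conv_comm, conv_affine_primitive ht hf hk h]
  exact intervalIntegral.integral_congr fun s _ => by simp only [conv_comm f k₁]

theorem continuousOn_primitive_of_eq {f g : ℝ → E} {T : ℝ} {c : E}
    (hg : IntervalIntegrable g volume 0 T) (hT : 0 ≤ T)
    (h : ∀ t ∈ Icc 0 T, f t = c + ∫ s in (0 : ℝ)..t, g s) : ContinuousOn f (Icc 0 T) := by
  exact (continuousOn_const.add (continuousOn_primitive_Icc hT hg)).congr h

/-- When one factor is absolutely continuous the convolution is itself a primitive, so mere
integrability of the kernel suffices. -/
theorem conv_continuousOn {k f f₁ : ℝ → ℂ} {c : ℂ} {T : ℝ} (hT : 0 ≤ T)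
    (hk : IntervalIntegrable k volume 0 T) (hf : IntervalIntegrable f₁ volume 0 T)
    (h : ∀ r ∈ Icc 0 T, f r = c + ∫ s in (0 : ℝ)..r, f₁ s) :
    ContinuousOn (conv k f) (Icc 0 T) := by
  refine continuousOn_primitive_of_eq (g := fun s => c * k s + conv k f₁ s) (c := 0)
    ((hk.const_mul c).add (conv_intervalIntegrable hT hk hf)) hT fun t ht => ?_
  have hsub : uIcc 0 t ⊆ uIcc 0 T := by
    rw [uIcc_of_le ht.1, uIcc_of_le hT]; exact Icc_subset_Icc_right ht.2
  rw [zero_add]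
  exact conv_affine_primitive ht.1 (hk.mono_set hsub) (hf.mono_set hsub)
    fun r hr => h r ⟨hr.1, hr.2.trans ht.2⟩

end Convolution

/-! ### Square norms on an interval -/

section SquareNorm

variable {E : Type*} [NormedAddCommGroup E] 

/-- The square of the norm of `f` in `L²(0, T)`. -/
def nsq (T : ℝ) (f : ℝ → E) : ℝ := ∫ t in Icc 0 T, ‖f t‖ ^ 2

theorem nsq_nonneg (T : ℝ) (f : ℝ → E) : 0 ≤ nsq T f := integral_nonneg fun _ => by positivity

theorem nsq_congr {T : ℝ} {f g : ℝ → E} (h : ∀ t ∈ Icc 0 T, f t = g t) : nsq T f = nsq T g :=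
  setIntegral_congr_fun measurableSet_Icc fun t ht => by simp only [h t ht]

theorem nsq_congr_ae {T : ℝ} {f g : ℝ → E} (h : f =ᵐ[vol T] g) : nsq T f = nsq T g :=
  integral_congr_ae (h.mono fun t ht => by simp only [ht])

theorem memLp_of_continuousOn {T : ℝ} {f : ℝ → E} (hf : ContinuousOn f (Icc 0 T)) :
    MemLp f 2 (vol T) := by
  obtain ⟨C, hC⟩ := isCompact_Icc.exists_bound_of_continuousOn hf
  exact MemLp.of_bound (hf.aestronglyMeasurable measurableSet_Icc) C
    ((ae_restrict_iff' measurableSet_Icc).2 (Eventually.of_forall hC))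

theorem integrable_sq {T : ℝ} {f : ℝ → E} (hf : MemLp f 2 (vol T)) :
    Integrable (fun t => ‖f t‖ ^ 2) (vol T) := hf.integrable_norm_pow (p := 2) (by norm_num)

theorem nsq_le_integral {T : ℝ} {f : ℝ → E} {g : ℝ → ℝ} (hg : Integrable g (vol T))
    (h : ∀ t ∈ Icc 0 T, ‖f t‖ ^ 2 ≤ g t) : nsq T f ≤ ∫ t in Icc 0 T, g t :=
  integral_mono_of_nonneg (Eventually.of_forall fun _ => by positivity) hg
    ((ae_restrict_iff' measurableSet_Icc).2 (Eventually.of_forall h))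

theorem nsq_le_of_bound {T C : ℝ} (hT : 0 ≤ T) {f : ℝ → E} (h : ∀ t ∈ Icc 0 T, ‖f t‖ ^ 2 ≤ C) :
    nsq T f ≤ T * C := by
  refine (nsq_le_integral (integrable_const C) h).trans_eq ?_
  simp [hT]

theorem sq_norm_add_le (a b : E) : ‖a + b‖ ^ 2 ≤ 2 * ‖a‖ ^ 2 + 2 * ‖b‖ ^ 2 := by
  have := norm_add_le a b
  nlinarith [norm_nonneg (a + b), norm_nonneg a, norm_nonneg b, sq_nonneg (‖a‖ - ‖b‖)]

theorem nsq_add_le {T : ℝ} {f g : ℝ → E} (hf : MemLp f 2 (vol T)) (hg : MemLp g 2 (vol T)) :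
    nsq T (fun t => f t + g t) ≤ 2 * nsq T f + 2 * nsq T g := by
  refine (nsq_le_integral (((integrable_sq hf).const_mul 2).add ((integrable_sq hg).const_mul 2))
    fun t _ => sq_norm_add_le _ _).trans_eq ?_
  rw [integral_add' ((integrable_sq hf).const_mul 2) ((integrable_sq hg).const_mul 2),
    integral_const_mul, integral_const_mul, nsq, nsq]

theorem nsq_sub_le {T : ℝ} {f g : ℝ → E} (hf : MemLp f 2 (vol T)) (hg : MemLp g 2 (vol T)) :
    nsq T (fun t => f t - g t) ≤ 2 * nsq T f + 2 * nsq T g := by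
  have := nsq_add_le hf hg.neg
  simpa [sub_eq_add_neg, nsq] using this

theorem nsq_const_smul [NormedSpace ℂ E] (T : ℝ) (f : ℝ → E) (c : ℂ) :
    nsq T (fun t => c • f t) = ‖c‖ ^ 2 * nsq T f := by
  simp only [nsq, norm_smul, mul_pow]
  exact integral_const_mul _ _

theorem nsq_mono_interval {t T : ℝ} (htT : t ≤ T) {f : ℝ → E} (hf : MemLp f 2 (vol T)) :
    nsq t f ≤ nsq T f :=
  setIntegral_mono_set (integrable_sq hf) (Eventually.of_forall fun _ => by positivity)
    (Icc_subset_Icc_right htT).eventuallyLE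

theorem ofReal_nsq {T : ℝ} {f : ℝ → E} (hf : MemLp f 2 (vol T)) :
    ENNReal.ofReal (nsq T f) = ∫⁻ t in Icc 0 T, ‖f t‖ₑ ^ 2 := by
  rw [nsq, ofReal_integral_eq_lintegral_ofReal (integrable_sq hf)
    (Eventually.of_forall fun _ => by positivity)]
  congr 1
  ext t
  rw [ENNReal.ofReal_pow (norm_nonneg _), ofReal_norm]

/-- Estimates that need Tonelli are carried out with `∫⁻`, where no integrability has to be checked,
and are brought back to `nsq` here. -/
theorem nsq_le_of_lintegral_le {T C : ℝ} (hC : 0 ≤ C) {f : ℝ → E} (hf : MemLp f 2 (vol T))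
    (h : ∫⁻ t in Icc 0 T, ‖f t‖ₑ ^ 2 ≤ ENNReal.ofReal C) : nsq T f ≤ C := by
  rw [← ofReal_nsq hf] at h
  exact (ENNReal.ofReal_le_ofReal_iff hC).1 h

theorem nsq_eq_norm_toLp {T : ℝ} {f : ℝ → E} (hf : MemLp f 2 (vol T)) :
    nsq T f = ‖hf.toLp f‖ ^ 2 := by
  have h := ofReal_nsq hf
  have h2 : (‖hf.toLp f‖ₑ) ^ 2 = ∫⁻ t in Icc 0 T, ‖f t‖ₑ ^ 2 := by
    rw [Lp.enorm_toLp, eLpNorm_eq_lintegral_rpow_enorm_toReal (by norm_num) (by norm_num)]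
    simp only [ENNReal.toReal_ofNat, ENNReal.rpow_ofNat]
    rw [← ENNReal.rpow_natCast, ← ENNReal.rpow_mul]
    norm_num
  rw [← h2, ← ofReal_norm, ← ENNReal.ofReal_pow (norm_nonneg _)] at h
  exact (ENNReal.ofReal_eq_ofReal_iff (nsq_nonneg _ _) (by positivity)).1 h

theorem sq_integral_mul_le {ν : Measure ℝ} {a b : ℝ → ℝ} (ha0 : ∀ t, 0 ≤ a t) (hb0 : ∀ t, 0 ≤ b t)
    (ha : MemLp a 2 ν) (hb : MemLp b 2 ν) :
    (∫ t, a t * b t ∂ν) ^ 2 ≤ (∫ t, a t ^ 2 ∂ν) * ∫ t, b t ^ 2 ∂ν := by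
  have h := integral_mul_le_Lp_mul_Lq_of_nonneg (μ := ν) Real.HolderConjugate.two_two
    (Eventually.of_forall ha0) (Eventually.of_forall hb0) (by simpa using ha) (by simpa using hb)
  have h0 : 0 ≤ ∫ t, a t * b t ∂ν := integral_nonneg fun t => mul_nonneg (ha0 t) (hb0 t)
  simp only [Real.rpow_ofNat, ← Real.sqrt_eq_rpow] at h
  calc _ ≤ (√(∫ t, a t ^ 2 ∂ν) * √(∫ t, b t ^ 2 ∂ν)) ^ 2 := by gcongr
    _ = _ := by
      rw [mul_pow, Real.sq_sqrt (integral_nonneg fun t => by positivity),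
        Real.sq_sqrt (integral_nonneg fun t => by positivity)]

theorem memLp_mono_interval {t T : ℝ} (htT : t ≤ T) {f : ℝ → E} (hf : MemLp f 2 (vol T)) :
    MemLp f 2 (vol t) :=
  hf.mono_measure (Measure.restrict_mono (Icc_subset_Icc_right htT) le_rfl)

theorem MemLp.reflect {t : ℝ} {f : ℝ → E} (hf : MemLp f 2 (vol t)) :
    MemLp (fun s => f (t - s)) 2 (vol t) := by
  have h := (Measure.measurePreserving_sub_left volume t).restrict_preimage
    (measurableSet_Icc (a := (0 : ℝ)) (b := t))
  have h2 : (fun s => t - s) ⁻¹' Icc 0 t = Icc 0 t := by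
    ext s
    simp only [mem_preimage, mem_Icc]
    constructor <;> rintro ⟨h1, h2⟩ <;> constructor <;> linarith
  rw [h2] at h
  exact hf.comp_measurePreserving h

theorem sq_integral_norm_le {T t : ℝ} (ht : t ∈ Icc 0 T) {f : ℝ → E} (hf : MemLp f 2 (vol T)) :
    (∫ s in (0 : ℝ)..t, ‖f s‖) ^ 2 ≤ T * nsq T f := by
  have hf' := memLp_mono_interval ht.2 hf
  have h := sq_integral_mul_le (ν := vol t) (a := fun _ => 1) (b := fun s => ‖f s‖)
    (fun _ => zero_le_one) (fun _ => norm_nonneg _) (memLp_const 1) hf'.norm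
  rw [intervalIntegral.integral_of_le ht.1, ← integral_Icc_eq_integral_Ioc]
  simp only [one_mul, one_pow] at h
  refine h.trans ?_
  have h1 : ∫ _ in Icc 0 t, (1 : ℝ) = t := by simp [ht.1]
  rw [h1]
  exact mul_le_mul ht.2 (nsq_mono_interval ht.2 hf) (nsq_nonneg _ _) (ht.1.trans ht.2)

theorem sq_norm_integral_le [NormedSpace ℝ E] {T t : ℝ} (ht : t ∈ Icc 0 T) {f : ℝ → E}
    (hf : MemLp f 2 (vol T)) : ‖∫ s in (0 : ℝ)..t, f s‖ ^ 2 ≤ T * nsq T f := by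
  refine le_trans ?_ (sq_integral_norm_le ht hf)
  gcongr
  exact intervalIntegral.norm_integral_le_integral_norm ht.1

/-- Cauchy–Schwarz, after the reflection `s ↦ t - s`, which preserves the square norm of the kernel
on `[0, t]`. The bound is pointwise in `t`, so a kernel that is only square integrable maps L² into
bounded functions. -/
theorem sq_norm_conv_le [NormedSpace ℂ E] {T t : ℝ} (ht : t ∈ Icc 0 T) {k : ℝ → ℂ} {f : ℝ → E}
    (hk : MemLp k 2 (vol T)) (hf : MemLp f 2 (vol T)) :
    ‖conv k f t‖ ^ 2 ≤ nsq T k * nsq T f := by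
  have hf' := memLp_mono_interval ht.2 hf
  have hk' := memLp_mono_interval ht.2 hk
  have h := sq_integral_mul_le (ν := vol t) (a := fun s => ‖k (t - s)‖) (b := fun s => ‖f s‖)
    (fun _ => norm_nonneg _) (fun _ => norm_nonneg _) (MemLp.reflect hk').norm hf'.norm
  have h1 : ‖conv k f t‖ ≤ ∫ s in Icc 0 t, ‖k (t - s)‖ * ‖f s‖ := by
    refine (intervalIntegral.norm_integral_le_integral_norm ht.1).trans_eq ?_
    rw [intervalIntegral.integral_of_le ht.1, ← integral_Icc_eq_integral_Ioc]
    simp only [norm_smul]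
  have h2 : ∫ s in Icc 0 t, ‖k (t - s)‖ ^ 2 = nsq t k := by
    rw [nsq, integral_Icc_eq_integral_Ioc, integral_Icc_eq_integral_Ioc,
      ← intervalIntegral.integral_of_le ht.1, ← intervalIntegral.integral_of_le ht.1,
      intervalIntegral.integral_comp_sub_left (fun s => ‖k s‖ ^ 2)]
    simp
  rw [h2] at h
  calc ‖conv k f t‖ ^ 2 ≤ (∫ s in Icc 0 t, ‖k (t - s)‖ * ‖f s‖) ^ 2 := by gcongr
    _ ≤ nsq t k * nsq t f := h
    _ ≤ _ := mul_le_mul (nsq_mono_interval ht.2 hk) (nsq_mono_interval ht.2 hf) (nsq_nonneg _ _)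
      (nsq_nonneg _ _)

/-- Gronwall's inequality in integrated form. -/
theorem integral_le_of_le_add_integral {T K : ℝ} (hT : 0 ≤ T) (hK : 0 ≤ K) {a g : ℝ → ℝ}
    (ha : ContinuousOn a (Icc 0 T)) (hg : ContinuousOn g (Icc 0 T)) (hg0 : ∀ t ∈ Icc 0 T, 0 ≤ g t)
    (h : ∀ t ∈ Icc 0 T, a t ≤ g t + K * ∫ s in (0 : ℝ)..t, a s) :
    ∀ t ∈ Icc 0 T, ∫ s in (0 : ℝ)..t, a s ≤ Real.exp (K * T) * ∫ s in (0 : ℝ)..T, g s := by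
  -- By hypothesis the derivative of this function is at most `(exp (-K t) - 1) g t`, which is
  -- nonpositive.
  have key : AntitoneOn (fun t => Real.exp (-K * t) * (∫ s in (0 : ℝ)..t, a s) -
      ∫ s in (0 : ℝ)..t, g s) (Icc 0 T) := by
    have hai : IntervalIntegrable a volume 0 T := ha.intervalIntegrable_of_Icc hT
    have hgi : IntervalIntegrable g volume 0 T := hg.intervalIntegrable_of_Icc hT
    have hd : ∀ (f : ℝ → ℝ), ContinuousOn f (Icc 0 T) → ∀ t ∈ Ioo 0 T,
        HasDerivAt (fun t => ∫ s in (0 : ℝ)..t, f s) (f t) t := fun f hf t ht =>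
      intervalIntegral.integral_hasDerivAt_right
        ((hf.mono (Icc_subset_Icc_right ht.2.le)).intervalIntegrable_of_Icc ht.1.le)
        (hf.mono Ioo_subset_Icc_self |>.stronglyMeasurableAtFilter isOpen_Ioo t ht)
        (hf.continuousAt (Icc_mem_nhds ht.1 ht.2))
    have hD : ∀ t ∈ Ioo 0 T, HasDerivAt (fun t => Real.exp (-K * t) * (∫ s in (0 : ℝ)..t, a s) -
        ∫ s in (0 : ℝ)..t, g s) ((Real.exp (-K * t) * (-K * 1)) * (∫ s in (0 : ℝ)..t, a s) +
          Real.exp (-K * t) * a t - g t) t := fun t ht =>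
      ((((hasDerivAt_id t).const_mul (-K)).exp).mul (hd a ha t ht)).sub (hd g hg t ht)
    refine antitoneOn_of_deriv_nonpos (convex_Icc _ _) ?_ ?_ ?_
    · have h1 := intervalIntegral.continuousOn_primitive_interval' hai left_mem_uIcc
      have h2 := intervalIntegral.continuousOn_primitive_interval' hgi left_mem_uIcc
      rw [uIcc_of_le hT] at h1 h2
      exact ((by fun_prop : Continuous fun t : ℝ => Real.exp (-K * t)).continuousOn.mul h1).sub h2
    · rw [interior_Icc]
      exact fun t ht => (hD t ht).differentiableAt.differentiableWithinAt
    · rw [interior_Icc]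
      intro t ht
      rw [(hD t ht).deriv]
      have h1 := h t (Ioo_subset_Icc_self ht)
      have h2 := hg0 t (Ioo_subset_Icc_self ht)
      have h3 : Real.exp (-K * t) ≤ 1 := Real.exp_le_one_iff.2 (by nlinarith [ht.1])
      have h4 := Real.exp_pos (-K * t)
      nlinarith
  intro t ht
  have h1 := key (left_mem_Icc.2 hT) ht ht.1
  simp only [intervalIntegral.integral_same, mul_zero, sub_zero] at h1
  have hgi : ∀ x y, x ∈ Icc 0 T → y ∈ Icc 0 T → x ≤ y → IntervalIntegrable g volume x y :=
    fun x y hx hy hxy => (hg.mono (Icc_subset_Icc hx.1 hy.2)).intervalIntegrable_of_Icc hxy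
  have h2 : ∫ s in (0 : ℝ)..t, g s ≤ ∫ s in (0 : ℝ)..T, g s := by
    rw [← intervalIntegral.integral_add_adjacent_intervals
      (hgi 0 t (left_mem_Icc.2 hT) ht ht.1) (hgi t T ht (right_mem_Icc.2 hT) ht.2)]
    have := intervalIntegral.integral_nonneg ht.2 (f := g) (μ := volume)
      fun s hs => hg0 s ⟨ht.1.trans hs.1, hs.2⟩
    linarith
  have h3 : 0 ≤ ∫ s in (0 : ℝ)..T, g s := intervalIntegral.integral_nonneg hT hg0
  have h4 : ∫ s in (0 : ℝ)..t, a s =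
      Real.exp (K * t) * (Real.exp (-K * t) * ∫ s in (0 : ℝ)..t, a s) := by
    rw [← mul_assoc, ← Real.exp_add]; simp
  rw [h4]
  calc _ ≤ Real.exp (K * t) * ∫ s in (0 : ℝ)..T, g s :=
        mul_le_mul_of_nonneg_left (by linarith) (Real.exp_pos _).le
    _ ≤ _ := mul_le_mul_of_nonneg_right
        (Real.exp_le_exp.2 (mul_le_mul_of_nonneg_left ht.2 hK)) h3

/-- Used with `u = z - μ * z`: Gronwall controls `∫ ‖z‖` by `∫ ‖u‖`, which makes the inverse of the
Volterra operator `1 - μ *` bounded in L², with a constant depending on `T` and `K` only. -/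
theorem nsq_le_of_le_add_integral {T K : ℝ} (hT : 0 ≤ T) (hK : 0 ≤ K) {z u : ℝ → E}
    (hz : ContinuousOn z (Icc 0 T)) (hu : ContinuousOn u (Icc 0 T))
    (h : ∀ t ∈ Icc 0 T, ‖z t‖ ≤ ‖u t‖ + K * ∫ s in (0 : ℝ)..t, ‖z s‖) :
    nsq T z ≤ (2 + 2 * T ^ 2 * (K * Real.exp (K * T)) ^ 2) * nsq T u := by
  have hg := integral_le_of_le_add_integral hT hK hz.norm hu.norm (fun _ _ => norm_nonneg _) h
  have hu2 := memLp_of_continuousOn hu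
  have hI := sq_integral_norm_le (right_mem_Icc.2 hT) hu2
  set I := ∫ s in (0 : ℝ)..T, ‖u s‖
  set D := K * Real.exp (K * T)
  have hD : 0 ≤ D := by positivity
  have hI0 : 0 ≤ I := intervalIntegral.integral_nonneg hT fun _ _ => norm_nonneg _
  have h1 : ∀ t ∈ Icc 0 T, ‖z t‖ ^ 2 ≤ 2 * ‖u t‖ ^ 2 + 2 * (D * I) ^ 2 := by
    intro t ht
    have h2 : ‖z t‖ ≤ ‖u t‖ + D * I := (h t ht).trans (by
      have := mul_le_mul_of_nonneg_left (hg t ht) hK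
      linarith)
    nlinarith [norm_nonneg (z t), norm_nonneg (u t), sq_nonneg (‖u t‖ - D * I)]
  refine (nsq_le_integral (((integrable_sq hu2).const_mul 2).add (integrable_const _)) h1).trans ?_
  rw [integral_add' ((integrable_sq hu2).const_mul 2) (integrable_const _), integral_const_mul]
  have h3 : ∫ _ in Icc 0 T, 2 * (D * I) ^ 2 = T * (2 * (D * I) ^ 2) := by simp [hT]
  rw [h3, ← nsq]
  have h4 : D ^ 2 * I ^ 2 ≤ D ^ 2 * (T * nsq T u) := by gcongr
  nlinarith

theorem norm_le_of_sq_gronwall {T K A : ℝ} (hT : 0 ≤ T) (hK : 0 ≤ K) {z : ℝ → E}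
    (hz : ContinuousOn z (Icc 0 T)) (hA : 0 ≤ A)
    (h : ∀ t ∈ Icc 0 T, ‖z t‖ ^ 2 ≤ A + K * ∫ s in (0 : ℝ)..t, ‖z s‖ ^ 2) :
    ∀ t ∈ Icc 0 T, ‖z t‖ ^ 2 ≤ (1 + K * (Real.exp (K * T) * T)) * A := by
  intro t ht
  have := integral_le_of_le_add_integral hT hK (hz.norm.pow 2) (continuousOn_const (c := A))
    (fun _ _ => hA) h t ht
  simp only [intervalIntegral.integral_const, sub_zero, smul_eq_mul] at this
  have h2 := mul_le_mul_of_nonneg_left this hK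
  simp only [Pi.pow_apply] at h2
  have h3 := h t ht
  nlinarith

end SquareNorm

/-! ### Sums of vectors with time-dependent coefficients -/

section VectorSums

variable {ι G : Type*} [NormedAddCommGroup G] [NormedSpace ℂ G]

/-- The function `t ↦ ∑_{i ∈ s} ψ_i(t) b_i`. -/
def vs (s : Finset ι) (ψ : ι → ℝ → ℂ) (b : ι → G) (t : ℝ) : G := ∑ i ∈ s, ψ i t • b i

variable {s : Finset ι} {b : ι → G} {T : ℝ}

theorem vs_memLp {ψ : ι → ℝ → ℂ} (h : ∀ i, MemLp (ψ i) 2 (vol T)) :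
    MemLp (vs s ψ b) 2 (vol T) := by
  refine memLp_finsetSum s fun i _ => ?_
  exact ((ContinuousLinearMap.toSpanSingleton ℂ (b i)).comp_memLp' (h i))

theorem vs_continuousOn {ψ : ι → ℝ → ℂ} {S : Set ℝ} (h : ∀ i, ContinuousOn (ψ i) S) :
    ContinuousOn (vs s ψ b) S :=
  continuousOn_finsetSum _ fun i _ => (h i).smul continuousOn_const

theorem vs_congr {ψ φ : ι → ℝ → ℂ} {t : ℝ} (h : ∀ i, ψ i t = φ i t) :
    vs s ψ b t = vs s φ b t := by simp only [vs, h]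

theorem vs_add (ψ φ : ι → ℝ → ℂ) (t : ℝ) :
    vs s (fun i t => ψ i t + φ i t) b t = vs s ψ b t + vs s φ b t := by
  simp only [vs, add_smul, Finset.sum_add_distrib]

theorem vs_sub (ψ φ : ι → ℝ → ℂ) (t : ℝ) :
    vs s (fun i t => ψ i t - φ i t) b t = vs s ψ b t - vs s φ b t := by
  simp only [vs, sub_smul, Finset.sum_sub_distrib]

theorem vs_const_mul (ψ : ι → ℝ → ℂ) (c : ℝ → ℂ) (t : ℝ) :
    vs s (fun i t => c t * ψ i t) b t = c t • vs s ψ b t := by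
  simp only [vs, mul_smul, Finset.smul_sum]

theorem integral_vs {ψ : ι → ℝ → ℂ} {x y : ℝ}
    (h : ∀ i, IntervalIntegrable (ψ i) volume x y) [CompleteSpace G] :
    ∫ r in x..y, vs s ψ b r = ∑ i ∈ s, (∫ r in x..y, ψ i r) • b i := by
  simp only [vs]
  rw [intervalIntegral.integral_finsetSum fun i _ =>
    (show IntervalIntegrable (fun r => ψ i r • b i) volume x y from
      ⟨(h i).1.smul_const (b i), (h i).2.smul_const (b i)⟩)]
  simp only [intervalIntegral.integral_smul_const]

theorem vs_conv [CompleteSpace G] {k : ℝ → ℂ} {ψ : ι → ℝ → ℂ} {t : ℝ}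
    (h : ∀ i, IntervalIntegrable (fun r => k (t - r) * ψ i r) volume 0 t) :
    vs s (fun i => conv k (ψ i)) b t = conv k (vs s ψ b) t := by
  have := integral_vs (s := s) (b := b) (ψ := fun i r => k (t - r) * ψ i r) h
  simp only [conv, vs, smul_eq_mul, Finset.smul_sum, ← mul_smul] at this ⊢
  exact this.symm

/-- Swap the integrals over the triangle `r ≤ t`, translate `t` by `r`, and enlarge the resulting
domain `[0, T - r]` to `[0, T]`. -/
theorem lintegral_triangle_le {T : ℝ} {Φ : ℝ → ℝ → ℝ≥0∞}
    (hΦ : AEMeasurable (fun p : ℝ × ℝ => Φ (p.1 - p.2) p.2) ((vol T).prod (vol T))) :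
    ∫⁻ t in Icc 0 T, ∫⁻ r in Icc 0 t, Φ (t - r) r ≤ ∫⁻ r in Icc 0 T, ∫⁻ t in Icc 0 T, Φ t r := by
  have hm : MeasurableSet {p : ℝ × ℝ | p.2 ≤ p.1} := measurableSet_le measurable_snd measurable_fst
  have h1 : ∀ t ∈ Icc 0 T, ∫⁻ r in Icc 0 t, Φ (t - r) r =
      ∫⁻ r in Icc 0 T, {p : ℝ × ℝ | p.2 ≤ p.1}.indicator (fun p => Φ (p.1 - p.2) p.2) (t, r) := by
    intro t ht
    have h2 : (fun r => {p : ℝ × ℝ | p.2 ≤ p.1}.indicator (fun p => Φ (p.1 - p.2) p.2) (t, r)) =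
        (Iic t).indicator fun r => Φ (t - r) r := by
      ext r
      simp [indicator_apply]
    rw [h2, lintegral_indicator measurableSet_Iic, Measure.restrict_restrict measurableSet_Iic,
      show Iic t ∩ Icc 0 T = Icc 0 t by
        ext r; simp only [mem_inter_iff, mem_Iic, mem_Icc]
        exact ⟨fun h => ⟨h.2.1, h.1⟩, fun h => ⟨h.2, h.1, h.2.trans ht.2⟩⟩]
  rw [setLIntegral_congr_fun measurableSet_Icc h1, lintegral_lintegral_swap (f := fun t r =>
    {p : ℝ × ℝ | p.2 ≤ p.1}.indicator (fun p => Φ (p.1 - p.2) p.2) (t, r)) (hΦ.indicator hm)]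
  refine setLIntegral_mono' measurableSet_Icc fun r hr => ?_
  rw [← lintegral_indicator measurableSet_Icc, ← lintegral_indicator measurableSet_Icc,
    ← lintegral_sub_right_eq_self ((Icc 0 T).indicator fun t => Φ t r) r]
  refine lintegral_mono fun t => ?_
  simp only [indicator_apply, mem_ofPred_eq, mem_Icc]
  split_ifs with h1 h2 h3
  · exact le_rfl
  · exact absurd ⟨by linarith, by linarith [hr.1, h1.2]⟩ h3
  all_goals exact zero_le

/-- Duhamel integrals: a bound for the free evolutions bounds the forced evolutions. -/
theorem nsq_duhamel_le [CompleteSpace G] (hT : 0 ≤ T) {S h : ι → ℝ → ℂ} {C : ℝ} (hC0 : 0 ≤ C)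
    (hS : ∀ i, Continuous (S i)) (hh : ∀ i, MemLp (h i) 2 (vol T))
    (hcont : ∀ i, ContinuousOn (conv (S i) (h i)) (Icc 0 T))
    (hC : ∀ x : ι → ℂ, nsq T (vs s (fun i t => x i * S i t) b) ≤ C * ∑ i ∈ s, ‖x i‖ ^ 2) :
    nsq T (vs s (fun i => conv (S i) (h i)) b) ≤ T * C * ∑ i ∈ s, nsq T (h i) := by
  have hint : ∀ i t, t ∈ Icc 0 T → IntervalIntegrable (fun r => S i (t - r) * h i r) volume 0 t :=
    fun i t ht => conv_integrand' ht.1 (hS i).continuousOn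
      (MemLp.intervalIntegrable ht.1 (memLp_mono_interval ht.2 (hh i)))
  -- For frozen `r`, `F · r` is the observed evolution whose data are the force at time `r`. The
  -- Duhamel integral superposes these evolutions, each delayed by `r`, so `hC` applies to every one
  -- of them separately.
  set F : ℝ → ℝ → G := fun t r => vs s (fun i t => h i r * S i t) b t with hF
  have hval : ∀ t ∈ Icc 0 T, vs s (fun i => conv (S i) (h i)) b t = ∫ r in (0 : ℝ)..t, F (t - r) r := by
    intro t ht
    have := integral_vs (s := s) (b := b) (x := 0) (y := t)
      (ψ := fun i r => S i (t - r) * h i r) fun i => hint i t ht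
    simp only [vs, hF, conv, smul_eq_mul] at this ⊢
    rw [← this]
    congr 1
    ext r
    simp only [mul_comm]
  have hmul : ∀ i t, t ∈ Icc 0 T → MemLp (fun r => S i (t - r) * h i r) 2 (vol t) := by
    intro i t ht
    obtain ⟨c, hc⟩ := (isCompact_Icc (a := (0 : ℝ)) (b := T)).exists_bound_of_continuousOn
      (hS i).continuousOn
    refine (memLp_mono_interval ht.2 (hh i)).of_le_mul (c := c) ?_ ?_
    · exact ((hS i).comp (continuous_const.sub continuous_id)).aestronglyMeasurable.mul
        (memLp_mono_interval ht.2 (hh i)).1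
    · refine (ae_restrict_iff' measurableSet_Icc).2 (Eventually.of_forall fun r hr => ?_)
      rw [norm_mul]
      exact mul_le_mul_of_nonneg_right
        (hc _ ⟨by linarith [hr.2], by linarith [hr.1, ht.2]⟩) (norm_nonneg _)
  have hFm : ∀ t ∈ Icc 0 T, MemLp (fun r => F (t - r) r) 2 (vol t) := by
    intro t ht
    have := vs_memLp (s := s) (b := b) fun i => hmul i t ht
    refine this.ae_eq (Eventually.of_forall fun r => ?_)
    simp only [hF, vs, mul_comm]
  have hpt : ∀ t ∈ Icc 0 T, ‖vs s (fun i => conv (S i) (h i)) b t‖ₑ ^ 2 ≤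
      ENNReal.ofReal T * ∫⁻ r in Icc 0 t, ‖F (t - r) r‖ₑ ^ 2 := by
    intro t ht
    have h1 := sq_norm_integral_le (right_mem_Icc.2 ht.1) (hFm t ht)
    rw [← hval t ht] at h1
    rw [← ofReal_nsq (hFm t ht), ← ENNReal.ofReal_mul hT, ← ofReal_norm,
      ← ENNReal.ofReal_pow (norm_nonneg _)]
    exact ENNReal.ofReal_le_ofReal
      (h1.trans (mul_le_mul_of_nonneg_right ht.2 (nsq_nonneg _ _)))
  have hsum0 : 0 ≤ ∑ i ∈ s, nsq T (h i) := Finset.sum_nonneg fun i _ => nsq_nonneg _ _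
  refine nsq_le_of_lintegral_le (by positivity)
    (memLp_of_continuousOn (vs_continuousOn hcont)) ?_
  have hmeas : AEMeasurable (fun p : ℝ × ℝ => ‖F (p.1 - p.2) p.2‖ₑ ^ 2)
      ((vol T).prod (vol T)) := by
    refine AEMeasurable.pow_const (AEStronglyMeasurable.enorm ?_) 2
    simp only [hF, vs]
    refine Finset.aestronglyMeasurable_fun_sum s fun i _ => ?_
    refine AEStronglyMeasurable.smul_const (AEStronglyMeasurable.mul ?_ ?_) _
    · exact (hh i).1.comp_snd
    · exact ((hS i).comp (continuous_fst.sub continuous_snd)).aestronglyMeasurable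
  calc ∫⁻ t in Icc 0 T, ‖vs s (fun i => conv (S i) (h i)) b t‖ₑ ^ 2
      ≤ ∫⁻ t in Icc 0 T, ENNReal.ofReal T * ∫⁻ r in Icc 0 t, ‖F (t - r) r‖ₑ ^ 2 :=
        setLIntegral_mono' measurableSet_Icc hpt
    _ = ENNReal.ofReal T * ∫⁻ t in Icc 0 T, ∫⁻ r in Icc 0 t, ‖F (t - r) r‖ₑ ^ 2 :=
        lintegral_const_mul' _ _ ENNReal.ofReal_ne_top
    _ ≤ ENNReal.ofReal T * ∫⁻ r in Icc 0 T, ∫⁻ t in Icc 0 T, ‖F t r‖ₑ ^ 2 := by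
        refine mul_le_mul_right ?_ _
        exact lintegral_triangle_le (Φ := fun t r => ‖F t r‖ₑ ^ 2) hmeas
    _ ≤ ENNReal.ofReal T * ∫⁻ r in Icc 0 T, ENNReal.ofReal (C * ∑ i ∈ s, ‖h i r‖ ^ 2) := by
        gcongr with r
        have hc : MemLp (fun t => F t r) 2 (vol T) := memLp_of_continuousOn
          (vs_continuousOn fun i => (continuous_const.mul (hS i)).continuousOn)
        rw [← ofReal_nsq hc]
        exact ENNReal.ofReal_le_ofReal (hC fun i => h i r)
    _ = ENNReal.ofReal (T * C * ∑ i ∈ s, nsq T (h i)) := by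
        have hi : Integrable (fun r => C * ∑ i ∈ s, ‖h i r‖ ^ 2) (vol T) :=
          (integrable_finsetSum s fun i _ => integrable_sq (hh i)).const_mul C
        rw [← ofReal_integral_eq_lintegral_ofReal hi (Eventually.of_forall fun r =>
          mul_nonneg hC0 (Finset.sum_nonneg fun i _ => by positivity)), integral_const_mul,
          integral_finsetSum s fun i _ => integrable_sq (hh i), ← ENNReal.ofReal_mul hT, mul_assoc]
        rfl

end VectorSums

/-! ### The scalar wave equation -/

section Wave

/-- A complex square root of a real number. -/
def csqrt (lam : ℝ) : ℂ := (lam : ℂ) ^ ((2 : ℕ) : ℂ)⁻¹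

theorem csqrt_sq (lam : ℝ) : csqrt lam ^ 2 = lam := Complex.cpow_nat_inv_pow _ two_ne_zero

theorem csqrt_ne_zero {lam : ℝ} (h : lam ≠ 0) : csqrt lam ≠ 0 := fun h0 => by
  have := csqrt_sq lam
  rw [h0] at this
  exact h (by exact_mod_cast (by simpa using this.symm : (lam : ℂ) = 0))

/-- The solution `cos (√λ t)` of `c'' + λ c = 0`. -/
def cw (lam : ℝ) (t : ℝ) : ℂ := Complex.cos (csqrt lam * t)

/-- The solution `sin (√λ t) / √λ` of `c'' + λ c = 0`. -/
def sw (lam : ℝ) (t : ℝ) : ℂ := if lam = 0 then (t : ℂ) else Complex.sin (csqrt lam * t) / csqrt lam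

theorem cw_zero (lam : ℝ) : cw lam 0 = 1 := by simp [cw]

theorem sw_zero (lam : ℝ) : sw lam 0 = 0 := by simp [sw]

theorem cw_hasDerivAt (lam t : ℝ) : HasDerivAt (cw lam) (-lam * sw lam t) t := by
  have h2 := (((hasDerivAt_id (t : ℂ)).const_mul (csqrt lam)).ccos).comp_ofReal
  simp only [id] at h2
  refine h2.congr_deriv ?_
  rw [sw]
  split_ifs with h
  · have : csqrt 0 = 0 := by simp [csqrt]
    simp [this, h]
  · have h3 := csqrt_ne_zero h
    rw [← csqrt_sq lam]
    field_simp

theorem sw_hasDerivAt (lam t : ℝ) : HasDerivAt (sw lam) (cw lam t) t := by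
  have h1 := (((hasDerivAt_id (t : ℂ)).const_mul (csqrt lam)).csin).comp_ofReal
  simp only [id] at h1
  by_cases h : lam = 0
  · have h0 : csqrt lam = 0 := by simp [csqrt, h]
    have h2 : sw lam = fun t : ℝ => (t : ℂ) := by ext t; simp [sw, h]
    rw [h2, cw, h0]
    simpa using! Complex.ofRealCLM.hasDerivAt (x := t)
  · have h2 : sw lam = fun t : ℝ => Complex.sin (csqrt lam * t) / csqrt lam := by
      ext t; simp [sw, h]
    rw [h2]
    refine (h1.div_const _).congr_deriv ?_
    have h3 := csqrt_ne_zero h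
    rw [cw]
    field_simp

theorem cw_continuous (lam : ℝ) : Continuous (cw lam) :=
  continuous_iff_continuousAt.2 fun t => (cw_hasDerivAt lam t).continuousAt

theorem sw_continuous (lam : ℝ) : Continuous (sw lam) :=
  continuous_iff_continuousAt.2 fun t => (sw_hasDerivAt lam t).continuousAt

theorem sw_eq_integral (lam t : ℝ) : sw lam t = 0 + ∫ s in (0 : ℝ)..t, cw lam s := by
  rw [intervalIntegral.integral_eq_sub_of_hasDerivAt (fun s _ => sw_hasDerivAt lam s)
    ((cw_continuous lam).intervalIntegrable _ _), sw_zero]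
  ring

theorem cw_eq_integral (lam t : ℝ) :
    cw lam t = 1 + ∫ s in (0 : ℝ)..t, -lam * sw lam s := by
  rw [intervalIntegral.integral_eq_sub_of_hasDerivAt (fun s _ => cw_hasDerivAt lam s)
    ((continuous_const.mul (sw_continuous lam)).intervalIntegrable _ _), cw_zero]
  ring

theorem cw_add (lam t h : ℝ) :
    cw lam (t + h) = cw lam t * cw lam h - lam * sw lam t * sw lam h := by
  by_cases h0 : lam = 0
  · have : csqrt 0 = 0 := by simp [csqrt]
    simp [cw, this, h0]
  · have h3 := csqrt_ne_zero h0
    simp only [cw, sw, h0, if_false]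
    push_cast
    rw [mul_add, Complex.cos_add, ← csqrt_sq lam]
    field_simp

theorem sw_add (lam t h : ℝ) :
    sw lam (t + h) = sw lam t * cw lam h + cw lam t * sw lam h := by
  by_cases h0 : lam = 0
  · have : csqrt 0 = 0 := by simp [csqrt]
    simp [cw, sw, this, h0]
  · have h3 := csqrt_ne_zero h0
    simp only [cw, sw, h0, if_false]
    push_cast
    rw [mul_add, Complex.sin_add]
    field_simp

/-- The square being real, the root is real or purely imaginary, and in the second case `Im² = -λ ≤
c`. Free modes therefore grow at most like `exp (√c t)`, uniformly in `λ`. -/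
theorem abs_csqrt_im_le {lam c : ℝ} (hc : 0 ≤ c) (h : -c ≤ lam) : |(csqrt lam).im| ≤ √c := by
  have h1 := congrArg Complex.re (csqrt_sq lam)
  have h2 := congrArg Complex.im (csqrt_sq lam)
  simp only [pow_two, Complex.mul_re, Complex.mul_im, Complex.ofReal_re, Complex.ofReal_im] at h1 h2
  refine Real.abs_le_sqrt ?_
  have h3 : (csqrt lam).re = 0 ∨ (csqrt lam).im = 0 := by
    rw [← mul_eq_zero]; linarith
  rcases h3 with h3 | h3 <;> rw [h3] at h1 <;> nlinarith

theorem norm_exp_I_le {z : ℂ} {m : ℝ} (h : |z.im| ≤ m) : ‖Complex.exp (z * Complex.I)‖ ≤ Real.exp m := by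
  rw [Complex.norm_exp]
  refine Real.exp_le_exp.2 ?_
  simp only [Complex.mul_re, Complex.I_re, Complex.I_im, mul_zero, mul_one, zero_sub]
  linarith [neg_abs_le z.im]

theorem norm_cos_le {z : ℂ} {m : ℝ} (h : |z.im| ≤ m) : ‖Complex.cos z‖ ≤ Real.exp m := by
  have h1 := norm_exp_I_le h
  have h2 := norm_exp_I_le (z := -z) (m := m) (by simpa using h)
  rw [Complex.cos, norm_div]
  have := norm_add_le (Complex.exp (z * Complex.I)) (Complex.exp (-z * Complex.I))
  simp only [Complex.norm_ofNat]
  linarith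

theorem norm_sin_le {z : ℂ} {m : ℝ} (h : |z.im| ≤ m) : ‖Complex.sin z‖ ≤ Real.exp m := by
  have h1 := norm_exp_I_le h
  have h2 := norm_exp_I_le (z := -z) (m := m) (by simpa using h)
  rw [Complex.sin, norm_div, norm_mul, Complex.norm_I, mul_one]
  have := norm_sub_le (Complex.exp (-z * Complex.I)) (Complex.exp (z * Complex.I))
  simp only [Complex.norm_ofNat]
  linarith

theorem csqrt_mul_im_le {lam c t T : ℝ} (hc : 0 ≤ c) (h : -c ≤ lam) (ht : t ∈ Icc 0 T) :
    |(csqrt lam * t).im| ≤ √c * T := by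
  rw [Complex.mul_im, Complex.ofReal_im, Complex.ofReal_re, mul_zero, zero_add, abs_mul,
    abs_of_nonneg ht.1]
  exact mul_le_mul (abs_csqrt_im_le hc h) ht.2 ht.1 (Real.sqrt_nonneg _)

theorem norm_cw_le {lam c t T : ℝ} (hc : 0 ≤ c) (h : -c ≤ lam) (ht : t ∈ Icc 0 T) :
    ‖cw lam t‖ ≤ Real.exp (√c * T) := norm_cos_le (csqrt_mul_im_le hc h ht)

/-- The sine mode gains half a power of the eigenvalue. For `λ ≥ 1` this comes from the division by
`√λ`; for `λ < 1` the weight is bounded and it is enough to integrate the bound for `cw`. -/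
theorem sq_norm_sw_le {lam c t T : ℝ} (hc : 0 ≤ c) (h : -c ≤ lam) (ht : t ∈ Icc 0 T) :
    (lam + c + 1) * ‖sw lam t‖ ^ 2 ≤ (c + 2) * (1 + T ^ 2) * Real.exp (√c * T) ^ 2 := by
  set e := Real.exp (√c * T)
  have he : 0 < e := Real.exp_pos _
  have hT : 0 ≤ T := ht.1.trans ht.2
  rcases lt_or_ge lam 1 with h1 | h1
  · have h2 : ‖sw lam t‖ ≤ e * T := by
      rw [sw_eq_integral, zero_add]
      refine (intervalIntegral.norm_integral_le_of_norm_le_const (C := e) fun s hs => ?_).trans ?_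
      · rw [uIoc_of_le ht.1] at hs
        exact norm_cw_le hc h ⟨hs.1.le, hs.2.trans ht.2⟩
      · rw [sub_zero, abs_of_nonneg ht.1]
        exact mul_le_mul_of_nonneg_left ht.2 he.le
    have h3 : ‖sw lam t‖ ^ 2 ≤ (e * T) ^ 2 := by gcongr
    calc _ ≤ (c + 2) * (e * T) ^ 2 := mul_le_mul (by linarith) h3 (by positivity) (by linarith)
      _ ≤ _ := by nlinarith [sq_nonneg e, mul_nonneg (by linarith : 0 ≤ c + 2) (sq_nonneg e)]
  · have h2 : ‖sw lam t‖ ^ 2 ≤ e ^ 2 / lam := by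
      have hl : (csqrt lam) ≠ 0 := csqrt_ne_zero (by linarith)
      have h4 : ‖csqrt lam‖ ^ 2 = lam := by
        rw [← norm_pow, csqrt_sq, Complex.norm_real, Real.norm_of_nonneg (by linarith)]
      rw [sw, if_neg (by linarith), norm_div, div_pow, h4]
      gcongr
      exact norm_sin_le (csqrt_mul_im_le hc h ht)
    calc _ ≤ ((c + 2) * lam) * (e ^ 2 / lam) := by
          gcongr
          · nlinarith
      _ = (c + 2) * e ^ 2 := by field_simp
      _ ≤ _ := by nlinarith [sq_nonneg (e * T), mul_nonneg (by linarith : 0 ≤ c + 2) (sq_nonneg (e * T))]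

end Wave

/-! ### Scalar modes of the system with memory -/

section Modes

theorem hasDerivAt_primitive {f : ℝ → ℂ} {T t : ℝ} (hf : ContinuousOn f (Icc 0 T))
    (ht : t ∈ Ioo 0 T) : HasDerivAt (fun t => ∫ s in (0 : ℝ)..t, f s) (f t) t :=
  intervalIntegral.integral_hasDerivAt_right
    ((hf.mono (Icc_subset_Icc_right ht.2.le)).intervalIntegrable_of_Icc ht.1.le)
    (hf.mono Ioo_subset_Icc_self |>.stronglyMeasurableAtFilter isOpen_Ioo t ht)
    (hf.continuousAt (Icc_mem_nhds ht.1 ht.2))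

theorem hasDerivAt_of_eq_primitive {F f : ℝ → ℂ} {c : ℂ} {T t : ℝ} (hf : ContinuousOn f (Icc 0 T))
    (hF : ∀ t ∈ Icc 0 T, F t = c + ∫ s in (0 : ℝ)..t, f s) (ht : t ∈ Ioo 0 T) :
    HasDerivAt F (f t) t :=
  ((hasDerivAt_primitive hf ht).const_add c).congr_of_eventuallyEq
    (mem_of_superset (Icc_mem_nhds ht.1 ht.2) hF)

/-- Differentiates an identity of primitives. Inside the interval this is the fundamental theorem of
calculus; the endpoints follow by density and continuity. -/
theorem eqOn_of_integral_eq {f g : ℝ → ℂ} {T : ℝ} (hT : 0 < T) (hf : ContinuousOn f (Icc 0 T))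
    (hg : ContinuousOn g (Icc 0 T))
    (h : ∀ t ∈ Icc 0 T, ∫ s in (0 : ℝ)..t, f s = ∫ s in (0 : ℝ)..t, g s) :
    EqOn f g (Icc 0 T) := by
  refine EqOn.of_subset_closure (s := Ioo 0 T) (fun t ht => ?_) hf hg Ioo_subset_Icc_self
    (closure_Ioo hT.ne).ge
  refine (hasDerivAt_of_eq_primitive (c := 0) hf (fun t ht => ?_) ht).unique
    (hasDerivAt_primitive hg ht)
  rw [← h t ht, zero_add]

theorem continuousOn_of_eq_primitive {F f : ℝ → ℂ} {c : ℂ} {T : ℝ} (hT : 0 ≤ T)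
    (hf : ContinuousOn f (Icc 0 T)) (hF : ∀ t ∈ Icc 0 T, F t = c + ∫ s in (0 : ℝ)..t, f s) :
    ContinuousOn F (Icc 0 T) :=
  continuousOn_primitive_of_eq (hf.intervalIntegrable_of_Icc hT) hT hF

/-- The free evolution with data `x`, `y`. -/
def free (lam : ℝ) (x y : ℂ) (t : ℝ) : ℂ := x * cw lam t + y * sw lam t

theorem free_continuous (lam : ℝ) (x y : ℂ) : Continuous (free lam x y) :=
  (continuous_const.mul (cw_continuous lam)).add (continuous_const.mul (sw_continuous lam))

/-- The time derivative of a free evolution is the free evolution with data `(y, -λ x)`; derivatives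
thus stay within the class to which `FreeObs` applies. -/
theorem free_eq_integral (lam : ℝ) (x y : ℂ) (t : ℝ) :
    free lam x y t = x + ∫ s in (0 : ℝ)..t, free lam y (-lam * x) s := by
  have h1 : Continuous fun s => y * cw lam s := continuous_const.mul (cw_continuous lam)
  have h2 : Continuous fun s => -lam * x * sw lam s := continuous_const.mul (sw_continuous lam)
  simp only [free]
  rw [intervalIntegral.integral_add (h1.intervalIntegrable _ _) (h2.intervalIntegrable _ _),
    intervalIntegral.integral_const_mul, cw_eq_integral, sw_eq_integral lam t,
    intervalIntegral.integral_const_mul, intervalIntegral.integral_const_mul]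
  ring

/-- Duhamel's formula. -/
theorem duhamel {T lam : ℝ} (hT : 0 ≤ T) {U P g : ℝ → ℂ} {x y : ℂ}
    (hg : ContinuousOn g (Icc 0 T)) (hP : ContinuousOn P (Icc 0 T))
    (hU : ∀ t ∈ Icc 0 T, U t = x + ∫ s in (0 : ℝ)..t, P s)
    (hPe : ∀ t ∈ Icc 0 T, P t = y + ∫ s in (0 : ℝ)..t, (-lam * U s + g s)) :
    ∀ t ∈ Icc 0 T, U t = free lam x y t + conv (sw lam) g t := by
  intro t ht
  have hUc := continuousOn_of_eq_primitive hT hP hU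
  have hg2 : ContinuousOn (fun s => -lam * U s + g s) (Icc 0 T) :=
    (continuousOn_const.mul hUc).add hg
  have hsub : Icc 0 t ⊆ Icc 0 T := Icc_subset_Icc_right ht.2
  have hcs : ∀ f : ℝ → ℂ, Continuous f → ContinuousOn (fun s => f (t - s)) (Icc 0 t) :=
    fun f hf => (hf.comp (continuous_const.sub continuous_id)).continuousOn
  -- Variation of constants: in the derivative of `cw (t - s) U + sw (t - s) P` with respect to `s`
  -- all terms cancel except `sw (t - s) g`.
  have key := intervalIntegral.integral_eq_sub_of_hasDerivAt_of_le (a := 0) (b := t)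
    (f := fun s => cw lam (t - s) * U s + sw lam (t - s) * P s)
    (f' := fun s => sw lam (t - s) • g s) ht.1 ?_ ?_ ?_
  · rw [conv, key]
    have h0 : U 0 = x := by simpa using hU 0 (left_mem_Icc.2 hT)
    have h1 : P 0 = y := by simpa using hPe 0 (left_mem_Icc.2 hT)
    simp only [sub_self, sub_zero, cw_zero, sw_zero, h0, h1, free]
    ring
  · exact ((hcs _ (cw_continuous lam)).mul (hUc.mono hsub)).add
      ((hcs _ (sw_continuous lam)).mul (hP.mono hsub))
  · intro s hs
    have hs' : s ∈ Ioo 0 T := ⟨hs.1, hs.2.trans_le ht.2⟩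
    have h1 := hasDerivAt_of_eq_primitive hP hU hs'
    have h2 := hasDerivAt_of_eq_primitive hg2 hPe hs'
    have h3 := (cw_hasDerivAt lam (t - s)).comp_const_sub t s
    have h4 := (sw_hasDerivAt lam (t - s)).comp_const_sub t s
    refine ((h3.mul h1).add (h4.mul h2)).congr_deriv ?_
    simp only [smul_eq_mul]
    ring
  · exact ((hcs _ (sw_continuous lam)).smul (hg.mono hsub)).intervalIntegrable_of_Icc ht.1

/-- Convolution of the sine family with an absolutely continuous force. -/
theorem conv_sw_primitive {T lam : ℝ} {g g' : ℝ → ℂ} {c : ℂ}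
    (hg' : IntervalIntegrable g' volume 0 T)
    (hg : ∀ t ∈ Icc 0 T, g t = c + ∫ s in (0 : ℝ)..t, g' s) {t : ℝ} (ht : t ∈ Icc 0 T) :
    conv (sw lam) g t = ∫ s in (0 : ℝ)..t, (c * sw lam s + conv (sw lam) g' s) := by
  have hsub : uIcc 0 t ⊆ uIcc 0 T := by
    rw [uIcc_of_le ht.1, uIcc_of_le (ht.1.trans ht.2)]; exact Icc_subset_Icc_right ht.2
  exact conv_affine_primitive ht.1 ((sw_continuous lam).intervalIntegrable _ _)
    (hg'.mono_set hsub) fun r hr => hg r ⟨hr.1, hr.2.trans ht.2⟩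

theorem conv_sw_eq_integral_conv_cw {T lam : ℝ} {g : ℝ → ℂ} (hg : IntervalIntegrable g volume 0 T)
    {t : ℝ} (ht : t ∈ Icc 0 T) :
    conv (sw lam) g t = ∫ s in (0 : ℝ)..t, conv (cw lam) g s := by
  have hsub : uIcc 0 t ⊆ uIcc 0 T := by
    rw [uIcc_of_le ht.1, uIcc_of_le (ht.1.trans ht.2)]; exact Icc_subset_Icc_right ht.2
  rw [conv_affine_primitive_left (c := 0) ht.1 ((cw_continuous lam).intervalIntegrable _ _)
    (hg.mono_set hsub) fun r _ => sw_eq_integral lam r]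
  simp

theorem conv_sw_continuousOn {T : ℝ} (hT : 0 ≤ T) (lam : ℝ) {g : ℝ → ℂ}
    (hg : IntervalIntegrable g volume 0 T) : ContinuousOn (conv (sw lam) g) (Icc 0 T) := by
  have := conv_continuousOn hT hg ((cw_continuous lam).intervalIntegrable 0 T)
    fun r _ => sw_eq_integral lam r
  exact this.congr fun t _ => conv_comm _ _ _

theorem conv_cw_continuousOn {T : ℝ} (hT : 0 ≤ T) (lam : ℝ) {g : ℝ → ℂ}
    (hg : IntervalIntegrable g volume 0 T) : ContinuousOn (conv (cw lam) g) (Icc 0 T) := by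
  have := conv_continuousOn hT hg
    ((continuous_const.mul (sw_continuous lam)).intervalIntegrable 0 T)
    fun r _ => cw_eq_integral lam r
  exact this.congr fun t _ => conv_comm _ _ _

/-- A memory kernel `μ` of class `H²` on `[0, T]`, with `κ = -μ''`. -/
structure IsKernel (T : ℝ) (a₀ b₀ : ℂ) (μ μ' κ : ℝ → ℂ) : Prop where
  eq_primitive : ∀ t ∈ Icc 0 T, μ t = a₀ + ∫ s in (0 : ℝ)..t, μ' s
  deriv_eq_primitive : ∀ t ∈ Icc 0 T, μ' t = b₀ + ∫ s in (0 : ℝ)..t, -κ s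
  memLp : MemLp κ 2 (vol T)

/-- The solution `z`, with derivatives `z₁` and `z₂`, of
`z'' - a₀ z' + (a₀² / 4) z + λ (z - μ * z) = 0` with `z(0) = x`, `z'(0) = y + a₀ x`. -/
structure IsMode (T : ℝ) (a₀ : ℂ) (μ : ℝ → ℂ) (lam : ℝ) (x y : ℂ) (z z₁ z₂ : ℝ → ℂ) : Prop where
  cont : Continuous z₂
  eq_primitive : ∀ t, z t = x + ∫ s in (0 : ℝ)..t, z₁ s
  deriv_eq_primitive : ∀ t, z₁ t = (y + a₀ * x) + ∫ s in (0 : ℝ)..t, z₂ s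
  ode : ∀ t ∈ Icc 0 T, z₂ t = a₀ * z₁ t - a₀ ^ 2 / 4 * z t - lam * (z t - conv μ z t)

/-- The lower order terms. -/
def force (β : ℂ) (κ z : ℝ → ℂ) (t : ℝ) : ℂ := β * z t + conv κ z t

variable {T : ℝ} {a₀ b₀ : ℂ} {μ μ' κ : ℝ → ℂ}

namespace IsKernel

theorem intervalIntegrable (hK : IsKernel T a₀ b₀ μ μ' κ) (hT : 0 ≤ T) :
    IntervalIntegrable κ volume 0 T := MemLp.intervalIntegrable hT hK.memLp

theorem deriv_continuousOn (hK : IsKernel T a₀ b₀ μ μ' κ) (hT : 0 ≤ T) :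
    ContinuousOn μ' (Icc 0 T) :=
  continuousOn_primitive_of_eq (hK.intervalIntegrable hT).neg hT hK.deriv_eq_primitive

theorem continuousOn (hK : IsKernel T a₀ b₀ μ μ' κ) (hT : 0 ≤ T) : ContinuousOn μ (Icc 0 T) :=
  continuousOn_of_eq_primitive hT (hK.deriv_continuousOn hT) hK.eq_primitive

end IsKernel

/-- Since `κ` is only square integrable, the derivative of `κ * z` has to fall on `z`, and the
initial value of `z` leaves the extra term `x κ`. -/
theorem force_eq_primitive (hT : 0 ≤ T) (hκ : IntervalIntegrable κ volume 0 T) {z z₁ : ℝ → ℂ}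
    {x β : ℂ} (hz₁ : ContinuousOn z₁ (Icc 0 T))
    (hz : ∀ t ∈ Icc 0 T, z t = x + ∫ s in (0 : ℝ)..t, z₁ s) {t : ℝ} (ht : t ∈ Icc 0 T) :
    force β κ z t = β * x + ∫ s in (0 : ℝ)..t, (force β κ z₁ s + x * κ s) := by
  have hsub : uIcc 0 t ⊆ uIcc 0 T := by
    rw [uIcc_of_le ht.1, uIcc_of_le hT]; exact Icc_subset_Icc_right ht.2
  have hi := (hz₁.intervalIntegrable_of_Icc (μ := volume) hT).mono_set hsub
  have hk := hκ.mono_set hsub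
  have hc := conv_intervalIntegrable ht.1 hk hi
  simp only [force]
  rw [conv_affine_primitive ht.1 hk hi fun r hr => hz r ⟨hr.1, hr.2.trans ht.2⟩,
    hz t ht, intervalIntegral.integral_add ((hi.const_mul β).add hc) (hk.const_mul x),
    intervalIntegral.integral_add (hi.const_mul β) hc,
    intervalIntegral.integral_add (hk.const_mul x) hc, intervalIntegral.integral_const_mul,
    intervalIntegral.integral_const_mul]
  ring

theorem force_continuousOn (hT : 0 ≤ T) (hκ : IntervalIntegrable κ volume 0 T) {z z₁ : ℝ → ℂ}
    {x β : ℂ} (hz₁ : ContinuousOn z₁ (Icc 0 T))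
    (hz : ∀ t ∈ Icc 0 T, z t = x + ∫ s in (0 : ℝ)..t, z₁ s) :
    ContinuousOn (force β κ z) (Icc 0 T) :=
  (continuousOn_const.mul (continuousOn_of_eq_primitive hT hz₁ hz)).add
    (conv_continuousOn hT hκ (hz₁.intervalIntegrable_of_Icc hT) hz)

theorem force_intervalIntegrable (hT : 0 ≤ T) (hκ : IntervalIntegrable κ volume 0 T) {z : ℝ → ℂ}
    {β : ℂ} (hz : ContinuousOn z (Icc 0 T)) : IntervalIntegrable (force β κ z) volume 0 T :=
  ((hz.intervalIntegrable_of_Icc hT).const_mul β).add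
    (conv_intervalIntegrable hT hκ (hz.intervalIntegrable_of_Icc hT))

namespace IsMode

variable {lam : ℝ} {x y : ℂ} {z z₁ z₂ : ℝ → ℂ}

theorem deriv_continuous (h : IsMode T a₀ μ lam x y z z₁ z₂) : Continuous z₁ := by
  have : z₁ = fun t => (y + a₀ * x) + ∫ s in (0 : ℝ)..t, z₂ s := funext h.deriv_eq_primitive
  rw [this]
  exact continuous_const.add
    (intervalIntegral.continuous_primitive (fun a b => h.cont.intervalIntegrable a b) 0)

theorem continuous (h : IsMode T a₀ μ lam x y z z₁ z₂) : Continuous z := by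
  have : z = fun t => x + ∫ s in (0 : ℝ)..t, z₁ s := funext h.eq_primitive
  rw [this]
  exact continuous_const.add
    (intervalIntegral.continuous_primitive (fun a b => h.deriv_continuous.intervalIntegrable a b) 0)

/-- The auxiliary function `u = z - μ * z`. -/
theorem aux_eq_primitive (hK : IsKernel T a₀ b₀ μ μ' κ) (h : IsMode T a₀ μ lam x y z z₁ z₂)
    {t : ℝ} (ht : t ∈ Icc 0 T) : z t - conv μ z t =
      x + ∫ s in (0 : ℝ)..t, (z₁ s - a₀ * z s - conv μ' z s) := by
  have hT : 0 ≤ T := ht.1.trans ht.2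
  have hz := h.continuous.intervalIntegrable (μ := volume) 0 t
  have hz₁ := h.deriv_continuous.intervalIntegrable (μ := volume) 0 t
  have hμ' := ((hK.deriv_continuousOn hT).mono
    (Icc_subset_Icc_right ht.2)).intervalIntegrable_of_Icc (μ := volume) ht.1
  have hc := conv_intervalIntegrable ht.1 hμ' hz
  rw [conv_affine_primitive_left ht.1 hμ' hz fun r hr =>
    hK.eq_primitive r ⟨hr.1, hr.2.trans ht.2⟩, h.eq_primitive t,
    intervalIntegral.integral_sub (hz₁.sub (hz.const_mul _)) hc,
    intervalIntegral.integral_sub hz₁ (hz.const_mul _),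
    intervalIntegral.integral_add (hz.const_mul _) hc]
  ring

/-- The heart of the reduction. The second derivative of `μ * z` is `a₀ z' + b₀ z - κ * z`, and the
damping term `a₀ z'` of the mode equation matches its first summand. So `u = z - μ * z` satisfies a
wave equation whose right-hand side involves `z` but not `z'`. -/
theorem aux_deriv_eq_primitive (hK : IsKernel T a₀ b₀ μ μ' κ) (h : IsMode T a₀ μ lam x y z z₁ z₂)
    {t : ℝ} (ht : t ∈ Icc 0 T) : z₁ t - a₀ * z t - conv μ' z t =
      y + ∫ s in (0 : ℝ)..t, (-lam * (z s - conv μ z s) + force (-(a₀ ^ 2 / 4 + b₀)) κ z s) := by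
  have hT : 0 ≤ T := ht.1.trans ht.2
  have hsub : uIcc 0 t ⊆ uIcc 0 T := by
    rw [uIcc_of_le ht.1, uIcc_of_le hT]; exact Icc_subset_Icc_right ht.2
  have hz := h.continuous.intervalIntegrable (μ := volume) 0 t
  have hz₁ := h.deriv_continuous.intervalIntegrable (μ := volume) 0 t
  have hz₂ := h.cont.intervalIntegrable (μ := volume) 0 t
  have hκ := (hK.intervalIntegrable hT).mono_set hsub
  have hc := conv_intervalIntegrable ht.1 hκ hz
  have hneg : ∀ s, conv (fun r => -κ r) z s = -conv κ z s := fun s => by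
    have := conv_const_mul_left κ z (-1) s
    simpa using this
  have hI : ∫ s in (0 : ℝ)..t, (-lam * (z s - conv μ z s) + force (-(a₀ ^ 2 / 4 + b₀)) κ z s) =
      ∫ s in (0 : ℝ)..t, (z₂ s - a₀ * z₁ s - b₀ * z s + conv κ z s) := by
    refine intervalIntegral.integral_congr fun s hs => ?_
    rw [uIcc_of_le ht.1] at hs
    simp only [force]
    rw [h.ode s ⟨hs.1, hs.2.trans ht.2⟩]
    ring
  rw [hI, conv_affine_primitive_left (k₁ := fun r => -κ r) ht.1 hκ.neg hz fun r hr =>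
    hK.deriv_eq_primitive r ⟨hr.1, hr.2.trans ht.2⟩,
    intervalIntegral.integral_add ((hz₂.sub (hz₁.const_mul _)).sub (hz.const_mul _)) hc,
    intervalIntegral.integral_sub (hz₂.sub (hz₁.const_mul _)) (hz.const_mul _),
    intervalIntegral.integral_sub hz₂ (hz₁.const_mul _)]
  simp only [hneg, ← sub_eq_add_neg]
  rw [intervalIntegral.integral_sub (hz.const_mul _) hc,
    h.deriv_eq_primitive t, h.eq_primitive t, intervalIntegral.integral_const_mul a₀]
  ring

theorem conv_continuousOn' (hT : 0 ≤ T) {k : ℝ → ℂ} (hk : IntervalIntegrable k volume 0 T)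
    (h : IsMode T a₀ μ lam x y z z₁ z₂) : ContinuousOn (conv k z) (Icc 0 T) :=
  conv_continuousOn hT hk (h.deriv_continuous.intervalIntegrable 0 T) fun r _ => h.eq_primitive r

theorem aux_deriv_continuousOn (hT : 0 ≤ T) (hK : IsKernel T a₀ b₀ μ μ' κ)
    (h : IsMode T a₀ μ lam x y z z₁ z₂) :
    ContinuousOn (fun t => z₁ t - a₀ * z t - conv μ' z t) (Icc 0 T) :=
  (h.deriv_continuous.sub (continuous_const.mul h.continuous)).continuousOn.sub
    (h.conv_continuousOn' hT ((hK.deriv_continuousOn hT).intervalIntegrable_of_Icc hT))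

theorem force_continuousOn (hT : 0 ≤ T) (hK : IsKernel T a₀ b₀ μ μ' κ) (β : ℂ)
    (h : IsMode T a₀ μ lam x y z z₁ z₂) : ContinuousOn (force β κ z) (Icc 0 T) :=
  Visco.force_continuousOn hT (hK.intervalIntegrable hT) h.deriv_continuous.continuousOn
    fun t _ => h.eq_primitive t

/-- Duhamel's formula for `u = z - μ * z`. -/
theorem aux_eq (hT : 0 ≤ T) (hK : IsKernel T a₀ b₀ μ μ' κ) (h : IsMode T a₀ μ lam x y z z₁ z₂) :
    ∀ t ∈ Icc 0 T, z t - conv μ z t =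
      free lam x y t + conv (sw lam) (force (-(a₀ ^ 2 / 4 + b₀)) κ z) t :=
  duhamel hT (h.force_continuousOn hT hK _) (h.aux_deriv_continuousOn hT hK)
    (fun _ ht => h.aux_eq_primitive hK ht) fun _ ht => h.aux_deriv_eq_primitive hK ht

/-- Differentiating the sine rather than the force keeps the right-hand side free of `z₁`, so that
bounds on `z` alone yield bounds on the derivative. -/
theorem aux_deriv_eq_cw (hT : 0 < T) (hK : IsKernel T a₀ b₀ μ μ' κ)
    (h : IsMode T a₀ μ lam x y z z₁ z₂) : ∀ t ∈ Icc 0 T, z₁ t - a₀ * z t - conv μ' z t =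
      free lam y (-lam * x) t + conv (cw lam) (force (-(a₀ ^ 2 / 4 + b₀)) κ z) t := by
  have hf := (h.force_continuousOn hT.le hK (-(a₀ ^ 2 / 4 + b₀))).intervalIntegrable_of_Icc
    (μ := volume) hT.le
  refine eqOn_of_integral_eq hT (h.aux_deriv_continuousOn hT.le hK)
    ((free_continuous _ _ _).continuousOn.add (conv_cw_continuousOn hT.le lam hf)) fun t ht => ?_
  have hsub : uIcc 0 t ⊆ uIcc 0 T := by
    rw [uIcc_of_le ht.1, uIcc_of_le hT.le]; exact Icc_subset_Icc_right ht.2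
  have h1 := h.aux_eq_primitive hK ht
  rw [h.aux_eq hT.le hK t ht, free_eq_integral, conv_sw_eq_integral_conv_cw hf ht] at h1
  rw [intervalIntegral.integral_add ((free_continuous _ _ _).intervalIntegrable _ _)
    (conv_intervalIntegrable ht.1 ((cw_continuous lam).intervalIntegrable _ _)
      (hf.mono_set hsub))]
  rw [add_assoc] at h1
  exact (add_left_cancel h1).symm

/-- The derivative of `u = z - μ * z` as a forced evolution. -/
theorem aux_deriv_eq_sw (hT : 0 < T) (hK : IsKernel T a₀ b₀ μ μ' κ)
    (h : IsMode T a₀ μ lam x y z z₁ z₂) : ∀ t ∈ Icc 0 T, z₁ t - a₀ * z t - conv μ' z t =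
      free lam y (-lam * x + -(a₀ ^ 2 / 4 + b₀) * x) t +
        conv (sw lam) (fun s => force (-(a₀ ^ 2 / 4 + b₀)) κ z₁ s + x * κ s) t := by
  set β := -(a₀ ^ 2 / 4 + b₀) with hβ
  have hκ := hK.intervalIntegrable hT.le
  have hf' : IntervalIntegrable (fun s => force β κ z₁ s + x * κ s) volume 0 T :=
    (force_intervalIntegrable hT.le hκ h.deriv_continuous.continuousOn).add (hκ.const_mul x)
  refine eqOn_of_integral_eq hT (h.aux_deriv_continuousOn hT.le hK)
    ((free_continuous _ _ _).continuousOn.add (conv_sw_continuousOn hT.le lam hf')) fun t ht => ?_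
  have hsub : uIcc 0 t ⊆ uIcc 0 T := by
    rw [uIcc_of_le ht.1, uIcc_of_le hT.le]; exact Icc_subset_Icc_right ht.2
  have h1 := h.aux_eq_primitive hK ht
  rw [h.aux_eq hT.le hK t ht, free_eq_integral, conv_sw_primitive hf' (fun t ht =>
    force_eq_primitive hT.le hκ h.deriv_continuous.continuousOn (fun t _ => h.eq_primitive t) ht)
    ht, add_assoc] at h1
  have h2 : IntervalIntegrable (fun s => β * x * sw lam s +
      conv (sw lam) (fun s => force β κ z₁ s + x * κ s) s) volume 0 t :=
    ((continuous_const.mul (sw_continuous lam)).intervalIntegrable _ _).add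
      (conv_intervalIntegrable ht.1 ((sw_continuous lam).intervalIntegrable _ _)
        (hf'.mono_set hsub))
  rw [← add_left_cancel h1, ← intervalIntegral.integral_add
    ((free_continuous _ _ _).intervalIntegrable _ _) h2]
  refine intervalIntegral.integral_congr fun s _ => ?_
  simp only [free]
  ring

end IsMode

end Modes

/-! ### Solvability of the mode equation -/

section ModeTheory

variable {T : ℝ} {a₀ b₀ : ℂ} {μ μ' κ : ℝ → ℂ}

/-- Linear Volterra equations of the second kind of convolution type are solvable. -/
theorem exists_volterra (hT : 0 ≤ T) {k f : ℝ → ℂ} (hk : Continuous k) (hf : Continuous f) :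
    ∃ z : ℝ → ℂ, Continuous z ∧ ∀ t ∈ Icc 0 T, z t = f t + conv k z t := by
  obtain ⟨B, hB⟩ := (isCompact_Icc (a := (0 : ℝ)) (b := T)).exists_bound_of_continuousOn
    hk.continuousOn
  have hB0 : 0 ≤ B := (norm_nonneg _).trans (hB 0 (left_mem_Icc.2 hT))
  -- For the unknown multiplied by `exp (-γ t)` the Volterra map has Lipschitz constant at most `B /
  -- γ ≤ 1 / 2`, whatever the length of the interval.
  set γ : ℝ := 2 * B + 1 with hγ
  have hγ0 : 0 < γ := by positivity
  set kγ : ℝ → ℂ := fun t => Real.exp (-γ * t) * k t with hkγ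
  have hkγc : Continuous kγ := by fun_prop
  have hcont : ∀ F : C(Icc 0 T, ℂ), Continuous fun t : ℝ =>
      (Real.exp (-γ * t) : ℂ) * f t + conv kγ (IccExtend hT F) t := fun F => by
    refine (by fun_prop : Continuous fun t : ℝ => (Real.exp (-γ * t) : ℂ) * f t).add ?_
    have : Continuous (IccExtend hT F) := F.continuous.Icc_extend'
    exact intervalIntegral.continuous_parametric_intervalIntegral_of_continuous
      (f := fun t s => kγ (t - s) • IccExtend hT F s) (by fun_prop) continuous_id
  set Φ : C(Icc 0 T, ℂ) → C(Icc 0 T, ℂ) := fun F =>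
    ⟨fun t => (Real.exp (-γ * t) : ℂ) * f t + conv kγ (IccExtend hT F) t,
      (hcont F).comp continuous_subtype_val⟩ with hΦ
  have hLip : ContractingWith (1 / 2) Φ := by
    refine ⟨by rw [← NNReal.coe_lt_coe]; norm_num, LipschitzWith.of_dist_le_mul fun F₁ F₂ => ?_⟩
    rw [ContinuousMap.dist_le (by positivity)]
    rintro ⟨t, ht⟩
    have hE : ∀ F : C(Icc 0 T, ℂ), ContinuousOn (IccExtend hT F) (Icc 0 t) := fun F =>
      (F.continuous.Icc_extend' (h := hT)).continuousOn
    have h1 : dist (Φ F₁ ⟨t, ht⟩) (Φ F₂ ⟨t, ht⟩) =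
        ‖∫ s in (0 : ℝ)..t, kγ (t - s) * (IccExtend hT F₁ s - IccExtend hT F₂ s)‖ := by
      simp only [hΦ, ContinuousMap.coe_mk, dist_eq_norm, add_sub_add_left_eq_sub, conv, smul_eq_mul,
        mul_sub]
      rw [intervalIntegral.integral_sub]
      · exact conv_integrand ht.1 (hkγc.intervalIntegrable _ _) (hE F₁)
      · exact conv_integrand ht.1 (hkγc.intervalIntegrable _ _) (hE F₂)
    rw [h1]
    have h2 : ∀ s ∈ Ioc 0 t, ‖kγ (t - s) * (IccExtend hT F₁ s - IccExtend hT F₂ s)‖ ≤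
        B * dist F₁ F₂ * Real.exp (γ * (s - t)) := by
      intro s hs
      have hs' : s ∈ Icc 0 T := ⟨hs.1.le, hs.2.trans ht.2⟩
      rw [norm_mul, hkγ, norm_mul, IccExtend_of_mem _ _ hs', IccExtend_of_mem _ _ hs', ← dist_eq_norm,
        Complex.norm_real, Real.norm_of_nonneg (Real.exp_pos _).le]
      have h3 := hB (t - s) ⟨sub_nonneg.2 hs.2, by linarith [hs.1, ht.2]⟩
      have h4 := ContinuousMap.dist_apply_le_dist (f := F₁) (g := F₂) ⟨s, hs'⟩
      have h5 : Real.exp (-γ * (t - s)) = Real.exp (γ * (s - t)) := by congr 1; ring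
      rw [h5]
      calc _ ≤ Real.exp (γ * (s - t)) * B * dist F₁ F₂ := by gcongr
        _ = _ := by ring
    refine (intervalIntegral.norm_integral_le_of_norm_le ht.1
      (Eventually.of_forall h2) ?_).trans ?_
    · exact (by fun_prop : Continuous fun s => B * dist F₁ F₂ * Real.exp (γ * (s - t))).intervalIntegrable _ _
    · have h6 : ∫ s in (0 : ℝ)..t, Real.exp (γ * (s - t)) = (1 - Real.exp (-γ * t)) / γ := by
        have hd : ∀ s ∈ uIcc 0 t, HasDerivAt (fun s => Real.exp (γ * (s - t)) / γ)
            (Real.exp (γ * (s - t))) s := fun s _ => by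
          have := ((((hasDerivAt_id s).sub_const t).const_mul γ).exp).div_const γ
          refine this.congr_deriv ?_
          simp only [id]
          field_simp
        rw [intervalIntegral.integral_eq_sub_of_hasDerivAt hd
          ((by fun_prop : Continuous fun s => Real.exp (γ * (s - t))).intervalIntegrable _ _)]
        simp only [sub_self, mul_zero, Real.exp_zero, zero_sub, mul_neg, neg_mul]
        ring
      rw [intervalIntegral.integral_const_mul, h6]
      have h7 : (1 - Real.exp (-γ * t)) / γ ≤ 1 / γ := by
        gcongr
        linarith [Real.exp_pos (-γ * t)]
      have h8 : B * (1 / γ) ≤ 1 / 2 := by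
        rw [mul_one_div, div_le_div_iff₀ hγ0 two_pos]; linarith
      have h9 : (0 : ℝ) ≤ dist F₁ F₂ := dist_nonneg
      calc _ ≤ B * dist F₁ F₂ * (1 / γ) := by gcongr
        _ = (B * (1 / γ)) * dist F₁ F₂ := by ring
        _ ≤ (1 / 2) * dist F₁ F₂ := by gcongr
        _ = _ := by norm_num
  obtain ⟨F, hF, -⟩ := hLip.exists_fixedPoint 0 (edist_ne_top _ _)
  have hE : Continuous (IccExtend hT F) := F.continuous.Icc_extend'
  refine ⟨fun t => Real.exp (γ * t) * IccExtend hT F t, by fun_prop, fun t ht => ?_⟩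
  have h1 : F ⟨t, ht⟩ = (Real.exp (-γ * t) : ℂ) * f t + conv kγ (IccExtend hT F) t := by
    conv_lhs => rw [← hF.eq]
    rfl
  have h3 : ∀ a b : ℝ, (Real.exp a : ℂ) * (Real.exp b : ℂ) = Real.exp (a + b) := fun a b => by
    rw [Real.exp_add]; push_cast; rfl
  have h2 : conv k (fun t => Real.exp (γ * t) * IccExtend hT F t) t =
      Real.exp (γ * t) * conv kγ (IccExtend hT F) t := by
    simp only [conv, hkγ, smul_eq_mul]
    rw [← intervalIntegral.integral_const_mul]
    congr 1
    ext s
    have : (Real.exp (γ * s) : ℂ) = Real.exp (γ * t) * Real.exp (-γ * (t - s)) := by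
      rw [h3]; congr 2; ring
    rw [this]; ring
  rw [h2]
  simp only
  rw [IccExtend_of_mem _ _ ht, h1, mul_add, ← mul_assoc, h3]
  simp

theorem primitive_continuous {f : ℝ → ℂ} (hf : Continuous f) :
    Continuous fun t => ∫ s in (0 : ℝ)..t, f s :=
  intervalIntegral.continuous_primitive (fun a b => hf.intervalIntegrable a b) 0

/-- The second derivative `r` is taken as the unknown. With `J` the primitive, `z₁ = η + J r` and `z
= x + t η + J² r`, and the mode equation becomes a Volterra equation of the second kind for `r`. -/
theorem exists_isMode (hT : 0 ≤ T) (hμ : ContinuousOn μ (Icc 0 T)) (lam : ℝ) (x y : ℂ) :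
    ∃ z z₁ z₂, IsMode T a₀ μ lam x y z z₁ z₂ := by
  -- A continuous extension of `μ` to the line, needed because `IsMode` asks for functions that are
  -- continuous everywhere.
  set ν : ℝ → ℂ := IccExtend hT ((Icc 0 T).domRestrict μ) with hν
  have hνc : Continuous ν := (continuousOn_iff_continuous_domRestrict.1 hμ).Icc_extend'
  have hνμ : ∀ t ∈ Icc 0 T, μ t = ν t := fun t ht => by rw [hν, IccExtend_of_mem _ _ ht]; rfl
  set J : (ℝ → ℂ) → ℝ → ℂ := fun f t => ∫ s in (0 : ℝ)..t, f s with hJ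
  have hJc : ∀ f, Continuous f → Continuous (J f) := fun f hf => primitive_continuous hf
  set η := y + a₀ * x
  have hcν : ∀ f : ℝ → ℂ, Continuous f → Continuous (conv ν f) := fun f hf => by
    have h2 : Continuous (Function.uncurry fun t s : ℝ => ν (t - s) • f s) :=
      (hνc.comp (continuous_fst.sub continuous_snd)).smul (hf.comp continuous_snd)
    exact intervalIntegral.continuous_parametric_intervalIntegral_of_continuous h2 continuous_id
  set aff : ℝ → ℂ := fun t => x + t * η
  have haff : Continuous aff := by fun_prop
  -- The three terms of the kernel `k` encode `J r = 1 * r`, `J² r = (J 1) * r` and `ν * J² r = (J²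
  -- ν) * r`.
  obtain ⟨r, hr, hreq⟩ := exists_volterra hT
    (k := fun t => a₀ * 1 + -(a₀ ^ 2 / 4 + lam) * J (fun _ => 1) t + lam * J (J ν) t)
    (f := fun t => a₀ * η - (a₀ ^ 2 / 4 + lam) * aff t + lam * conv ν aff t)
    (((continuous_const).add (continuous_const.mul (hJc _ continuous_const))).add
      (continuous_const.mul (hJc _ (hJc _ hνc))))
    (((continuous_const).sub (continuous_const.mul haff)).add
      (continuous_const.mul (hcν _ haff)))
  refine ⟨fun t => x + J (fun t => η + J r t) t, fun t => η + J r t, r, hr, fun t => rfl,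
    fun t => rfl, fun t ht => ?_⟩
  have hi : ∀ f : ℝ → ℂ, Continuous f → ∀ a b, IntervalIntegrable f volume a b :=
    fun f hf a b => hf.intervalIntegrable a b
  have hz : ∀ t, x + J (fun t => η + J r t) t = aff t + J (J r) t := fun t => by
    simp only [hJ]
    rw [intervalIntegral.integral_add (hi _ continuous_const _ _) (hi _ (hJc _ hr) _ _)]
    simp only [intervalIntegral.integral_const, sub_zero, Complex.real_smul, aff, add_assoc]
    rfl
  have h1 : conv μ (fun t => x + J (fun t => η + J r t) t) t = conv ν aff t + conv (J (J ν)) r t := by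
    rw [conv_congr ht.1 (fun s hs => hνμ s ⟨hs.1, hs.2.trans ht.2⟩) (fun s _ => hz s),
      conv_add_right (conv_integrand ht.1 (hi _ hνc _ _) haff.continuousOn)
        (conv_integrand ht.1 (hi _ hνc _ _) (hJc _ (hJc _ hr)).continuousOn)]
    congr 1
    rw [conv_primitive ht.1 (hi _ hνc _ _) (hi _ (hJc _ hr) _ _),
      ← integral_conv ht.1 (hi _ (hJc _ hνc) _ _) (hi _ hr _ _)]
    refine intervalIntegral.integral_congr fun s hs => ?_
    rw [uIcc_of_le ht.1] at hs
    rw [conv_primitive hs.1 (hi _ hνc _ _) (hi _ hr _ _),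
      ← integral_conv hs.1 (hi _ hνc _ _) (hi _ hr _ _)]
  have h2 : conv (fun t => a₀ * 1 + -(a₀ ^ 2 / 4 + lam) * J (fun _ => 1) t + lam * J (J ν) t) r t =
      a₀ * J r t - (a₀ ^ 2 / 4 + lam) * J (J r) t + lam * conv (J (J ν)) r t := by
    have e1 : J r t = conv r (fun _ => 1) t := by
      rw [conv_comm, conv_const_one]
    have e2 : J (J r) t = conv r (J fun _ => 1) t := by
      rw [conv_comm, ← integral_conv ht.1 (hi _ continuous_const _ _) (hi _ hr _ _)]
      simp only [hJ, conv_const_one]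
    rw [conv_comm, conv_add_right, conv_add_right, conv_const_mul_right, conv_const_mul_right,
      conv_const_mul_right, conv_comm _ r, e1, e2]
    · ring
    · exact conv_integrand ht.1 (hi _ hr _ _) continuousOn_const
    · exact conv_integrand ht.1 (hi _ hr _ _)
        (continuous_const.mul (hJc _ continuous_const)).continuousOn
    · exact conv_integrand ht.1 (hi _ hr _ _) (continuous_const.add
        (continuous_const.mul (hJc _ continuous_const))).continuousOn
    · exact conv_integrand ht.1 (hi _ hr _ _)
        (continuous_const.mul (hJc _ (hJc _ hνc))).continuousOn
  rw [h1, hreq t ht, h2, hz]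
  ring

end ModeTheory

/-! ### Bounds for modes, uniform in the eigenvalue -/

section ModeBounds

variable {T : ℝ} {a₀ b₀ : ℂ} {μ μ' κ : ℝ → ℂ}

theorem nsq_eq_intervalIntegral {t : ℝ} (ht : 0 ≤ t) (f : ℝ → ℂ) :
    nsq t f = ∫ s in (0 : ℝ)..t, ‖f s‖ ^ 2 := by
  rw [nsq, integral_Icc_eq_integral_Ioc, intervalIntegral.integral_of_le ht]

theorem memLp_conv {t : ℝ} (ht : 0 ≤ t) {k f : ℝ → ℂ} (hk : MemLp k 2 (vol t))
    (hf : MemLp f 2 (vol t)) : MemLp (conv k f) 2 (vol t) := by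
  have hi := conv_intervalIntegrable ht (MemLp.intervalIntegrable ht hk)
    (MemLp.intervalIntegrable ht hf)
  rw [intervalIntegrable_iff_integrableOn_Icc_of_le ht] at hi
  refine MemLp.of_bound hi.1 (√(nsq t k * nsq t f)) ((ae_restrict_iff' measurableSet_Icc).2
    (Eventually.of_forall fun s hs => ?_))
  exact Real.le_sqrt_of_sq_le (sq_norm_conv_le hs hk hf)

theorem nsq_conv_le {t : ℝ} (ht : 0 ≤ t) {k f : ℝ → ℂ} (hk : MemLp k 2 (vol t))
    (hf : MemLp f 2 (vol t)) : nsq t (conv k f) ≤ t * (nsq t k * nsq t f) :=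
  nsq_le_of_bound ht fun _ hs => sq_norm_conv_le hs hk hf

theorem memLp_force {t : ℝ} (ht : 0 ≤ t) {β : ℂ} {f : ℝ → ℂ} (hκ : MemLp κ 2 (vol t))
    (hf : MemLp f 2 (vol t)) : MemLp (force β κ f) 2 (vol t) :=
  (hf.const_mul β).add (memLp_conv ht hκ hf)

theorem nsq_force_le {t : ℝ} (ht : 0 ≤ t) {β : ℂ} {f : ℝ → ℂ} (hκ : MemLp κ 2 (vol t))
    (hf : MemLp f 2 (vol t)) :
    nsq t (force β κ f) ≤ (2 * ‖β‖ ^ 2 + 2 * (t * nsq t κ)) * nsq t f := by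
  have h1 := nsq_add_le (hf.const_mul β) (memLp_conv ht hκ hf)
  have h2 := nsq_conv_le ht hκ hf
  have h3 := nsq_const_smul t f β
  simp only [smul_eq_mul] at h3
  rw [h3] at h1
  refine h1.trans ?_
  nlinarith

/-- The norm weight `λ + c + 1` of the mode with eigenvalue `λ`. -/
def wt (c lam : ℝ) : ℝ := lam + c + 1

theorem one_le_wt {c lam : ℝ} (h : -c ≤ lam) : 1 ≤ wt c lam := by unfold wt; linarith

theorem sq_le_wt {c lam : ℝ} (hc : 0 ≤ c) (h : -c ≤ lam) :
    lam ^ 2 ≤ (1 + c) ^ 2 * wt c lam ^ 2 := by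
  rw [← mul_pow, sq_le_sq, abs_of_nonneg
    (mul_nonneg (by linarith : 0 ≤ 1 + c) (zero_le_one.trans (one_le_wt h)))]
  unfold wt
  have h0 := mul_nonneg hc (by linarith : 0 ≤ lam + c)
  refine abs_le.2 ⟨by nlinarith, by nlinarith⟩

theorem exists_free_bound {c : ℝ} (hc : 0 ≤ c) (hT : 0 ≤ T) : ∃ K : ℝ, 1 ≤ K ∧
    ∀ lam : ℝ, -c ≤ lam → ∀ t ∈ Icc 0 T,
      ‖cw lam t‖ ^ 2 ≤ K ∧ wt c lam * ‖sw lam t‖ ^ 2 ≤ K ∧ ‖sw lam t‖ ^ 2 ≤ K := by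
  set e := Real.exp (√c * T) ^ 2 with he
  have he1 : 1 ≤ e := one_le_pow₀ (Real.one_le_exp (by positivity))
  refine ⟨(c + 2) * (1 + T ^ 2) * e, ?_, fun lam hlam t ht => ?_⟩
  · have : 1 ≤ (c + 2) * (1 + T ^ 2) := by nlinarith [sq_nonneg T]
    nlinarith
  · have h1 : ‖cw lam t‖ ^ 2 ≤ e := by
      rw [he]
      gcongr
      exact norm_cw_le hc hlam ht
    have h2 := sq_norm_sw_le hc hlam ht
    have h3 : 1 ≤ (c + 2) * (1 + T ^ 2) := by nlinarith [sq_nonneg T]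
    refine ⟨h1.trans (by nlinarith), h2, le_trans ?_ h2⟩
    have := one_le_wt hlam
    unfold wt at this
    nlinarith [sq_nonneg ‖sw lam t‖]

theorem sq_norm_free_le {K S : ℝ} {lam t : ℝ} (x y : ℂ) (h1 : ‖cw lam t‖ ^ 2 ≤ K)
    (h2 : ‖sw lam t‖ ^ 2 ≤ S) : ‖free lam x y t‖ ^ 2 ≤ 2 * (‖x‖ ^ 2 * K) + 2 * (‖y‖ ^ 2 * S) := by
  refine (sq_norm_add_le _ _).trans ?_
  rw [norm_mul, norm_mul, mul_pow, mul_pow]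
  gcongr

/-- Uniform bounds for the solution of the mode equation. -/
theorem IsMode.exists_bound {c : ℝ} (hc : 0 ≤ c) (hT : 0 < T) (hK : IsKernel T a₀ b₀ μ μ' κ) :
    ∃ K : ℝ, 0 < K ∧ ∀ (lam : ℝ) (x y : ℂ) (z z₁ z₂ : ℝ → ℂ), -c ≤ lam →
      IsMode T a₀ μ lam x y z z₁ z₂ → ∀ t ∈ Icc 0 T,
        ‖z t‖ ^ 2 ≤ K * (‖x‖ ^ 2 + ‖y‖ ^ 2 / wt c lam) := by
  obtain ⟨K₀, hK₀, hfree⟩ := exists_free_bound hc hT.le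
  set β := -(a₀ ^ 2 / 4 + b₀)
  have hμ2 := memLp_of_continuousOn (hK.continuousOn hT.le)
  set F := 2 * ‖β‖ ^ 2 + 2 * (T * nsq T κ) with hF
  have hF0 : 0 ≤ F := by have := nsq_nonneg T κ; positivity
  -- Gronwall constant of the identity `z = (free + sw * force) + μ * z`: squaring costs a factor
  -- `2` for each of the two sums. The weight dividing `‖y‖²` comes from the decay of `sw`.
  set D := 4 * (T * K₀ * F) + 2 * nsq T μ with hD
  have hD0 : 0 ≤ D := by have := nsq_nonneg T μ; positivity
  refine ⟨(1 + D * (Real.exp (D * T) * T)) * (8 * K₀), by positivity,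
    fun lam x y z z₁ z₂ hlam h t ht => ?_⟩
  have hw := one_le_wt hlam
  set A := ‖x‖ ^ 2 + ‖y‖ ^ 2 / wt c lam with hA
  have hA0 : 0 ≤ A := by positivity
  have key := norm_le_of_sq_gronwall hT.le hD0 h.continuous.continuousOn
    (A := 8 * K₀ * A) (by positivity) ?_ t ht
  · calc _ ≤ _ := key
      _ = _ := by ring
  intro t ht
  have ht0 := ht.1
  have hz2 : MemLp z 2 (vol t) := memLp_of_continuousOn h.continuous.continuousOn
  have hκ2 := memLp_mono_interval ht.2 hK.memLp
  have hg2 := memLp_force (β := β) ht0 hκ2 hz2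
  have hsw2 : MemLp (sw lam) 2 (vol t) := memLp_of_continuousOn (sw_continuous lam).continuousOn
  have e1 : z t = (free lam x y t + conv (sw lam) (force β κ z) t) + conv μ z t := by
    rw [← h.aux_eq hT.le hK t ht]; ring
  have h1 : ‖free lam x y t‖ ^ 2 ≤ 2 * K₀ * A := by
    obtain ⟨f1, f2, f3⟩ := hfree lam hlam t ht
    have f4 : ‖sw lam t‖ ^ 2 ≤ K₀ / wt c lam := by
      rw [le_div_iff₀ (by linarith)]; linarith
    refine (sq_norm_free_le x y f1 f4).trans_eq ?_
    rw [hA]; ring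
  have h2 : ‖conv (sw lam) (force β κ z) t‖ ^ 2 ≤ T * K₀ * F * nsq t z := by
    have g1 := sq_norm_conv_le (right_mem_Icc.2 ht0) hsw2 hg2
    have g2 : nsq t (sw lam) ≤ T * K₀ := (nsq_le_of_bound ht0 fun s hs =>
      (hfree lam hlam s ⟨hs.1, hs.2.trans ht.2⟩).2.2).trans
        (mul_le_mul_of_nonneg_right ht.2 (by linarith))
    have g3 : nsq t (force β κ z) ≤ F * nsq t z := by
      refine (nsq_force_le ht0 hκ2 hz2).trans ?_
      refine mul_le_mul_of_nonneg_right ?_ (nsq_nonneg _ _)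
      have g4 := nsq_mono_interval ht.2 hK.memLp
      have := mul_le_mul ht.2 g4 (nsq_nonneg _ _) hT.le
      rw [hF]; linarith
    calc _ ≤ _ := g1
      _ ≤ (T * K₀) * (F * nsq t z) := mul_le_mul g2 g3 (nsq_nonneg _ _) (by positivity)
      _ = _ := by ring
  have h3 : ‖conv μ z t‖ ^ 2 ≤ nsq T μ * nsq t z :=
    (sq_norm_conv_le (right_mem_Icc.2 ht0) (memLp_mono_interval ht.2 hμ2) hz2).trans
      (mul_le_mul_of_nonneg_right (nsq_mono_interval ht.2 hμ2) (nsq_nonneg _ _))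
  have h4 := sq_norm_add_le (free lam x y t + conv (sw lam) (force β κ z) t) (conv μ z t)
  have h5 := sq_norm_add_le (free lam x y t) (conv (sw lam) (force β κ z) t)
  rw [← e1] at h4
  rw [← nsq_eq_intervalIntegral ht0, hD]
  nlinarith

theorem sq_norm_conv_mode_le {k z : ℝ → ℂ} {A : ℝ} (hT : 0 ≤ T) (hk : MemLp k 2 (vol T))
    (hz : ContinuousOn z (Icc 0 T)) (hzA : ∀ t ∈ Icc 0 T, ‖z t‖ ^ 2 ≤ A) {t : ℝ}
    (ht : t ∈ Icc 0 T) : ‖conv k z t‖ ^ 2 ≤ nsq T k * T * A := by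
  refine (sq_norm_conv_le ht hk (memLp_of_continuousOn hz)).trans ?_
  rw [mul_assoc]
  exact mul_le_mul_of_nonneg_left (nsq_le_of_bound hT hzA) (nsq_nonneg _ _)

theorem wt_mul_eq {w : ℝ} (hw : 0 < w) (x y : ℂ) :
    w * (‖x‖ ^ 2 + ‖y‖ ^ 2 / w) = w * ‖x‖ ^ 2 + ‖y‖ ^ 2 := by field_simp

/-- Bounds for the derivative of a free evolution. -/
theorem sq_norm_free_deriv_le {c K lam t : ℝ} (hc : 0 ≤ c) (hlam : -c ≤ lam) (hK : 1 ≤ K)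
    (h1 : ‖cw lam t‖ ^ 2 ≤ K) (h2 : wt c lam * ‖sw lam t‖ ^ 2 ≤ K) (x y : ℂ) :
    ‖free lam y (-lam * x) t‖ ^ 2 ≤
      2 * (1 + c) ^ 2 * K * (wt c lam * ‖x‖ ^ 2 + ‖y‖ ^ 2) := by
  have hw := one_le_wt hlam
  have hl := sq_le_wt hc hlam
  generalize wt c lam = w at *
  have hw0 : 0 < w := by linarith
  have g1 : ‖sw lam t‖ ^ 2 ≤ K / w := by rw [le_div_iff₀ hw0]; linarith
  refine (sq_norm_free_le y (-lam * x) h1 g1).trans ?_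
  have g2 : ‖(-lam : ℂ) * x‖ ^ 2 ≤ (1 + c) ^ 2 * w ^ 2 * ‖x‖ ^ 2 := by
    rw [norm_mul, mul_pow, norm_neg, Complex.norm_real, Real.norm_eq_abs, sq_abs]
    exact mul_le_mul_of_nonneg_right hl (by positivity)
  have g3 : ‖(-lam : ℂ) * x‖ ^ 2 * (K / w) ≤ (1 + c) ^ 2 * w ^ 2 * ‖x‖ ^ 2 * (K / w) :=
    mul_le_mul_of_nonneg_right g2 (by positivity)
  have g4 : (1 + c) ^ 2 * w ^ 2 * ‖x‖ ^ 2 * (K / w) = (1 + c) ^ 2 * K * (w * ‖x‖ ^ 2) := by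
    field_simp
  have g5 : ‖y‖ ^ 2 * K ≤ (1 + c) ^ 2 * K * ‖y‖ ^ 2 := by
    have : 1 ≤ (1 + c) ^ 2 := by nlinarith
    have h0 : 0 ≤ K * ‖y‖ ^ 2 := by positivity
    nlinarith
  linarith

/-- Write `z₁ = u' + a₀ z + μ' * z`. The cosine form of `u'` and the bound for `z` control every
term; only the free part of `u'` is of the order of the energy. -/
theorem IsMode.exists_bound_deriv {c : ℝ} (hc : 0 ≤ c) (hT : 0 < T)
    (hK : IsKernel T a₀ b₀ μ μ' κ) :
    ∃ K : ℝ, 0 < K ∧ ∀ (lam : ℝ) (x y : ℂ) (z z₁ z₂ : ℝ → ℂ), -c ≤ lam →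
      IsMode T a₀ μ lam x y z z₁ z₂ → ∀ t ∈ Icc 0 T,
        ‖z₁ t‖ ^ 2 ≤ K * (wt c lam * ‖x‖ ^ 2 + ‖y‖ ^ 2) := by
  obtain ⟨K₀, hK₀, hfree⟩ := exists_free_bound hc hT.le
  obtain ⟨K₁, hK₁, hz⟩ := IsMode.exists_bound hc hT hK
  obtain ⟨F, hF0, hF⟩ : ∃ F : ℝ, 0 ≤ F ∧ ∀ f : ℝ → ℂ, MemLp f 2 (vol T) →
      nsq T (force (-(a₀ ^ 2 / 4 + b₀)) κ f) ≤ F * nsq T f :=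
    ⟨_, by have := nsq_nonneg T κ; positivity, fun f hf => nsq_force_le hT.le hK.memLp hf⟩
  have hμ'2 := memLp_of_continuousOn (hK.deriv_continuousOn hT.le)
  have hnμ' := nsq_nonneg T μ'
  refine ⟨2 * (2 * (2 * (1 + c) ^ 2 * K₀) + 2 * (T * K₀ * (F * (T * K₁)))) +
    (4 * ‖a₀‖ ^ 2 * K₁ + 4 * (nsq T μ' * T * K₁)), by positivity,
    fun lam x y z z₁ z₂ hlam h t ht => ?_⟩
  have hw := one_le_wt hlam
  have hz0 : ∀ t ∈ Icc 0 T, ‖z t‖ ^ 2 ≤ K₁ * (‖x‖ ^ 2 + ‖y‖ ^ 2 / wt c lam) :=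
    fun t ht => hz lam x y z z₁ z₂ hlam h t ht
  obtain ⟨f1, f2, f3⟩ := hfree lam hlam t ht
  have hfr := sq_norm_free_deriv_le hc hlam hK₀ f1 f2 x y
  have hwA := wt_mul_eq (lt_of_lt_of_le one_pos hw) x y
  have hA0 : 0 ≤ ‖x‖ ^ 2 + ‖y‖ ^ 2 / wt c lam := by
    have : 0 < wt c lam := by linarith
    positivity
  generalize ‖x‖ ^ 2 + ‖y‖ ^ 2 / wt c lam = A at *
  rw [← hwA] at hfr ⊢
  have hAw : A ≤ wt c lam * A := le_mul_of_one_le_left hA0 hw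
  generalize wt c lam * A = W at *
  have hz2 : MemLp z 2 (vol T) := memLp_of_continuousOn h.continuous.continuousOn
  have hnz : nsq T z ≤ T * (K₁ * A) := nsq_le_of_bound hT.le hz0
  have hg2 := memLp_force (β := -(a₀ ^ 2 / 4 + b₀)) hT.le hK.memLp hz2
  have hng : nsq T (force (-(a₀ ^ 2 / 4 + b₀)) κ z) ≤ F * (T * (K₁ * A)) :=
    (hF z hz2).trans (mul_le_mul_of_nonneg_left hnz hF0)
  have hcc : ‖conv (cw lam) (force (-(a₀ ^ 2 / 4 + b₀)) κ z) t‖ ^ 2 ≤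
      (T * K₀) * (F * (T * (K₁ * A))) :=
    (sq_norm_conv_le ht (memLp_of_continuousOn (cw_continuous lam).continuousOn) hg2).trans
      (mul_le_mul (nsq_le_of_bound hT.le fun s hs => (hfree lam hlam s hs).1) hng
        (nsq_nonneg _ _) (by positivity))
  have hp : ‖z₁ t - a₀ * z t - conv μ' z t‖ ^ 2 ≤
      2 * (2 * (1 + c) ^ 2 * K₀ * W) + 2 * ((T * K₀) * (F * (T * (K₁ * A)))) := by
    rw [h.aux_deriv_eq_cw hT hK t ht]
    exact (sq_norm_add_le _ _).trans (add_le_add (mul_le_mul_of_nonneg_left hfr two_pos.le)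
      (mul_le_mul_of_nonneg_left hcc two_pos.le))
  have g0 := sq_norm_add_le (z₁ t - a₀ * z t - conv μ' z t) (a₀ * z t + conv μ' z t)
  have e1 : (z₁ t - a₀ * z t - conv μ' z t) + (a₀ * z t + conv μ' z t) = z₁ t := by ring
  rw [e1] at g0
  have g1 := sq_norm_add_le (a₀ * z t) (conv μ' z t)
  have g2 := sq_norm_conv_mode_le hT.le hμ'2 h.continuous.continuousOn hz0 ht
  have g3 : ‖a₀ * z t‖ ^ 2 ≤ ‖a₀‖ ^ 2 * (K₁ * A) := by
    rw [norm_mul, mul_pow]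
    exact mul_le_mul_of_nonneg_left (hz0 t ht) (by positivity)
  have g4 : (4 * (T * K₀ * (F * (T * K₁))) + 4 * ‖a₀‖ ^ 2 * K₁ + 4 * (nsq T μ' * T * K₁)) * A ≤
      (4 * (T * K₀ * (F * (T * K₁))) + 4 * ‖a₀‖ ^ 2 * K₁ + 4 * (nsq T μ' * T * K₁)) * W :=
    mul_le_mul_of_nonneg_left hAw (by positivity)
  linarith

/-- Read off from the mode equation; the factor `λ` there costs one more power of the weight than
the bound for `z₁`. -/
theorem IsMode.exists_bound_deriv2 {c : ℝ} (hc : 0 ≤ c) (hT : 0 < T)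
    (hK : IsKernel T a₀ b₀ μ μ' κ) :
    ∃ K : ℝ, 0 < K ∧ ∀ (lam : ℝ) (x y : ℂ) (z z₁ z₂ : ℝ → ℂ), -c ≤ lam →
      IsMode T a₀ μ lam x y z z₁ z₂ → ∀ t ∈ Icc 0 T,
        ‖z₂ t‖ ^ 2 ≤ K * (wt c lam ^ 2 * ‖x‖ ^ 2 + wt c lam * ‖y‖ ^ 2) := by
  obtain ⟨K₁, hK₁, hz⟩ := IsMode.exists_bound hc hT hK
  obtain ⟨K₂, hK₂, hzd⟩ := IsMode.exists_bound_deriv hc hT hK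
  have hμ2 := memLp_of_continuousOn (hK.continuousOn hT.le)
  have hnμ := nsq_nonneg T μ
  refine ⟨4 * ‖a₀‖ ^ 2 * K₂ + 4 * ‖a₀ ^ 2 / 4‖ ^ 2 * K₁ +
    2 * ((1 + c) ^ 2 * (2 * K₁ + 2 * (nsq T μ * T * K₁))), by positivity,
    fun lam x y z z₁ z₂ hlam h t ht => ?_⟩
  have hw := one_le_wt hlam
  have hl := sq_le_wt hc hlam
  have hz0 : ∀ t ∈ Icc 0 T, ‖z t‖ ^ 2 ≤ K₁ * (‖x‖ ^ 2 + ‖y‖ ^ 2 / wt c lam) :=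
    fun t ht => hz lam x y z z₁ z₂ hlam h t ht
  have hz1 := hzd lam x y z z₁ z₂ hlam h t ht
  have hw0 : 0 < wt c lam := by linarith
  have hwA := wt_mul_eq hw0 x y
  have hA0 : 0 ≤ ‖x‖ ^ 2 + ‖y‖ ^ 2 / wt c lam := by positivity
  generalize wt c lam = w at *
  have hwwA : w ^ 2 * ‖x‖ ^ 2 + w * ‖y‖ ^ 2 = w ^ 2 * (‖x‖ ^ 2 + ‖y‖ ^ 2 / w) := by
    rw [sq w, mul_assoc w w (‖x‖ ^ 2 + ‖y‖ ^ 2 / w), hwA]; ring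
  rw [hwwA]
  rw [← hwA] at hz1
  generalize ‖x‖ ^ 2 + ‖y‖ ^ 2 / w = A at *
  have g0 := sq_norm_add_le (a₀ * z₁ t + -(a₀ ^ 2 / 4) * z t) ((-lam) * (z t - conv μ z t))
  have e1 : (a₀ * z₁ t + -(a₀ ^ 2 / 4) * z t) + (-lam) * (z t - conv μ z t) = z₂ t := by
    rw [h.ode t ht]; ring
  rw [e1] at g0
  have g1 := sq_norm_add_le (a₀ * z₁ t) (-(a₀ ^ 2 / 4) * z t)
  have hww : w * A ≤ w ^ 2 * A := mul_le_mul_of_nonneg_right (by nlinarith) hA0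
  have hAw : A ≤ w ^ 2 * A := le_mul_of_one_le_left hA0 (one_le_pow₀ hw)
  have g2 : ‖a₀ * z₁ t‖ ^ 2 ≤ ‖a₀‖ ^ 2 * (K₂ * (w ^ 2 * A)) := by
    rw [norm_mul, mul_pow]
    exact mul_le_mul_of_nonneg_left (hz1.trans (mul_le_mul_of_nonneg_left hww hK₂.le))
      (by positivity)
  have g3 : ‖-(a₀ ^ 2 / 4) * z t‖ ^ 2 ≤ ‖a₀ ^ 2 / 4‖ ^ 2 * (K₁ * (w ^ 2 * A)) := by
    rw [norm_mul, mul_pow, norm_neg]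
    exact mul_le_mul_of_nonneg_left ((hz0 t ht).trans (mul_le_mul_of_nonneg_left hAw hK₁.le))
      (by positivity)
  have g4 : ‖z t - conv μ z t‖ ^ 2 ≤ 2 * (K₁ * A) + 2 * (nsq T μ * T * (K₁ * A)) := by
    have h1 := sq_norm_add_le (z t) (-conv μ z t)
    rw [norm_neg, ← sub_eq_add_neg] at h1
    have h2 := sq_norm_conv_mode_le hT.le hμ2 h.continuous.continuousOn hz0 ht
    have h3 := hz0 t ht
    linarith
  have g5 : ‖(-lam : ℂ) * (z t - conv μ z t)‖ ^ 2 ≤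
      ((1 + c) ^ 2 * w ^ 2) * (2 * (K₁ * A) + 2 * (nsq T μ * T * (K₁ * A))) := by
    rw [norm_mul, mul_pow, norm_neg, Complex.norm_real, Real.norm_eq_abs, sq_abs]
    exact mul_le_mul hl g4 (by positivity) (by positivity)
  linarith

/-! ### Linearity of the mode equation -/

theorem IsMode.const_mul {lam : ℝ} {x y : ℂ} {z z₁ z₂ : ℝ → ℂ} (a : ℂ)
    (h : IsMode T a₀ μ lam x y z z₁ z₂) :
    IsMode T a₀ μ lam (a * x) (a * y) (fun t => a * z t) (fun t => a * z₁ t)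
      (fun t => a * z₂ t) where
  cont := continuous_const.mul h.cont
  eq_primitive t := by
    rw [intervalIntegral.integral_const_mul, h.eq_primitive t]; ring
  deriv_eq_primitive t := by
    rw [intervalIntegral.integral_const_mul, h.deriv_eq_primitive t]; ring
  ode t ht := by
    rw [conv_const_mul_right, h.ode t ht]; ring

theorem IsMode.add {lam : ℝ} {x y x' y' : ℂ} {z z₁ z₂ z' z₁' z₂' : ℝ → ℂ}
    (hμ : ContinuousOn μ (Icc 0 T)) (h : IsMode T a₀ μ lam x y z z₁ z₂)
    (h' : IsMode T a₀ μ lam x' y' z' z₁' z₂') :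
    IsMode T a₀ μ lam (x + x') (y + y') (fun t => z t + z' t) (fun t => z₁ t + z₁' t)
      (fun t => z₂ t + z₂' t) where
  cont := h.cont.add h'.cont
  eq_primitive t := by
    rw [intervalIntegral.integral_add (h.deriv_continuous.intervalIntegrable _ _)
      (h'.deriv_continuous.intervalIntegrable _ _), h.eq_primitive t, h'.eq_primitive t]
    ring
  deriv_eq_primitive t := by
    rw [intervalIntegral.integral_add (h.cont.intervalIntegrable _ _)
      (h'.cont.intervalIntegrable _ _), h.deriv_eq_primitive t, h'.deriv_eq_primitive t]
    ring
  ode t ht := by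
    have hk : IntervalIntegrable μ volume 0 t :=
      (hμ.mono (Icc_subset_Icc_right ht.2)).intervalIntegrable_of_Icc ht.1
    rw [conv_add_right (conv_integrand ht.1 hk h.continuous.continuousOn)
      (conv_integrand ht.1 hk h'.continuous.continuousOn), h.ode t ht, h'.ode t ht]
    ring

/-- The difference is a mode with zero data, which the uniform bound annihilates; for one fixed
eigenvalue `c = |λ|` is an admissible lower bound. -/
theorem IsMode.unique (hT : 0 < T) (hK : IsKernel T a₀ b₀ μ μ' κ) {lam : ℝ} {x y : ℂ}
    {z z₁ z₂ z' z₁' z₂' : ℝ → ℂ} (h : IsMode T a₀ μ lam x y z z₁ z₂)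
    (h' : IsMode T a₀ μ lam x y z' z₁' z₂') : EqOn z z' (Icc 0 T) := by
  obtain ⟨K, -, hb⟩ := IsMode.exists_bound (abs_nonneg lam) hT hK
  have h2 := h.add (hK.continuousOn hT.le) (h'.const_mul (-1))
  intro t ht
  have h3 := hb lam _ _ _ _ _ (neg_abs_le lam) h2 t ht
  simp only [neg_mul, one_mul, add_neg_cancel, norm_zero] at h3
  simp only [ne_eq, OfNat.ofNat_ne_zero, not_false_eq_true, zero_pow, zero_div, add_zero,
    mul_zero] at h3
  have h4 := pow_eq_zero_iff two_ne_zero |>.1 (le_antisymm h3 (by positivity))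
  exact add_neg_eq_zero.1 (norm_eq_zero.1 h4)

end ModeBounds

/-! ### Observation of finite sums of modes -/

section Observation

variable {ι G : Type*} [NormedAddCommGroup G] [InnerProductSpace ℂ G]

/-- The squared energy norm of finitely many modes. -/
def energy (c : ℝ) (lam : ι → ℝ) (s : Finset ι) (x y : ι → ℂ) : ℝ :=
  ∑ i ∈ s, (wt c (lam i) * ‖x i‖ ^ 2 + ‖y i‖ ^ 2)

/-- Two-sided observability estimate for finite sums of free modes. -/
def FreeObs (c : ℝ) (lam : ι → ℝ) (b : ι → G) (T : ℝ) : Prop :=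
  ∃ C : ℝ, 0 < C ∧ ∀ (s : Finset ι) (x y : ι → ℂ),
    energy c lam s x y ≤ C * nsq T (vs s (fun i => free (lam i) (x i) (y i)) b) ∧
    nsq T (vs s (fun i => free (lam i) (x i) (y i)) b) ≤ C * energy c lam s x y

variable {T c : ℝ} {lam : ι → ℝ} {b : ι → G} {a₀ b₀ : ℂ} {μ μ' κ : ℝ → ℂ}

theorem vs_free_continuous (s : Finset ι) (x y : ι → ℂ) :
    Continuous (vs s (fun i => free (lam i) (x i) (y i)) b) :=
  continuous_finsetSum _ fun _ _ => (free_continuous _ _ _).smul continuous_const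

/-- Uniform bound for finite sums of forced evolutions. -/
theorem FreeObs.duhamel_bound [CompleteSpace G] (hT : 0 ≤ T) (h : FreeObs c lam b T) :
    ∃ C : ℝ, 0 < C ∧ ∀ (s : Finset ι) (f : ι → ℝ → ℂ), (∀ i, MemLp (f i) 2 (vol T)) →
      nsq T (vs s (fun i => conv (sw (lam i)) (f i)) b) ≤ C * ∑ i ∈ s, nsq T (f i) := by
  obtain ⟨C, hC, hobs⟩ := h
  refine ⟨T * C + 1, by positivity, fun s f hf => ?_⟩
  have key := nsq_duhamel_le (s := s) (b := b) hT (S := fun i => sw (lam i)) hC.le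
    (fun i => sw_continuous _) hf
    (fun i => conv_sw_continuousOn hT _ (MemLp.intervalIntegrable hT (hf i))) fun x => by
      have h1 := (hobs s (fun _ => 0) x).2
      have h2 : (fun i => free (lam i) 0 (x i)) = fun i t => x i * sw (lam i) t := by
        ext i t; simp [free]
      rw [h2] at h1
      simpa [energy] using h1
  have h0 : 0 ≤ ∑ i ∈ s, nsq T (f i) := Finset.sum_nonneg fun i _ => nsq_nonneg _ _
  nlinarith

theorem conv_memory_bound (hT : 0 ≤ T) (hμ : ContinuousOn μ (Icc 0 T)) :
    ∃ K : ℝ, 0 ≤ K ∧ ∀ f : ℝ → G, ContinuousOn f (Icc 0 T) → ∀ t ∈ Icc 0 T,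
      ‖conv μ f t‖ ≤ K * ∫ s in (0 : ℝ)..t, ‖f s‖ := by
  obtain ⟨K, hK⟩ := (isCompact_Icc (a := (0 : ℝ)) (b := T)).exists_bound_of_continuousOn hμ
  refine ⟨K, (norm_nonneg _).trans (hK 0 (left_mem_Icc.2 hT)), fun f hf t ht => ?_⟩
  rw [← intervalIntegral.integral_const_mul]
  refine intervalIntegral.norm_integral_le_of_norm_le ht.1 (Eventually.of_forall fun s hs => ?_)
    (((hf.mono (Icc_subset_Icc_right ht.2)).norm.intervalIntegrable_of_Icc ht.1).const_mul K)
  rw [norm_smul]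
  exact mul_le_mul_of_nonneg_right
    (hK _ ⟨sub_nonneg.2 hs.2, by linarith [hs.1, ht.2]⟩) (norm_nonneg _)

/-- The memory operator does not change square norms, up to constants. -/
theorem memory_nsq_bounds [CompleteSpace G] (hT : 0 ≤ T) (hμ : ContinuousOn μ (Icc 0 T)) :
    ∃ C : ℝ, 0 < C ∧ ∀ (s : Finset ι) (z : ι → ℝ → ℂ), (∀ i, ContinuousOn (z i) (Icc 0 T)) →
      (∀ i, ContinuousOn (conv μ (z i)) (Icc 0 T)) →
      nsq T (vs s (fun i t => z i t - conv μ (z i) t) b) ≤ C * nsq T (vs s z b) ∧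
      nsq T (vs s z b) ≤ C * nsq T (vs s (fun i t => z i t - conv μ (z i) t) b) := by
  obtain ⟨K, hK0, hK⟩ := conv_memory_bound (G := G) hT hμ
  have hμ2 := memLp_of_continuousOn hμ
  have hnμ := nsq_nonneg T μ
  refine ⟨(2 + 2 * (T * nsq T μ)) + (2 + 2 * T ^ 2 * (K * Real.exp (K * T)) ^ 2), by positivity,
    fun s z hz hzc => ?_⟩
  have hV : ContinuousOn (vs s z b) (Icc 0 T) := vs_continuousOn hz
  have hC : ∀ t ∈ Icc 0 T, vs s (fun i => conv μ (z i)) b t = conv μ (vs s z b) t := fun t ht =>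
    vs_conv fun i => conv_integrand ht.1
      ((hμ.mono (Icc_subset_Icc_right ht.2)).intervalIntegrable_of_Icc ht.1)
      ((hz i).mono (Icc_subset_Icc_right ht.2))
  have hCc : ContinuousOn (vs s (fun i => conv μ (z i)) b) (Icc 0 T) := vs_continuousOn hzc
  have hU : ContinuousOn (vs s (fun i t => z i t - conv μ (z i) t) b) (Icc 0 T) :=
    vs_continuousOn fun i => (hz i).sub (hzc i)
  have hV0 := nsq_nonneg T (vs s z b)
  have hU0 := nsq_nonneg T (vs s (fun i t => z i t - conv μ (z i) t) b)
  constructor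
  · have h1 : nsq T (vs s (fun i t => z i t - conv μ (z i) t) b) ≤
        2 * nsq T (vs s z b) + 2 * nsq T (vs s (fun i => conv μ (z i)) b) := by
      rw [nsq_congr fun t _ => vs_sub z (fun i => conv μ (z i)) t]
      exact nsq_sub_le (memLp_of_continuousOn hV) (memLp_of_continuousOn hCc)
    have h2 : nsq T (vs s (fun i => conv μ (z i)) b) ≤ T * (nsq T μ * nsq T (vs s z b)) := by
      rw [nsq_congr hC]
      exact nsq_le_of_bound hT fun t ht => sq_norm_conv_le ht hμ2 (memLp_of_continuousOn hV)
    have h3 : 0 ≤ (2 + 2 * T ^ 2 * (K * Real.exp (K * T)) ^ 2) * nsq T (vs s z b) := by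
      positivity
    linarith
  · have h1 := nsq_le_of_le_add_integral hT hK0 hV hU fun t ht => by
      have e : vs s z b t = vs s (fun i t => z i t - conv μ (z i) t) b t + conv μ (vs s z b) t := by
        rw [vs_sub, hC t ht, sub_add_cancel]
      have h2 := norm_add_le (vs s (fun i t => z i t - conv μ (z i) t) b t) (conv μ (vs s z b) t)
      rw [← e] at h2
      exact h2.trans (add_le_add_right (hK _ hV t ht) _)
    refine h1.trans (mul_le_mul_of_nonneg_right ?_ hU0)
    have : 0 ≤ T * nsq T μ := by positivity
    linarith

/-- A family of modes with the given data. -/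
def IsModes (T : ℝ) (a₀ : ℂ) (μ : ℝ → ℂ) (lam : ι → ℝ) (x y : ι → ℂ) (z z₁ z₂ : ι → ℝ → ℂ) :
    Prop := ∀ i, IsMode T a₀ μ (lam i) (x i) (y i) (z i) (z₁ i) (z₂ i)

variable {x y : ι → ℂ} {z z₁ z₂ : ι → ℝ → ℂ}

theorem IsModes.continuousOn (h : IsModes T a₀ μ lam x y z z₁ z₂) (i : ι) :
    ContinuousOn (z i) (Icc 0 T) := (h i).continuous.continuousOn

theorem IsModes.conv_continuousOn (hT : 0 ≤ T) (hμ : ContinuousOn μ (Icc 0 T))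
    (h : IsModes T a₀ μ lam x y z z₁ z₂) (i : ι) : ContinuousOn (conv μ (z i)) (Icc 0 T) :=
  (h i).conv_continuousOn' hT (hμ.intervalIntegrable_of_Icc hT)

/-- The forcing terms in the equation for `u = z - μ * z` are of lower order. -/
theorem force_bound [CompleteSpace G] (hT : 0 < T) (hc : 0 ≤ c) (hlam : ∀ i, -c ≤ lam i)
    (hK : IsKernel T a₀ b₀ μ μ' κ) (hobs : FreeObs c lam b T) :
    ∃ C : ℝ, 0 < C ∧ ∀ (s : Finset ι) (x y : ι → ℂ) (z z₁ z₂ : ι → ℝ → ℂ),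
      IsModes T a₀ μ lam x y z z₁ z₂ →
      nsq T (vs s (fun i => conv (sw (lam i)) (force (-(a₀ ^ 2 / 4 + b₀)) κ (z i))) b) ≤
        C * ∑ i ∈ s, (‖x i‖ ^ 2 + ‖y i‖ ^ 2 / wt c (lam i)) := by
  obtain ⟨C, hC, hD⟩ := hobs.duhamel_bound hT.le
  obtain ⟨K, hK0, hb⟩ := IsMode.exists_bound hc hT hK
  have hκ0 := nsq_nonneg T κ
  refine ⟨C * ((2 * ‖-(a₀ ^ 2 / 4 + b₀)‖ ^ 2 + 2 * (T * nsq T κ)) * (T * K)) + 1, by positivity,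
    fun s x y z z₁ z₂ h => ?_⟩
  have hz2 : ∀ i, MemLp (z i) 2 (vol T) := fun i => memLp_of_continuousOn (h.continuousOn i)
  have hw : ∀ i, 0 < wt c (lam i) := fun i => one_pos.trans_le (one_le_wt (hlam i))
  refine (hD s _ fun i => memLp_force hT.le hK.memLp (hz2 i)).trans ?_
  have h1 : ∑ i ∈ s, nsq T (force (-(a₀ ^ 2 / 4 + b₀)) κ (z i)) ≤
      ((2 * ‖-(a₀ ^ 2 / 4 + b₀)‖ ^ 2 + 2 * (T * nsq T κ)) * (T * K)) *
        ∑ i ∈ s, (‖x i‖ ^ 2 + ‖y i‖ ^ 2 / wt c (lam i)) := by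
    rw [Finset.mul_sum]
    refine Finset.sum_le_sum fun i _ => ?_
    refine (nsq_force_le hT.le hK.memLp (hz2 i)).trans ?_
    rw [mul_assoc]
    refine mul_le_mul_of_nonneg_left ?_ (by positivity)
    rw [mul_assoc]
    exact nsq_le_of_bound hT.le fun t ht => hb _ _ _ _ _ _ (hlam i) (h i) t ht
  have h2 : 0 ≤ ∑ i ∈ s, (‖x i‖ ^ 2 + ‖y i‖ ^ 2 / wt c (lam i)) :=
    Finset.sum_nonneg fun i _ => by have := hw i; positivity
  have h3 := mul_le_mul_of_nonneg_left h1 hC.le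
  linarith

theorem IsModes.vs_aux_eq (hT : 0 ≤ T) (hK : IsKernel T a₀ b₀ μ μ' κ)
    (h : IsModes T a₀ μ lam x y z z₁ z₂) (s : Finset ι) {t : ℝ} (ht : t ∈ Icc 0 T) :
    vs s (fun i t => z i t - conv μ (z i) t) b t = vs s (fun i => free (lam i) (x i) (y i)) b t +
      vs s (fun i => conv (sw (lam i)) (force (-(a₀ ^ 2 / 4 + b₀)) κ (z i))) b t := by
  rw [← vs_add]
  exact vs_congr fun i => (h i).aux_eq hT hK t ht

theorem sum_lower_le_energy (hlam : ∀ i, -c ≤ lam i) (s : Finset ι) (x y : ι → ℂ) :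
    ∑ i ∈ s, (‖x i‖ ^ 2 + ‖y i‖ ^ 2 / wt c (lam i)) ≤ energy c lam s x y := by
  refine Finset.sum_le_sum fun i _ => ?_
  have hw := one_le_wt (hlam i)
  exact add_le_add (le_mul_of_one_le_left (by positivity) hw) (div_le_self (by positivity) hw)

theorem energy_nonneg (hlam : ∀ i, -c ≤ lam i) (s : Finset ι) (x y : ι → ℂ) :
    0 ≤ energy c lam s x y :=
  Finset.sum_nonneg fun i _ => by
    have := one_le_wt (hlam i)
    positivity

/-- The observation of finite sums of modes is bounded by the energy, and bounds the energy up to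
a lower order term. -/
theorem modes_obs [CompleteSpace G] (hT : 0 < T) (hc : 0 ≤ c) (hlam : ∀ i, -c ≤ lam i)
    (hK : IsKernel T a₀ b₀ μ μ' κ) (hobs : FreeObs c lam b T) :
    ∃ C : ℝ, 0 < C ∧ ∀ (s : Finset ι) (x y : ι → ℂ) (z z₁ z₂ : ι → ℝ → ℂ),
      IsModes T a₀ μ lam x y z z₁ z₂ →
      nsq T (vs s z b) ≤ C * energy c lam s x y ∧
      energy c lam s x y ≤ C * nsq T (vs s z b) +
        C * ∑ i ∈ s, (‖x i‖ ^ 2 + ‖y i‖ ^ 2 / wt c (lam i)) := by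
  obtain ⟨C₁, hC₁, hf⟩ := force_bound hT hc hlam hK hobs
  obtain ⟨C₂, hC₂, hm⟩ := memory_nsq_bounds (ι := ι) (b := b) hT.le (hK.continuousOn hT.le)
  obtain ⟨C₀, hC₀, ho⟩ := hobs
  refine ⟨C₂ * (2 * C₀ + 2 * C₁) + C₀ * (2 * C₂) + C₀ * (2 * C₁), by positivity,
    fun s x y z z₁ z₂ h => ?_⟩
  have hzc := fun i => h.conv_continuousOn hT.le (hK.continuousOn hT.le) i
  obtain ⟨m1, m2⟩ := hm s z h.continuousOn hzc
  obtain ⟨o1, o2⟩ := ho s x y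
  have f1 := hf s x y z z₁ z₂ h
  have hL := sum_lower_le_energy hlam s x y
  have hE := energy_nonneg hlam s x y
  have hL0 : 0 ≤ ∑ i ∈ s, (‖x i‖ ^ 2 + ‖y i‖ ^ 2 / wt c (lam i)) :=
    Finset.sum_nonneg fun i _ => by have := one_le_wt (hlam i); positivity
  set U := vs s (fun i t => z i t - conv μ (z i) t) b with hU
  set W := vs s (fun i => free (lam i) (x i) (y i)) b with hW
  set D := vs s (fun i => conv (sw (lam i)) (force (-(a₀ ^ 2 / 4 + b₀)) κ (z i))) b with hD
  have hUc : MemLp U 2 (vol T) := memLp_of_continuousOn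
    (vs_continuousOn fun i => (h.continuousOn i).sub (hzc i))
  have hWc : MemLp W 2 (vol T) := memLp_of_continuousOn (vs_free_continuous s x y).continuousOn
  have hDc : MemLp D 2 (vol T) := memLp_of_continuousOn (vs_continuousOn fun i =>
    conv_sw_continuousOn hT.le _
      (((h i).force_continuousOn hT.le hK _).intervalIntegrable_of_Icc hT.le))
  have e : ∀ t ∈ Icc 0 T, U t = W t + D t := fun t ht => h.vs_aux_eq hT.le hK s ht
  have n1 : nsq T U ≤ 2 * nsq T W + 2 * nsq T D := by
    rw [nsq_congr e]; exact nsq_add_le hWc hDc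
  have n2 : nsq T W ≤ 2 * nsq T U + 2 * nsq T D := by
    rw [nsq_congr fun t ht => show W t = U t - D t by rw [e t ht, add_sub_cancel_right]]
    exact nsq_sub_le hUc hDc
  have hz0 := nsq_nonneg T (vs s z b)
  set L := ∑ i ∈ s, (‖x i‖ ^ 2 + ‖y i‖ ^ 2 / wt c (lam i))
  set Z := nsq T (vs s z b)
  set En := energy c lam s x y
  constructor
  · have h1 : nsq T U ≤ (2 * C₀ + 2 * C₁) * En := by nlinarith
    have h2 := mul_le_mul_of_nonneg_left h1 hC₂.le
    have h3 : 0 ≤ (C₀ * (2 * C₂) + C₀ * (2 * C₁)) * En := by positivity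
    linarith
  · have h1 : nsq T W ≤ 2 * C₂ * Z + 2 * C₁ * L := by linarith
    have h2 := mul_le_mul_of_nonneg_left h1 hC₀.le
    have h3 : 0 ≤ (C₂ * (2 * C₀ + 2 * C₁) + C₀ * (2 * C₁)) * Z := by positivity
    have h4 : 0 ≤ (C₂ * (2 * C₀ + 2 * C₁) + C₀ * (2 * C₂)) * L := by positivity
    linarith

end Observation

/-! ### Translates and increments in L² -/

section Shift

variable {G : Type*} [NormedAddCommGroup G] [NormedSpace ℂ G]

theorem nsq_shift_le {T T' h : ℝ} (hT' : 0 ≤ T') (hh : 0 ≤ h) (hTT : T' + h ≤ T) {f : ℝ → G}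
    (hf : MemLp f 2 (vol T)) : nsq T' (fun t => f (t + h)) ≤ nsq T f := by
  have h1 : nsq T' (fun t => f (t + h)) = ∫ t in Icc h (T' + h), ‖f t‖ ^ 2 := by
    rw [nsq, integral_Icc_eq_integral_Ioc, integral_Icc_eq_integral_Ioc,
      ← intervalIntegral.integral_of_le hT', ← intervalIntegral.integral_of_le (by linarith),
      intervalIntegral.integral_comp_add_right (fun t => ‖f t‖ ^ 2), zero_add]
  rw [h1]
  exact setIntegral_mono_set (integrable_sq hf) (Eventually.of_forall fun _ => by positivity)
    (Icc_subset_Icc hh hTT).eventuallyLE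

/-- Cauchy–Schwarz on a window of length `h` gives one factor `h`, and Tonelli in the position
within the window gives the other. Joint measurability is why `D` is strongly measurable here; the
general case passes to a representative. -/
theorem nsq_difference_le_aux {T T' h : ℝ} (hT' : 0 ≤ T') (hh : 0 ≤ h) (hTT : T' + h ≤ T)
    {D : ℝ → G} (hD : MemLp D 2 (vol T)) (hm : StronglyMeasurable D) :
    nsq T' (fun t => ∫ s in t..t + h, D s) ≤ h ^ 2 * nsq T D := by
  have hTh : ∀ t ∈ Icc 0 T', MemLp (fun r => D (t + r)) 2 (vol h) := by
    intro t ht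
    have hmp := (measurePreserving_add_left volume t).restrict_preimage
      (measurableSet_Icc (a := t) (b := t + h))
    have he : (fun s => t + s) ⁻¹' Icc t (t + h) = Icc 0 h := by
      ext s; simp
    rw [he] at hmp
    exact (hD.mono_measure (Measure.restrict_mono
      (Icc_subset_Icc ht.1 (by linarith [ht.2])) le_rfl)).comp_measurePreserving hmp
  have hval : ∀ t, ∫ s in t..t + h, D s = ∫ r in (0 : ℝ)..h, D (t + r) := by
    intro t
    rw [intervalIntegral.integral_comp_add_left, add_zero]
  have hDi : IntervalIntegrable D volume 0 T :=
    (intervalIntegrable_iff_integrableOn_Icc_of_le (by linarith)).2 (hD.integrable (by norm_num))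
  have hcont : ContinuousOn (fun t => ∫ s in t..t + h, D s) (Icc 0 T') := by
    have hP := continuousOn_primitive_Icc (by linarith) hDi
    have hsub : ∀ x y, x ∈ Icc 0 T → y ∈ Icc 0 T → IntervalIntegrable D volume x y :=
      fun x y hx hy => hDi.mono_set (by
        rw [uIcc_of_le (hx.1.trans hx.2)]; exact uIcc_subset_Icc hx hy)
    have h0 : (0 : ℝ) ∈ Icc 0 T := ⟨le_rfl, by linarith⟩
    have hc : ContinuousOn (fun t => ∫ s in (0 : ℝ)..t + h, D s) (Icc 0 T') :=
      hP.comp (f := fun t => t + h) (by fun_prop)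
        fun t ht => ⟨by linarith [ht.1], by linarith [ht.2]⟩
    have := hc.sub (hP.mono (Icc_subset_Icc_right (by linarith : T' ≤ T)))
    refine this.congr fun t ht => ?_
    have ht1 : t ∈ Icc 0 T := ⟨ht.1, by linarith [ht.2]⟩
    have ht2 : t + h ∈ Icc 0 T := ⟨by linarith [ht.1], by linarith [ht.2]⟩
    exact (intervalIntegral.integral_interval_sub_left (hsub _ _ h0 ht2) (hsub _ _ h0 ht1)).symm
  refine nsq_le_of_lintegral_le (by have := nsq_nonneg T D; positivity)
    (memLp_of_continuousOn hcont) ?_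
  calc ∫⁻ t in Icc 0 T', ‖∫ s in t..t + h, D s‖ₑ ^ 2
      ≤ ∫⁻ t in Icc 0 T', ENNReal.ofReal h * ∫⁻ r in Icc 0 h, ‖D (t + r)‖ₑ ^ 2 := by
        refine setLIntegral_mono' measurableSet_Icc fun t ht => ?_
        have h1 := sq_norm_integral_le (right_mem_Icc.2 hh) (hTh t ht)
        rw [← ofReal_nsq (hTh t ht), ← ENNReal.ofReal_mul hh, ← ofReal_norm,
          ← ENNReal.ofReal_pow (norm_nonneg _), hval]
        exact ENNReal.ofReal_le_ofReal h1
    _ = ENNReal.ofReal h * ∫⁻ t in Icc 0 T', ∫⁻ r in Icc 0 h, ‖D (t + r)‖ₑ ^ 2 :=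
        lintegral_const_mul' _ _ ENNReal.ofReal_ne_top
    _ = ENNReal.ofReal h * ∫⁻ r in Icc 0 h, ∫⁻ t in Icc 0 T', ‖D (t + r)‖ₑ ^ 2 := by
        rw [lintegral_lintegral_swap]
        exact ((hm.comp_measurable (measurable_fst.add measurable_snd)).enorm.pow_const 2).aemeasurable
    _ ≤ ENNReal.ofReal h * ∫⁻ _ in Icc 0 h, ENNReal.ofReal (nsq T D) := by
        refine mul_le_mul_right (setLIntegral_mono' measurableSet_Icc fun r hr => ?_) _
        rw [ofReal_nsq hD, ← lintegral_indicator measurableSet_Icc,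
          ← lintegral_indicator measurableSet_Icc,
          ← lintegral_add_right_eq_self ((Icc 0 T).indicator fun t => ‖D t‖ₑ ^ 2) r]
        refine lintegral_mono fun t => ?_
        simp only [indicator_apply, mem_Icc]
        split_ifs with h1 h2
        · exact le_rfl
        · exact absurd ⟨by linarith [h1.1, hr.1], by linarith [h1.2, hr.2]⟩ h2
        all_goals exact zero_le
    _ = ENNReal.ofReal (h ^ 2 * nsq T D) := by
        rw [lintegral_const, Measure.restrict_apply MeasurableSet.univ, univ_inter, Real.volume_Icc,
          sub_zero, mul_comm (ENNReal.ofReal (nsq T D)), ← mul_assoc, ← ENNReal.ofReal_mul hh,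
          ← ENNReal.ofReal_mul (by positivity), sq]

/-- Differences of a primitive are controlled by the derivative. -/
theorem nsq_difference_le {T T' h : ℝ} (hT' : 0 ≤ T') (hh : 0 ≤ h) (hTT : T' + h ≤ T)
    {D : ℝ → G} (hD : MemLp D 2 (vol T)) :
    nsq T' (fun t => ∫ s in t..t + h, D s) ≤ h ^ 2 * nsq T D := by
  have hae := hD.1.ae_eq_mk
  have h1 := nsq_difference_le_aux hT' hh hTT (hD.ae_eq hae) hD.1.stronglyMeasurable_mk
  rw [← nsq_congr_ae hae] at h1
  refine le_of_eq_of_le (nsq_congr fun t ht => ?_) h1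
  refine intervalIntegral.integral_congr_ae ?_
  have h2 := (ae_restrict_iff' measurableSet_Icc).1 hae
  filter_upwards [h2] with s hs hst
  rw [uIoc_of_le (by linarith)] at hst
  exact hs ⟨by linarith [ht.1, hst.1], by linarith [ht.2, hst.2]⟩

end Shift

/-! ### Gain of regularity through difference quotients -/

section Regularity

variable {ι G : Type*} [NormedAddCommGroup G] [InnerProductSpace ℂ G] [CompleteSpace G]
  {T c : ℝ} {lam : ι → ℝ} {b : ι → G}

/-- A translate of a free evolution is the free evolution of the translated data, so the
observability estimate applies to increments in time. -/
theorem free_shift (lam : ℝ) (x y : ℂ) (t h : ℝ) :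
    free lam x y (t + h) = free lam (free lam x y h) (free lam y (-lam * x) h) t := by
  simp only [free, cw_add, sw_add]
  ring

theorem free_sub (lam : ℝ) (x y x' y' : ℂ) (t : ℝ) :
    free lam (x - x') (y - y') t = free lam x y t - free lam x' y' t := by
  simp only [free]; ring

theorem free_hasDerivAt (lam : ℝ) (x y : ℂ) (t : ℝ) :
    HasDerivAt (free lam x y) (free lam y (-lam * x) t) t := by
  refine (((cw_hasDerivAt lam t).const_mul x).add ((sw_hasDerivAt lam t).const_mul y)).congr_deriv ?_
  simp only [free]; ring

theorem free_zero (lam : ℝ) (x y : ℂ) : free lam x y 0 = x := by simp [free, cw_zero, sw_zero]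

/-- If the observation of a free evolution is differentiable in time, then its data are more
regular. -/
theorem free_regularity {T₀ : ℝ} (hT₀ : 0 ≤ T₀) (hT : T₀ < T) (hlam : ∀ i, -c ≤ lam i)
    (hobs : ∀ T', T₀ < T' → FreeObs c lam b T') {x y : ι → ℂ} {q q' : ι → ℝ → ℂ}
    (hq' : ∀ i, MemLp (q' i) 2 (vol T))
    (hq : ∀ i, ∀ t ∈ Icc 0 T, q i t = ∫ s in (0 : ℝ)..t, q' i s) {K : ℝ}
    (hK : ∀ s, nsq T (vs s q' b) ≤ K)
    (h0 : Tendsto (fun s => nsq T (vs s (fun i t => free (lam i) (x i) (y i) t + q i t) b))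
      atTop (𝓝 0)) :
    Summable fun i => wt c (lam i) * ‖y i‖ ^ 2 + ‖-lam i * x i‖ ^ 2 := by
  have hT0 : 0 ≤ T := hT₀.trans hT.le
  -- The strict inequality `T₀ < T` is essential: `T'` is still an observability time, and `T - T'`
  -- leaves room for the increments `h`.
  set T' := (T₀ + T) / 2 with hT'
  have hT'0 : 0 ≤ T' := by linarith
  obtain ⟨C, hC, ho⟩ := hobs T' (by linarith)
  have hK0 : 0 ≤ K := (nsq_nonneg _ _).trans (hK ∅)
  have hw : ∀ i, 1 ≤ wt c (lam i) := fun i => one_le_wt (hlam i)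
  have hq'i : ∀ i, IntervalIntegrable (q' i) volume 0 T := fun i =>
    MemLp.intervalIntegrable hT0 (hq' i)
  have hqc : ∀ i, ContinuousOn (q i) (Icc 0 T) := fun i =>
    (continuousOn_primitive_Icc hT0 (hq'i i)).congr (hq i)
  have hsub : ∀ i, ∀ r t, r ∈ Icc 0 T → t ∈ Icc 0 T → IntervalIntegrable (q' i) volume r t :=
    fun i r t hr ht => (hq'i i).mono_set (by
      rw [uIcc_of_le hT0]; exact uIcc_subset_Icc hr ht)
  set Ψ : Finset ι → ℝ → G := fun s => vs s (fun i t => free (lam i) (x i) (y i) t + q i t) b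
  have hΨ : ∀ s, ContinuousOn (Ψ s) (Icc 0 T) := fun s => vs_continuousOn fun i =>
    (free_continuous _ _ _).continuousOn.add (hqc i)
  -- the estimate for differences
  have step : ∀ F : Finset ι, ∀ h ∈ Ioo 0 (T - T'), energy c lam F
      (fun i => free (lam i) (x i) (y i) h - x i)
      (fun i => free (lam i) (y i) (-lam i * x i) h - y i) ≤ 2 * C * K * h ^ 2 := by
    intro F h hh
    have hle : ∀ s : Finset ι, F ⊆ s → energy c lam F
        (fun i => free (lam i) (x i) (y i) h - x i)
        (fun i => free (lam i) (y i) (-lam i * x i) h - y i) ≤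
        C * (2 * (h ^ 2 * K) + 8 * nsq T (Ψ s)) := by
      intro s hs
      have h1 := (ho s (fun i => free (lam i) (x i) (y i) h - x i)
        (fun i => free (lam i) (y i) (-lam i * x i) h - y i)).1
      have h2 : energy c lam F (fun i => free (lam i) (x i) (y i) h - x i)
          (fun i => free (lam i) (y i) (-lam i * x i) h - y i) ≤ energy c lam s
          (fun i => free (lam i) (x i) (y i) h - x i)
          (fun i => free (lam i) (y i) (-lam i * x i) h - y i) :=
        Finset.sum_le_sum_of_subset_of_nonneg hs fun i _ _ => by
          have := hw i
          positivity
      refine (h2.trans h1).trans (mul_le_mul_of_nonneg_left ?_ hC.le)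
      have hT'T : ∀ t ∈ Icc 0 T', t ∈ Icc 0 T ∧ t + h ∈ Icc 0 T := fun t ht =>
        ⟨⟨ht.1, by linarith [ht.2]⟩, ⟨by linarith [ht.1, hh.1], by linarith [ht.2, hh.2]⟩⟩
      -- Increments of the free part are increments of the whole observation `Ψ`, which tends to
      -- zero in L², minus increments of `q`, which are of size `h` because `q` is a primitive.
      have e : ∀ t ∈ Icc 0 T', vs s (fun i => free (lam i)
          (free (lam i) (x i) (y i) h - x i)
          (free (lam i) (y i) (-lam i * x i) h - y i)) b t =
          (Ψ s (t + h) - Ψ s t) - ∫ r in t..t + h, vs s q' b r := by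
        intro t ht
        obtain ⟨t1, t2⟩ := hT'T t ht
        have hI := integral_vs (s := s) (b := b) fun i => hsub i t (t + h) t1 t2
        have h00 : (0 : ℝ) ∈ Icc 0 T := left_mem_Icc.2 hT0
        rw [hI]
        simp only [Ψ, vs]
        rw [← Finset.sum_sub_distrib, ← Finset.sum_sub_distrib]
        refine Finset.sum_congr rfl fun i _ => ?_
        rw [← sub_smul, ← sub_smul]
        congr 1
        rw [free_sub, ← free_shift, hq i t t1, hq i _ t2,
          ← intervalIntegral.integral_add_adjacent_intervals (hsub i 0 t h00 t1)
            (hsub i t (t + h) t1 t2)]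
        ring
      rw [nsq_congr e]
      have hΨm := memLp_of_continuousOn (hΨ s)
      have hΨ' : ContinuousOn (fun t => Ψ s (t + h)) (Icc 0 T') :=
        (hΨ s).comp (by fun_prop) fun t ht => (hT'T t ht).2
      have hΨ0 : ContinuousOn (Ψ s) (Icc 0 T') := (hΨ s).mono fun t ht => (hT'T t ht).1
      have hd : ContinuousOn (fun t => Ψ s (t + h) - Ψ s t) (Icc 0 T') := hΨ'.sub hΨ0
      have hQ : ContinuousOn (fun t => ∫ r in t..t + h, vs s q' b r) (Icc 0 T') := by
        refine (hd.sub (vs_free_continuous (lam := lam) (b := b) s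
          (fun i => free (lam i) (x i) (y i) h - x i)
          (fun i => free (lam i) (y i) (-lam i * x i) h - y i)).continuousOn).congr fun t ht => ?_
        rw [Pi.sub_apply, e t ht, sub_sub_cancel]
      have n1 := nsq_sub_le (memLp_of_continuousOn hd) (memLp_of_continuousOn hQ)
      have n2 := nsq_sub_le (memLp_of_continuousOn hΨ') (memLp_of_continuousOn hΨ0)
      have n3 := nsq_shift_le hT'0 hh.1.le (by linarith [hh.2]) hΨm
      have n4 := nsq_mono_interval (by linarith : T' ≤ T) hΨm
      have n5 := nsq_difference_le (h := h) hT'0 hh.1.le (by linarith [hh.2])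
        (vs_memLp (s := s) (b := b) hq')
      have n6 := mul_le_mul_of_nonneg_left (hK s) (sq_nonneg h)
      linarith
    -- For fixed `h` and fixed `F` the larger set `s` is sent to infinity first; this removes `Ψ`
    -- and leaves the quadratic bound in `h`.
    have hlim : Tendsto (fun s => C * (2 * (h ^ 2 * K) + 8 * nsq T (Ψ s))) atTop
        (𝓝 (C * (2 * (h ^ 2 * K) + 8 * 0))) :=
      ((h0.const_mul 8).const_add _).const_mul C
    have := ge_of_tendsto hlim (eventually_atTop.2 ⟨F, hle⟩)
    linarith
  -- On a finite set `F` one may divide by `h²` and let `h` decrease to `0`; the difference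
  -- quotients tend to `y` and `-λ x`, with a bound independent of `F`.
  refine summable_of_sum_le (c := 2 * C * K) (fun i => by have := hw i; positivity) fun F => ?_
  have hd : ∀ (l : ℝ) (u v : ℂ), Tendsto (fun h : ℝ => ‖free l u v h - u‖ ^ 2 / h ^ 2) (𝓝[>] 0)
      (𝓝 (‖v‖ ^ 2)) := by
    intro l u v
    have h1 := (free_hasDerivAt l u v 0).tendsto_slope_zero_right
    simp only [zero_add, free_zero] at h1
    refine (h1.norm.pow 2).congr' ?_
    filter_upwards [self_mem_nhdsWithin] with h hh
    rw [norm_smul, mul_pow, Real.norm_eq_abs, sq_abs]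
    field_simp
  have hlim : Tendsto (fun h : ℝ => ∑ i ∈ F, (wt c (lam i) *
      (‖free (lam i) (x i) (y i) h - x i‖ ^ 2 / h ^ 2) +
      ‖free (lam i) (y i) (-lam i * x i) h - y i‖ ^ 2 / h ^ 2)) (𝓝[>] 0)
      (𝓝 (∑ i ∈ F, (wt c (lam i) * ‖y i‖ ^ 2 + ‖-lam i * x i‖ ^ 2))) :=
    tendsto_finsetSum _ fun i _ => ((hd _ _ _).const_mul _).add (hd _ _ _)
  refine le_of_tendsto hlim ?_
  filter_upwards [Ioo_mem_nhdsGT (by linarith : (0 : ℝ) < T - T')] with h hh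
  have h1 := step F h hh
  have h2 : (0 : ℝ) < h ^ 2 := by have := hh.1; positivity
  rw [← div_le_iff₀ h2] at h1
  refine le_of_eq_of_le ?_ h1
  rw [energy, Finset.sum_div]
  refine Finset.sum_congr rfl fun i _ => ?_
  rw [add_div, mul_div_assoc]

end Regularity

/-- The Cauchy criterion for `r` passes to `v`, as the hypothesis covers finite sets lying far out.
It replaces orthogonality for the observed vectors. -/
theorem summable_of_sq_norm_sum_le {ι V : Type*} [NormedAddCommGroup V] [CompleteSpace V]
    {v : ι → V} {r : ι → ℝ} (hr : Summable r) (h : ∀ s : Finset ι, ‖∑ i ∈ s, v i‖ ^ 2 ≤ ∑ i ∈ s, r i) :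
    Summable v := by
  rw [summable_iff_vanishing_norm]
  intro ε hε
  obtain ⟨s, hs⟩ := summable_iff_vanishing_norm.1 hr (ε ^ 2) (by positivity)
  refine ⟨s, fun t ht => ?_⟩
  have h1 := (h t).trans_lt ((le_abs_self _).trans_lt (hs t ht))
  exact lt_of_pow_lt_pow_left₀ 2 hε.le h1

/-! ### Observed sums as elements of the space L² -/

section L2

variable {G : Type*} [NormedAddCommGroup G] [NormedSpace ℂ G] {T : ℝ} {f g : ℝ → G}

open Classical in
/-- The class of `f` in `L²`, or `0` if `f` is not square integrable. -/
def toL2 (T : ℝ) (f : ℝ → G) : Lp G 2 (vol T) := if h : MemLp f 2 (vol T) then h.toLp f else 0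

theorem toL2_eq (h : MemLp f 2 (vol T)) : toL2 T f = h.toLp f := dif_pos h

theorem coeFn_toL2 (h : MemLp f 2 (vol T)) : toL2 T f =ᵐ[vol T] f := by
  rw [toL2_eq h]; exact h.coeFn_toLp

theorem sq_norm_toL2 (h : MemLp f 2 (vol T)) : ‖toL2 T f‖ ^ 2 = nsq T f := by
  rw [toL2_eq h, nsq_eq_norm_toLp h]

theorem sq_norm_eq_nsq (P : Lp G 2 (vol T)) : ‖P‖ ^ 2 = nsq T P := by
  rw [nsq_eq_norm_toLp (Lp.memLp P), Lp.toLp_coeFn]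

theorem toL2_add (hf : MemLp f 2 (vol T)) (hg : MemLp g 2 (vol T)) :
    toL2 T (fun t => f t + g t) = toL2 T f + toL2 T g := by
  rw [toL2_eq hf, toL2_eq hg, ← MemLp.toLp_add]
  exact toL2_eq (hf.add hg)

theorem toL2_const_smul (c : ℂ) (hf : MemLp f 2 (vol T)) :
    toL2 T (fun t => c • f t) = c • toL2 T f := by
  rw [toL2_eq hf, ← MemLp.toLp_const_smul]
  exact toL2_eq (hf.const_smul c)

theorem memLp_smul_const {φ : ℝ → ℂ} (h : MemLp φ 2 (vol T)) (a : G) :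
    MemLp (fun t => φ t • a) 2 (vol T) :=
  (ContinuousLinearMap.toSpanSingleton ℂ a).comp_memLp' h

theorem toL2_vs {ι : Type*} (s : Finset ι) {ψ : ι → ℝ → ℂ} {b : ι → G}
    (h : ∀ i, MemLp (ψ i) 2 (vol T)) :
    toL2 T (vs s ψ b) = ∑ i ∈ s, toL2 T (fun t => ψ i t • b i) := by
  classical
  induction s using Finset.induction_on with
  | empty =>
    have e : vs (∅ : Finset ι) ψ b = fun _ => 0 := by ext; simp [vs]
    have h0 := sq_norm_toL2 (f := vs (∅ : Finset ι) ψ b) (vs_memLp h)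
    rw [e] at h0 ⊢
    simpa [nsq] using h0
  | insert i s hi ih =>
    have e : vs (insert i s) ψ b = fun t => ψ i t • b i + vs s ψ b t := by
      ext t; simp [vs, Finset.sum_insert hi]
    rw [Finset.sum_insert hi, e, toL2_add (memLp_smul_const (h i) _) (vs_memLp h), ih]

theorem sq_norm_integral_smul_le {g : ℝ → ℝ} (hg : MemLp g 2 (vol T)) (hf : MemLp f 2 (vol T)) :
    ‖∫ t in Icc 0 T, g t • f t‖ ^ 2 ≤ nsq T g * nsq T f := by
  have h1 := sq_integral_mul_le (fun _ => norm_nonneg _) (fun _ => norm_nonneg _) hg.norm hf.norm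
  refine le_trans ?_ h1
  gcongr
  refine (norm_integral_le_integral_norm _).trans_eq ?_
  simp only [norm_smul]

end L2

/-! ### Differentiating a vanishing observation in time -/

section Derivative

variable {ι G : Type*} [NormedAddCommGroup G] [InnerProductSpace ℂ G] [CompleteSpace G] {T : ℝ}

theorem integral_smul_deriv {g : ℝ → ℝ} (hT : 0 < T) (hg : ContDiff ℝ ∞ g)
    (hs : tsupport g ⊆ Ioo 0 T) {F F' : ℝ → G} (hF : ContinuousOn F (Icc 0 T))
    (hF' : ContinuousOn F' (Icc 0 T)) (hd : ∀ t ∈ Ioo 0 T, HasDerivAt F (F' t) t) :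
    ∫ t in Icc 0 T, g t • F' t = -∫ t in Icc 0 T, deriv g t • F t := by
  have hgd : ∀ t, HasDerivAt g (deriv g t) t := fun t =>
    ((hg.differentiable (by simp)) t).hasDerivAt
  have hgc : Continuous (deriv g) := hg.continuous_deriv (by simp)
  have hz : ∀ t, t ∉ Ioo 0 T → g t = 0 := fun t ht => image_eq_zero_of_notMem_tsupport fun h =>
    ht (hs h)
  have h1 : IntervalIntegrable (fun t => g t • F' t) volume 0 T :=
    (hg.continuous.continuousOn.smul hF').intervalIntegrable_of_Icc hT.le
  have h2 : IntervalIntegrable (fun t => deriv g t • F t) volume 0 T :=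
    (hgc.continuousOn.smul hF).intervalIntegrable_of_Icc hT.le
  have key := intervalIntegral.integral_eq_sub_of_hasDerivAt_of_le hT.le
    (hg.continuous.continuousOn.smul hF) (fun t ht => (hgd t).smul (hd t ht)) (h1.add h2)
  rw [Pi.smul_apply', Pi.smul_apply', hz T (by simp), hz 0 (by simp),
    intervalIntegral.integral_add h1 h2] at key
  rw [integral_Icc_eq_integral_Ioc, integral_Icc_eq_integral_Ioc,
    ← intervalIntegral.integral_of_le hT.le, ← intervalIntegral.integral_of_le hT.le]
  exact eq_neg_of_add_eq_zero_left (by simpa using key)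

/-- The fundamental lemma of the calculus of variations on the open interval; the two endpoints form
a null set. -/
theorem ae_eq_zero_of_integral_smul {P : ℝ → G} (hP : IntegrableOn P (Icc 0 T))
    (h : ∀ g : ℝ → ℝ, ContDiff ℝ ∞ g → HasCompactSupport g → tsupport g ⊆ Ioo 0 T →
      ∫ t in Icc 0 T, g t • P t = 0) : P =ᵐ[vol T] 0 := by
  have h1 := isOpen_Ioo.ae_eq_zero_of_integral_contDiff_smul_eq_zero (μ := volume) (U := Ioo 0 T)
    (hP.mono_set Ioo_subset_Icc_self).locallyIntegrableOn fun g hg hc hs => by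
      rw [← h g hg hc hs, setIntegral_eq_integral_of_forall_compl_eq_zero]
      intro t ht
      rw [image_eq_zero_of_notMem_tsupport fun h => ht (Ioo_subset_Icc_self (hs h)), zero_smul]
  have h2 : ∀ᵐ t ∂volume, t ≠ 0 ∧ t ≠ T := by
    have h0 : ∀ᵐ t : ℝ ∂volume, t ≠ 0 := by simp [ae_iff]
    have h1 : ∀ᵐ t : ℝ ∂volume, t ≠ T := by simp [ae_iff]
    filter_upwards [h0, h1] with t a b using ⟨a, b⟩
  refine (ae_restrict_iff' measurableSet_Icc).2 ?_
  filter_upwards [h1, h2] with t h1 h2 ht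
  exact h1 ⟨lt_of_le_of_ne ht.1 h2.1.symm, lt_of_le_of_ne ht.2 h2.2⟩

/-- If finite sums tend to zero and their time derivatives are summable, then the latter tend to
zero, too. -/
theorem deriv_tendsto_zero (hT : 0 < T) {φ φ' : ι → ℝ → ℂ} {k : ι → ℂ} {b : ι → G} {r : ι → ℝ}
    (hφ' : ∀ i, ContinuousOn (φ' i) (Icc 0 T))
    (hφ : ∀ i, ∀ t ∈ Icc 0 T, φ i t = k i + ∫ s in (0 : ℝ)..t, φ' i s)
    (h0 : Tendsto (fun s => nsq T (vs s φ b)) atTop (𝓝 0)) (hr : Summable r)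
    (hb : ∀ s, nsq T (vs s φ' b) ≤ ∑ i ∈ s, r i) :
    Tendsto (fun s => nsq T (vs s φ' b)) atTop (𝓝 0) := by
  have hφc : ∀ i, ContinuousOn (φ i) (Icc 0 T) := fun i =>
    continuousOn_of_eq_primitive hT.le (hφ' i) (hφ i)
  have hm' : ∀ i, MemLp (φ' i) 2 (vol T) := fun i => memLp_of_continuousOn (hφ' i)
  have hsum : Summable fun i => toL2 T (fun t => φ' i t • b i) :=
    summable_of_sq_norm_sum_le hr fun s => by
      rw [← toL2_vs s hm', sq_norm_toL2 (vs_memLp hm')]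
      exact hb s
  obtain ⟨P, hP⟩ := hsum
  have hlim : Tendsto (fun s => toL2 T (vs s φ' b)) atTop (𝓝 P) := by
    simp only [toL2_vs _ hm']
    exact hP
  -- `P` is the distributional derivative of the limit of the undifferentiated sums, and that limit
  -- is zero: pair with a test function and integrate by parts before passing to the limit.
  have hP0 : P = 0 := by
    rw [Lp.eq_zero_iff_ae_eq_zero]
    refine ae_eq_zero_of_integral_smul ((Lp.memLp P).integrable (by norm_num)) fun g hg hc hs => ?_
    have hgm : MemLp g 2 (vol T) := memLp_of_continuousOn hg.continuous.continuousOn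
    have hgm' : MemLp (deriv g) 2 (vol T) :=
      memLp_of_continuousOn (hg.continuous_deriv (by simp)).continuousOn
    have hint : ∀ Q : Lp G 2 (vol T), Integrable (fun t => g t • Q t) (vol T) := fun Q =>
      IntegrableOn.continuousOn_smul ((Lp.memLp Q).integrable (by norm_num))
        hg.continuous.continuousOn isCompact_Icc
    have e1 : ∀ s : Finset ι, ∫ t in Icc 0 T, g t • (toL2 T (vs s φ' b)) t =
        -∫ t in Icc 0 T, deriv g t • vs s φ b t := by
      intro s
      rw [← integral_smul_deriv hT hg hs (vs_continuousOn hφc) (vs_continuousOn hφ') fun t ht =>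
        HasDerivAt.fun_sum fun i _ =>
          (hasDerivAt_of_eq_primitive (hφ' i) (hφ i) ht).smul_const (b i)]
      refine integral_congr_ae ?_
      filter_upwards [coeFn_toL2 (vs_memLp (s := s) (b := b) hm')] with t ht
      rw [ht]
    have l1 : Tendsto (fun s : Finset ι => ∫ t in Icc 0 T, g t • (toL2 T (vs s φ' b)) t) atTop
        (𝓝 (∫ t in Icc 0 T, g t • P t)) := by
      rw [tendsto_iff_norm_sub_tendsto_zero]
      have hb0 : Tendsto (fun s => √(nsq T g) * ‖toL2 T (vs s φ' b) - P‖) atTop (𝓝 0) := by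
        simpa using (tendsto_iff_norm_sub_tendsto_zero.1 hlim).const_mul (√(nsq T g))
      refine squeeze_zero (fun _ => norm_nonneg _) (fun s => ?_) hb0
      rw [← integral_sub (hint _) (hint _)]
      have h1 := sq_norm_integral_smul_le hgm (Lp.memLp (toL2 T (vs s φ' b) - P))
      rw [← sq_norm_eq_nsq] at h1
      have h2 : ∫ t in Icc 0 T, (g t • (toL2 T (vs s φ' b)) t - g t • P t) =
          ∫ t in Icc 0 T, g t • (toL2 T (vs s φ' b) - P : Lp G 2 (vol T)) t := by
        refine integral_congr_ae ?_
        filter_upwards [Lp.coeFn_sub (toL2 T (vs s φ' b)) P] with t ht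
        rw [ht, Pi.sub_apply, smul_sub]
      rw [h2]
      refine le_of_sq_le_sq ?_ (by positivity)
      rwa [mul_pow, Real.sq_sqrt (nsq_nonneg _ _)]
    have l2 : Tendsto (fun s : Finset ι => ∫ t in Icc 0 T, g t • (toL2 T (vs s φ' b)) t) atTop
        (𝓝 0) := by
      rw [tendsto_zero_iff_norm_tendsto_zero]
      have hb0 : Tendsto (fun s => √(nsq T (deriv g) * nsq T (vs s φ b))) atTop (𝓝 0) := by
        simpa using (h0.const_mul (nsq T (deriv g))).sqrt
      refine squeeze_zero (fun _ => norm_nonneg _) (fun s => ?_) hb0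
      rw [e1, norm_neg]
      exact Real.le_sqrt_of_sq_le (sq_norm_integral_smul_le hgm'
        (vs_memLp fun i => memLp_of_continuousOn (hφc i)))
    exact tendsto_nhds_unique l1 l2
  rw [hP0] at hlim
  have := (tendsto_zero_iff_norm_tendsto_zero.1 hlim).pow 2
  simpa only [sq_norm_toL2 (vs_memLp hm'), ne_eq, OfNat.ofNat_ne_zero, not_false_eq_true,
    zero_pow] using this

end Derivative

/-! ### Data with vanishing observation: regularity and invariance -/

section Kernel

variable {ι G : Type*} [NormedAddCommGroup G] [InnerProductSpace ℂ G] [CompleteSpace G]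
  {T c : ℝ} {lam : ι → ℝ} {b : ι → G} {a₀ b₀ : ℂ} {μ μ' κ : ℝ → ℂ}
  {x y : ι → ℂ} {z z₁ z₂ : ι → ℝ → ℂ}

/-- `β` and `κ` are the same for all modes, so forming the lower order terms commutes with
observing. Hence the observed force is controlled by the observation itself, not only by the energy.
-/
theorem nsq_vs_force_le (hT : 0 ≤ T) (hκ : MemLp κ 2 (vol T)) (β : ℂ) (s : Finset ι)
    (hz : ∀ i, ContinuousOn (z i) (Icc 0 T)) :
    nsq T (vs s (fun i => force β κ (z i)) b) ≤
      (2 * ‖β‖ ^ 2 + 2 * (T * nsq T κ)) * nsq T (vs s z b) := by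
  have hz2 : ∀ i, MemLp (z i) 2 (vol T) := fun i => memLp_of_continuousOn (hz i)
  have e : ∀ t ∈ Icc 0 T, vs s (fun i => force β κ (z i)) b t =
      β • vs s z b t + vs s (fun i => conv κ (z i)) b t := by
    intro t _
    rw [← vs_const_mul z (fun _ => β), ← vs_add]
    rfl
  have h1 : MemLp (fun t => β • vs s z b t) 2 (vol T) := (vs_memLp hz2).const_smul β
  rw [nsq_congr e]
  have h2 := nsq_add_le h1 (vs_memLp (s := s) (b := b) fun i => memLp_conv hT hκ (hz2 i))
  have h3 : nsq T (vs s (fun i => conv κ (z i)) b) ≤ T * (nsq T κ * nsq T (vs s z b)) := by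
    refine nsq_le_of_bound hT fun t ht => ?_
    rw [vs_conv fun i => conv_integrand ht.1
      (MemLp.intervalIntegrable ht.1 (memLp_mono_interval ht.2 hκ))
      ((hz i).mono (Icc_subset_Icc_right ht.2))]
    exact sq_norm_conv_le ht hκ (vs_memLp hz2)
  rw [nsq_const_smul] at h2
  linarith

/-- Square norm of the forced evolutions appearing in the differentiated equations. -/
theorem FreeObs.force_bound (hT : 0 ≤ T) (hobs : FreeObs c lam b T) (hκ : MemLp κ 2 (vol T))
    (β : ℂ) : ∃ C : ℝ, 0 < C ∧ ∀ (s : Finset ι) (k : ι → ℂ) (f : ι → ℝ → ℂ),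
      (∀ i, MemLp (f i) 2 (vol T)) →
      nsq T (vs s (fun i => conv (sw (lam i)) (fun r => force β κ (f i) r + k i * κ r)) b) ≤
        C * ∑ i ∈ s, (‖k i‖ ^ 2 + nsq T (f i)) := by
  obtain ⟨C, hC, hD⟩ := hobs.duhamel_bound hT
  have hκ0 := nsq_nonneg T κ
  refine ⟨C * (2 * (2 * ‖β‖ ^ 2 + 2 * (T * nsq T κ)) + 2 * nsq T κ) + 1, by positivity,
    fun s k f hf => ?_⟩
  have hkκ : ∀ i, MemLp (fun r => k i * κ r) 2 (vol T) := fun i => hκ.const_mul (k i)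
  refine (hD s _ fun i => (memLp_force hT hκ (hf i)).add (hkκ i)).trans ?_
  have h1 : ∑ i ∈ s, nsq T (fun r => force β κ (f i) r + k i * κ r) ≤
      (2 * (2 * ‖β‖ ^ 2 + 2 * (T * nsq T κ)) + 2 * nsq T κ) *
        ∑ i ∈ s, (‖k i‖ ^ 2 + nsq T (f i)) := by
    rw [Finset.mul_sum]
    refine Finset.sum_le_sum fun i _ => ?_
    refine (nsq_add_le (memLp_force hT hκ (hf i)) (hkκ i)).trans ?_
    have h2 := nsq_force_le (β := β) hT hκ (hf i)
    have h3 : nsq T (fun r => k i * κ r) = ‖k i‖ ^ 2 * nsq T κ := nsq_const_smul T κ (k i)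
    have h4 := nsq_nonneg T (f i)
    have h5 : 0 ≤ 2 * (2 * ‖β‖ ^ 2 + 2 * (T * nsq T κ)) * ‖k i‖ ^ 2 := by positivity
    have h6 : 0 ≤ 2 * nsq T κ * nsq T (f i) := by positivity
    rw [h3]
    linarith
  have h2 : 0 ≤ ∑ i ∈ s, (‖k i‖ ^ 2 + nsq T (f i)) :=
    Finset.sum_nonneg fun i _ => by have := nsq_nonneg T (f i); positivity
  have h3 := mul_le_mul_of_nonneg_left h1 hC.le
  exact h3.trans (by linarith)

theorem FreeObs.sw_bound (hobs : FreeObs c lam b T) : ∃ C : ℝ, 0 < C ∧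
    ∀ (s : Finset ι) (k : ι → ℂ),
      nsq T (vs s (fun i t => k i * sw (lam i) t) b) ≤ C * ∑ i ∈ s, ‖k i‖ ^ 2 := by
  obtain ⟨C, hC, h⟩ := hobs
  refine ⟨C, hC, fun s k => ?_⟩
  have h1 := (h s (fun _ => 0) k).2
  have h2 : (fun i => free (lam i) 0 (k i)) = fun i t => k i * sw (lam i) t := by
    ext i t; simp [free]
  rw [h2] at h1
  simpa [energy] using h1

theorem IsModes.smul (h : IsModes T a₀ μ lam x y z z₁ z₂) (a : ι → ℂ) :
    IsModes T a₀ μ lam (fun i => a i * x i) (fun i => a i * y i) (fun i t => a i * z i t)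
      (fun i t => a i * z₁ i t) (fun i t => a i * z₂ i t) := fun i => (h i).const_mul (a i)

theorem memory_tendsto_zero (hT : 0 ≤ T) (hμ : ContinuousOn μ (Icc 0 T))
    (hz : ∀ i, ContinuousOn (z i) (Icc 0 T)) (hzc : ∀ i, ContinuousOn (conv μ (z i)) (Icc 0 T)) :
    Tendsto (fun s => nsq T (vs s (fun i t => z i t - conv μ (z i) t) b)) atTop (𝓝 0) ↔
      Tendsto (fun s => nsq T (vs s z b)) atTop (𝓝 0) := by
  obtain ⟨C, -, hC⟩ := memory_nsq_bounds (ι := ι) (b := b) hT hμ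
  constructor <;> intro h
  · exact squeeze_zero (fun _ => nsq_nonneg _ _) (fun s => (hC s z hz hzc).2)
      (by simpa using h.const_mul C)
  · exact squeeze_zero (fun _ => nsq_nonneg _ _) (fun s => (hC s z hz hzc).1)
      (by simpa using h.const_mul C)

/-- First gain of regularity for data with vanishing observation. -/
theorem kernel_regularity {T₀ : ℝ} (hT₀ : 0 ≤ T₀) (hT : T₀ < T) (hc : 0 ≤ c)
    (hlam : ∀ i, -c ≤ lam i) (hobs : ∀ T', T₀ < T' → FreeObs c lam b T')
    (hK : IsKernel T a₀ b₀ μ μ' κ) (hm : IsModes T a₀ μ lam x y z z₁ z₂)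
    (hs : Summable fun i => wt c (lam i) * ‖x i‖ ^ 2 + ‖y i‖ ^ 2)
    (h0 : Tendsto (fun s => nsq T (vs s z b)) atTop (𝓝 0)) :
    Summable fun i => wt c (lam i) * ‖y i‖ ^ 2 + ‖-lam i * x i‖ ^ 2 := by
  have hT0 : 0 < T := hT₀.trans_lt hT
  set β := -(a₀ ^ 2 / 4 + b₀) with hβ
  have hκi := hK.intervalIntegrable hT0.le
  have hw : ∀ i, 1 ≤ wt c (lam i) := fun i => one_le_wt (hlam i)
  obtain ⟨C₁, hC₁, hF⟩ := (hobs T hT).force_bound hT0.le hK.memLp β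
  obtain ⟨C₂, hC₂, hS⟩ := (hobs T hT).sw_bound
  obtain ⟨K, hK0, hb⟩ := IsMode.exists_bound_deriv hc hT0 hK
  have hz₁ : ∀ i, ContinuousOn (z₁ i) (Icc 0 T) := fun i => (hm i).deriv_continuous.continuousOn
  have hz₁m : ∀ i, MemLp (z₁ i) 2 (vol T) := fun i => memLp_of_continuousOn (hz₁ i)
  have hfm : ∀ i, MemLp (fun r => force β κ (z₁ i) r + x i * κ r) 2 (vol T) := fun i =>
    (memLp_force hT0.le hK.memLp (hz₁m i)).add (hK.memLp.const_mul (x i))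
  have hfi : ∀ i, IntervalIntegrable (fun r => force β κ (z₁ i) r + x i * κ r) volume 0 T :=
    fun i => MemLp.intervalIntegrable hT0.le (hfm i)
  have hu := (memory_tendsto_zero (b := b) hT0.le (hK.continuousOn hT0.le) hm.continuousOn
    fun i => hm.conv_continuousOn hT0.le (hK.continuousOn hT0.le) i).2 h0
  -- The time derivative of the Duhamel term in `u = free + q`, with the derivative put on the
  -- force. Its observation is bounded by the given energy, since this energy controls `z₁`.
  set q' : ι → ℝ → ℂ := fun i t => β * x i * sw (lam i) t +
    conv (sw (lam i)) (fun r => force β κ (z₁ i) r + x i * κ r) t with hq'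
  have hm1 : ∀ i, MemLp (fun t => β * x i * sw (lam i) t) 2 (vol T) := fun i =>
    memLp_of_continuousOn ((sw_continuous _).continuousOn.const_smul (β * x i))
  have hm2 : ∀ i, MemLp (conv (sw (lam i)) (fun r => force β κ (z₁ i) r + x i * κ r)) 2
      (vol T) := fun i => memLp_of_continuousOn (conv_sw_continuousOn hT0.le _ (hfi i))
  refine free_regularity (q := fun i => conv (sw (lam i)) (force β κ (z i))) (q' := q')
    (K := (2 * (C₂ * ‖β‖ ^ 2) + 2 * (C₁ * (1 + T * K))) *
      ∑' i, (wt c (lam i) * ‖x i‖ ^ 2 + ‖y i‖ ^ 2)) hT₀ hT hlam hobs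
    (fun i => (hm1 i).add (hm2 i)) (fun i t ht => ?_) (fun s => ?_) ?_
  · exact conv_sw_primitive (hfi i) (fun t ht => force_eq_primitive hT0.le hκi (hz₁ i)
      (fun t _ => (hm i).eq_primitive t) ht) ht
  · have h1 : nsq T (vs s q' b) ≤ 2 * (C₂ * ∑ i ∈ s, ‖β * x i‖ ^ 2) +
        2 * (C₁ * ∑ i ∈ s, (‖x i‖ ^ 2 + nsq T (z₁ i))) := by
      have h2 := nsq_add_le (vs_memLp (s := s) (b := b) hm1) (vs_memLp (s := s) (b := b) hm2)
      rw [nsq_congr fun t _ => vs_add (fun i t => β * x i * sw (lam i) t)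
        (fun i => conv (sw (lam i)) (fun r => force β κ (z₁ i) r + x i * κ r)) t]
      have h3 := hS s fun i => β * x i
      have h4 := hF s x z₁ hz₁m
      linarith
    refine h1.trans ?_
    have hnn : ∀ i, 0 ≤ wt c (lam i) * ‖x i‖ ^ 2 + ‖y i‖ ^ 2 := fun i => by
      have := hw i; positivity
    have hx : ∀ i, ‖x i‖ ^ 2 ≤ wt c (lam i) * ‖x i‖ ^ 2 + ‖y i‖ ^ 2 := fun i => by
      have := le_mul_of_one_le_left (sq_nonneg ‖x i‖) (hw i)
      have := sq_nonneg ‖y i‖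
      linarith
    have h5 : ∑ i ∈ s, ‖β * x i‖ ^ 2 ≤
        ‖β‖ ^ 2 * ∑ i ∈ s, (wt c (lam i) * ‖x i‖ ^ 2 + ‖y i‖ ^ 2) := by
      rw [Finset.mul_sum]
      refine Finset.sum_le_sum fun i _ => ?_
      rw [norm_mul, mul_pow]
      exact mul_le_mul_of_nonneg_left (hx i) (sq_nonneg _)
    have h6 : ∑ i ∈ s, (‖x i‖ ^ 2 + nsq T (z₁ i)) ≤
        (1 + T * K) * ∑ i ∈ s, (wt c (lam i) * ‖x i‖ ^ 2 + ‖y i‖ ^ 2) := by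
      rw [Finset.mul_sum]
      refine Finset.sum_le_sum fun i _ => ?_
      have h7 := nsq_le_of_bound hT0.le (hb _ _ _ _ _ _ (hlam i) (hm i))
      have h8 := hx i
      linarith
    have h9 := hs.sum_le_tsum s fun i _ => hnn i
    have h10 : (2 * (C₂ * ‖β‖ ^ 2) + 2 * (C₁ * (1 + T * K))) *
        ∑ i ∈ s, (wt c (lam i) * ‖x i‖ ^ 2 + ‖y i‖ ^ 2) ≤
        (2 * (C₂ * ‖β‖ ^ 2) + 2 * (C₁ * (1 + T * K))) *
        ∑' i, (wt c (lam i) * ‖x i‖ ^ 2 + ‖y i‖ ^ 2) :=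
      mul_le_mul_of_nonneg_left h9 (by positivity)
    have h11 := mul_le_mul_of_nonneg_left h5 hC₂.le
    have h12 := mul_le_mul_of_nonneg_left h6 hC₁.le
    linarith
  · refine hu.congr fun s => nsq_congr fun t ht => ?_
    exact vs_congr fun i => (hm i).aux_eq hT0.le hK t ht

/-- Under vanishing observation, the observation of the time derivative vanishes, too. -/
theorem kernel_deriv {T₀ : ℝ} (hT₀ : 0 ≤ T₀) (hT : T₀ < T) (hc : 0 ≤ c)
    (hlam : ∀ i, -c ≤ lam i) (hobs : ∀ T', T₀ < T' → FreeObs c lam b T')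
    (hK : IsKernel T a₀ b₀ μ μ' κ) (hm : IsModes T a₀ μ lam x y z z₁ z₂)
    (hs : Summable fun i => wt c (lam i) * ‖x i‖ ^ 2 + ‖y i‖ ^ 2)
    (h0 : Tendsto (fun s => nsq T (vs s z b)) atTop (𝓝 0)) :
    Tendsto (fun s => nsq T (vs s (fun i t => z₁ i t - a₀ * z i t - conv μ' (z i) t) b)) atTop
      (𝓝 0) := by
  have hT0 : 0 < T := hT₀.trans_lt hT
  have hs2 := kernel_regularity hT₀ hT hc hlam hobs hK hm hs h0
  set β := -(a₀ ^ 2 / 4 + b₀) with hβ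
  have hw : ∀ i, 1 ≤ wt c (lam i) := fun i => one_le_wt (hlam i)
  obtain ⟨C₁, hC₁, hF⟩ := (hobs T hT).force_bound hT0.le hK.memLp β
  obtain ⟨C₂, hC₂, hS⟩ := hobs T hT
  obtain ⟨K, hK0, hb⟩ := IsMode.exists_bound_deriv hc hT0 hK
  have hz₁ : ∀ i, ContinuousOn (z₁ i) (Icc 0 T) := fun i => (hm i).deriv_continuous.continuousOn
  have hz₁m : ∀ i, MemLp (z₁ i) 2 (vol T) := fun i => memLp_of_continuousOn (hz₁ i)
  have hfi : ∀ i, IntervalIntegrable (fun r => force β κ (z₁ i) r + x i * κ r) volume 0 T :=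
    fun i => MemLp.intervalIntegrable hT0.le
      ((memLp_force hT0.le hK.memLp (hz₁m i)).add (hK.memLp.const_mul (x i)))
  have hu := (memory_tendsto_zero (b := b) hT0.le (hK.continuousOn hT0.le) hm.continuousOn
    fun i => hm.conv_continuousOn hT0.le (hK.continuousOn hT0.le) i).2 h0
  have hm2 : ∀ i, MemLp (conv (sw (lam i)) (fun r => force β κ (z₁ i) r + x i * κ r)) 2
      (vol T) := fun i => memLp_of_continuousOn (conv_sw_continuousOn hT0.le _ (hfi i))
  -- The majorant is dictated by the sine form of `u'`: a free evolution with data `(y, -λ x + β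
  -- x)`, whose energy is summable by the first gain, and a forced part controlled by `z₁`.
  refine deriv_tendsto_zero hT0 (fun i => (hm i).aux_deriv_continuousOn hT0.le hK)
    (fun i t ht => (hm i).aux_eq_primitive hK ht) hu
    (r := fun i => 4 * C₂ * (wt c (lam i) * ‖y i‖ ^ 2 + ‖-lam i * x i‖ ^ 2) +
      (4 * C₂ * ‖β‖ ^ 2 + 2 * C₁ * (1 + T * K)) * (wt c (lam i) * ‖x i‖ ^ 2 + ‖y i‖ ^ 2))
    ((hs2.mul_left _).add (hs.mul_left _)) fun s => ?_
  have e : ∀ t ∈ Icc 0 T, vs s (fun i t => z₁ i t - a₀ * z i t - conv μ' (z i) t) b t =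
      vs s (fun i => free (lam i) (y i) (-lam i * x i + β * x i)) b t +
      vs s (fun i => conv (sw (lam i)) (fun r => force β κ (z₁ i) r + x i * κ r)) b t := by
    intro t ht
    rw [← vs_add]
    exact vs_congr fun i => (hm i).aux_deriv_eq_sw hT0 hK t ht
  rw [nsq_congr e]
  refine (nsq_add_le (memLp_of_continuousOn (vs_free_continuous s _ _).continuousOn)
    (vs_memLp (s := s) (b := b) hm2)).trans ?_
  have h1 := (hS s y fun i => -lam i * x i + β * x i).2
  have h2 := hF s x z₁ hz₁m
  have h3 : 2 * (C₂ * energy c lam s y fun i => -lam i * x i + β * x i) +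
      2 * (C₁ * ∑ i ∈ s, (‖x i‖ ^ 2 + nsq T (z₁ i))) ≤
      ∑ i ∈ s, (4 * C₂ * (wt c (lam i) * ‖y i‖ ^ 2 + ‖-lam i * x i‖ ^ 2) +
      (4 * C₂ * ‖β‖ ^ 2 + 2 * C₁ * (1 + T * K)) * (wt c (lam i) * ‖x i‖ ^ 2 + ‖y i‖ ^ 2)) := by
    rw [energy, Finset.mul_sum, Finset.mul_sum, Finset.mul_sum, Finset.mul_sum,
      ← Finset.sum_add_distrib]
    refine Finset.sum_le_sum fun i _ => ?_
    have h4 := sq_norm_add_le (-lam i * x i) (β * x i)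
    rw [norm_mul β, mul_pow] at h4
    have h5 := nsq_le_of_bound hT0.le (hb _ _ _ _ _ _ (hlam i) (hm i))
    have h6 : ‖x i‖ ^ 2 ≤ wt c (lam i) * ‖x i‖ ^ 2 + ‖y i‖ ^ 2 := by
      have := le_mul_of_one_le_left (sq_nonneg ‖x i‖) (hw i)
      have := sq_nonneg ‖y i‖
      linarith
    have h7 : 0 ≤ wt c (lam i) * ‖y i‖ ^ 2 := by have := hw i; positivity
    have h8 := mul_le_mul_of_nonneg_left h4 hC₂.le
    have h9 := mul_le_mul_of_nonneg_left h6 (by positivity : 0 ≤ C₂ * ‖β‖ ^ 2)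
    have h10 := mul_le_mul_of_nonneg_left (add_le_add h6 h5) hC₁.le
    have h11 := mul_nonneg hC₂.le h7
    linarith
  linarith

/-- Second gain of regularity for data with vanishing observation. -/
theorem kernel_regularity₂ {T₀ : ℝ} (hT₀ : 0 ≤ T₀) (hT : T₀ < T) (hc : 0 ≤ c)
    (hlam : ∀ i, -c ≤ lam i) (hobs : ∀ T', T₀ < T' → FreeObs c lam b T')
    (hK : IsKernel T a₀ b₀ μ μ' κ) (hm : IsModes T a₀ μ lam x y z z₁ z₂)
    (hs : Summable fun i => wt c (lam i) * ‖x i‖ ^ 2 + ‖y i‖ ^ 2)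
    (h0 : Tendsto (fun s => nsq T (vs s z b)) atTop (𝓝 0)) :
    Summable fun i => wt c (lam i) * ‖lam i * x i‖ ^ 2 + ‖lam i * y i‖ ^ 2 := by
  have hT0 : 0 < T := hT₀.trans_lt hT
  have hs2 := kernel_regularity hT₀ hT hc hlam hobs hK hm hs h0
  have hp := kernel_deriv hT₀ hT hc hlam hobs hK hm hs h0
  set β := -(a₀ ^ 2 / 4 + b₀) with hβ
  have hκi := hK.intervalIntegrable hT0.le
  have hw : ∀ i, 1 ≤ wt c (lam i) := fun i => one_le_wt (hlam i)
  obtain ⟨C₁, hC₁, hF⟩ := (hobs T hT).force_bound hT0.le hK.memLp β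
  obtain ⟨C₂, hC₂, hS⟩ := (hobs T hT).sw_bound
  obtain ⟨C₃, hC₃, hO⟩ := hobs T hT
  obtain ⟨K, hK0, hb⟩ := IsMode.exists_bound_deriv2 hc hT0 hK
  have hz₁ : ∀ i, ContinuousOn (z₁ i) (Icc 0 T) := fun i => (hm i).deriv_continuous.continuousOn
  have hz₂ : ∀ i, ContinuousOn (z₂ i) (Icc 0 T) := fun i => (hm i).cont.continuousOn
  have hz₁m : ∀ i, MemLp (z₁ i) 2 (vol T) := fun i => memLp_of_continuousOn (hz₁ i)
  have hz₂m : ∀ i, MemLp (z₂ i) 2 (vol T) := fun i => memLp_of_continuousOn (hz₂ i)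
  set k : ι → ℂ := fun i => y i + a₀ * x i with hk
  have hfi : ∀ i, IntervalIntegrable (fun r => force β κ (z₂ i) r + k i * κ r) volume 0 T :=
    fun i => MemLp.intervalIntegrable hT0.le
      ((memLp_force hT0.le hK.memLp (hz₂m i)).add (hK.memLp.const_mul (k i)))
  have hkκ : ∀ (a : ℂ), IntervalIntegrable (fun r => a * κ r) volume 0 T := fun a =>
    hκi.const_mul a
  have hm1 : ∀ i, ContinuousOn (fun t => β * k i * sw (lam i) t) (Icc 0 T) := fun i =>
    (sw_continuous _).continuousOn.const_smul (β * k i)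
  have hm2 : ∀ i, ContinuousOn (conv (sw (lam i)) (fun r => force β κ (z₂ i) r + k i * κ r))
      (Icc 0 T) := fun i => conv_sw_continuousOn hT0.le _ (hfi i)
  have hm3 : ∀ i, ContinuousOn (conv (cw (lam i)) fun r => x i * κ r) (Icc 0 T) :=
    fun i => conv_cw_continuousOn hT0.le _ (hkκ _)
  -- In the force of `u'` the part coming from `z₁` is differentiated, giving `z₂` and the initial
  -- value `k`. The part `x κ` has no derivative in L²; there the derivative falls on `sw` and
  -- produces `cw`.
  set q' : ι → ℝ → ℂ := fun i t => (β * k i * sw (lam i) t +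
    conv (sw (lam i)) (fun r => force β κ (z₂ i) r + k i * κ r) t) +
    conv (cw (lam i)) (fun r => x i * κ r) t with hq'
  set S := ∑' i, (wt c (lam i) * ‖x i‖ ^ 2 + ‖y i‖ ^ 2)
  set S₂ := ∑' i, (wt c (lam i) * ‖y i‖ ^ 2 + ‖-lam i * x i‖ ^ 2)
  have hR := free_regularity (x := y) (y := fun i => -lam i * x i + β * x i)
    (q := fun i => conv (sw (lam i)) fun r => force β κ (z₁ i) r + x i * κ r) (q' := q')
    (K := 4 * (C₂ * (‖β‖ ^ 2 * (2 * (1 + ‖a₀‖ ^ 2) * S))) +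
      4 * (C₁ * ((2 * (1 + ‖a₀‖ ^ 2) + 2 * (T * K * (c + 1) ^ 2)) * S + 2 * T * K * S₂)) +
      2 * (T * (nsq T κ * (C₃ * S)))) hT₀ hT hlam hobs
    (fun i => memLp_of_continuousOn (((hm1 i).add (hm2 i)).add (hm3 i)))
    (fun i t ht => ?_) (fun s => ?_) ?_
  -- The regularity result was applied to `u'`, whose data are `(y, -λ x + β x)`; the correction `β
  -- x` is absorbed by the original energy.
  · refine Summable.of_nonneg_of_le (fun i => by have := hw i; positivity) (fun i => ?_)
      ((hR.mul_left 2).add (hs.mul_left (2 * ‖β‖ ^ 2)))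
    have h1 := sq_norm_add_le (-(-lam i * x i + β * x i)) (β * x i)
    rw [norm_neg, norm_mul β, mul_pow, show -(-(lam i : ℂ) * x i + β * x i) + β * x i =
      lam i * x i by ring] at h1
    have h2 : ‖-(lam i : ℂ) * y i‖ = ‖lam i * y i‖ := by rw [neg_mul, norm_neg]
    have h3 := mul_le_mul_of_nonneg_left h1 (zero_le_one.trans (hw i))
    have h4 : 0 ≤ ‖β‖ ^ 2 * ‖y i‖ ^ 2 := by positivity
    have h5 := sq_nonneg ‖lam i * y i‖
    rw [h2]
    linarith
  · have hsub : Icc 0 t ⊆ Icc 0 T := Icc_subset_Icc_right ht.2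
    have hii : ∀ {f : ℝ → ℂ}, IntervalIntegrable f volume 0 T →
        IntervalIntegrable f volume 0 t := fun hf => hf.mono_set (by
      rw [uIcc_of_le ht.1, uIcc_of_le hT0.le]; exact hsub)
    have e1 : conv (sw (lam i)) (fun r => force β κ (z₁ i) r + x i * κ r) t =
        conv (sw (lam i)) (force β κ (z₁ i)) t + conv (sw (lam i)) (fun r => x i * κ r) t :=
      conv_add_right
        (conv_integrand' ht.1 (sw_continuous _).continuousOn
          (hii (force_intervalIntegrable hT0.le hκi (hz₁ i))))
        (conv_integrand' ht.1 (sw_continuous _).continuousOn (hii (hkκ _)))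
    rw [e1, conv_sw_primitive (hfi i) (fun t ht => force_eq_primitive hT0.le hκi (hz₂ i)
      (fun t _ => (hm i).deriv_eq_primitive t) ht) ht, conv_sw_eq_integral_conv_cw (hkκ _) ht]
    exact (intervalIntegral.integral_add
      ((((hm1 i).add (hm2 i)).mono hsub).intervalIntegrable_of_Icc ht.1)
      (((hm3 i).mono hsub).intervalIntegrable_of_Icc ht.1)).symm
  · have n1 : nsq T (vs s q' b) ≤ 4 * (C₂ * ∑ i ∈ s, ‖β * k i‖ ^ 2) +
        4 * (C₁ * ∑ i ∈ s, (‖k i‖ ^ 2 + nsq T (z₂ i))) +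
        2 * nsq T (vs s (fun i => conv (cw (lam i)) fun r => x i * κ r) b) := by
      have h2 := nsq_add_le (memLp_of_continuousOn (vs_continuousOn (s := s) (b := b) hm1))
        (memLp_of_continuousOn (vs_continuousOn (s := s) (b := b) hm2))
      have h3 := nsq_add_le (memLp_of_continuousOn (vs_continuousOn (s := s) (b := b)
        fun i => (hm1 i).add (hm2 i))) (memLp_of_continuousOn (vs_continuousOn (s := s) (b := b) hm3))
      have h4 := hS s fun i => β * k i
      have h5 := hF s k z₂ hz₂m
      rw [nsq_congr fun t _ => vs_add (fun i t => β * k i * sw (lam i) t +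
        conv (sw (lam i)) (fun r => force β κ (z₂ i) r + k i * κ r) t)
        (fun i => conv (cw (lam i)) fun r => x i * κ r) t]
      rw [← nsq_congr fun t _ => vs_add (fun i t => β * k i * sw (lam i) t)
        (fun i => conv (sw (lam i)) (fun r => force β κ (z₂ i) r + k i * κ r)) t] at h2
      refine h3.trans ?_
      have h7 := h2.trans (add_le_add (mul_le_mul_of_nonneg_left h4 zero_le_two)
        (mul_le_mul_of_nonneg_left h5 zero_le_two))
      refine (add_le_add_left (mul_le_mul_of_nonneg_left h7 zero_le_two) _).trans ?_
      exact le_of_eq (by ring)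
    have n2 : nsq T (vs s (fun i => conv (cw (lam i)) fun r => x i * κ r) b) ≤
        T * (nsq T κ * nsq T (vs s (fun i => free (lam i) (x i) 0) b)) := by
      refine nsq_le_of_bound hT0.le fun t ht => ?_
      -- Interchanging the factors exhibits this term as the scalar kernel `κ` convolved with the
      -- observed free evolution with data `(x, 0)`, which (B) bounds.
      have e : vs s (fun i => conv (cw (lam i)) fun r => x i * κ r) b t =
          conv κ (vs s (fun i => free (lam i) (x i) 0) b) t := by
        rw [← vs_conv fun i => conv_integrand ht.1
          (MemLp.intervalIntegrable ht.1 (memLp_mono_interval ht.2 hK.memLp))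
          (free_continuous _ _ _).continuousOn]
        refine vs_congr fun i => ?_
        have e1 : free (lam i) (x i) 0 = fun s => x i * cw (lam i) s := by
          ext t; simp [free]
        rw [e1, conv_const_mul_right, conv_const_mul_right, conv_comm]
      rw [e]
      exact sq_norm_conv_le ht hK.memLp
        (memLp_of_continuousOn (vs_free_continuous s x fun _ => 0).continuousOn)
    have n3 := (hO s x fun _ => 0).2
    have hnn : ∀ i, 0 ≤ wt c (lam i) * ‖x i‖ ^ 2 + ‖y i‖ ^ 2 := fun i => by
      have := hw i; positivity
    have hnn₂ : ∀ i, 0 ≤ wt c (lam i) * ‖y i‖ ^ 2 + ‖-lam i * x i‖ ^ 2 := fun i => by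
      have := hw i; positivity
    have hx : ∀ i, ‖x i‖ ^ 2 ≤ wt c (lam i) * ‖x i‖ ^ 2 := fun i =>
      le_mul_of_one_le_left (sq_nonneg ‖x i‖) (hw i)
    have hk' : ∀ i, ‖k i‖ ^ 2 ≤
        2 * (1 + ‖a₀‖ ^ 2) * (wt c (lam i) * ‖x i‖ ^ 2 + ‖y i‖ ^ 2) := fun i => by
      have h1 := sq_norm_add_le (y i) (a₀ * x i)
      rw [norm_mul a₀, mul_pow] at h1
      have h2 := mul_le_mul_of_nonneg_left (hx i) (by positivity : 0 ≤ ‖a₀‖ ^ 2)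
      have h3 : 0 ≤ ‖a₀‖ ^ 2 * ‖y i‖ ^ 2 := by positivity
      have h4 := (sq_nonneg ‖x i‖).trans (hx i)
      exact h1.trans (by linarith)
    have hsS := hs.sum_le_tsum s fun i _ => hnn i
    have hsS₂ := hs2.sum_le_tsum s fun i _ => hnn₂ i
    have m1 : ∑ i ∈ s, ‖β * k i‖ ^ 2 ≤ ‖β‖ ^ 2 * (2 * (1 + ‖a₀‖ ^ 2) * S) := by
      have h1 : ∑ i ∈ s, ‖β * k i‖ ^ 2 ≤ ∑ i ∈ s, ‖β‖ ^ 2 * (2 * (1 + ‖a₀‖ ^ 2) *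
          (wt c (lam i) * ‖x i‖ ^ 2 + ‖y i‖ ^ 2)) := Finset.sum_le_sum fun i _ => by
        rw [norm_mul, mul_pow]
        exact mul_le_mul_of_nonneg_left (hk' i) (sq_nonneg _)
      refine h1.trans ?_
      rw [← Finset.mul_sum, ← Finset.mul_sum]
      exact mul_le_mul_of_nonneg_left (mul_le_mul_of_nonneg_left hsS (by positivity))
        (sq_nonneg _)
    have m2 : ∑ i ∈ s, (‖k i‖ ^ 2 + nsq T (z₂ i)) ≤
        (2 * (1 + ‖a₀‖ ^ 2) + 2 * (T * K * (c + 1) ^ 2)) * S + 2 * T * K * S₂ := by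
      have h1 : ∑ i ∈ s, (‖k i‖ ^ 2 + nsq T (z₂ i)) ≤ ∑ i ∈ s,
          ((2 * (1 + ‖a₀‖ ^ 2) + 2 * (T * K * (c + 1) ^ 2)) *
            (wt c (lam i) * ‖x i‖ ^ 2 + ‖y i‖ ^ 2) +
          2 * T * K * (wt c (lam i) * ‖y i‖ ^ 2 + ‖-lam i * x i‖ ^ 2)) := by
        refine Finset.sum_le_sum fun i _ => ?_
        have h2 := hk' i
        have h3 := nsq_le_of_bound hT0.le (hb _ _ _ _ _ _ (hlam i) (hm i))
        have h4 : wt c (lam i) ^ 2 ≤ 2 * lam i ^ 2 + 2 * (c + 1) ^ 2 := by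
          unfold wt; nlinarith [sq_nonneg (lam i - (c + 1))]
        have h5 : ‖-(lam i : ℂ) * x i‖ ^ 2 = lam i ^ 2 * ‖x i‖ ^ 2 := by
          rw [norm_mul, norm_neg, Complex.norm_real, mul_pow, Real.norm_eq_abs, sq_abs]
        have h6 := mul_le_mul_of_nonneg_right h4 (sq_nonneg ‖x i‖)
        have h7 : 0 ≤ wt c (lam i) * ‖y i‖ ^ 2 := by have := hw i; positivity
        have h8 : wt c (lam i) ^ 2 * ‖x i‖ ^ 2 + wt c (lam i) * ‖y i‖ ^ 2 ≤
            2 * (wt c (lam i) * ‖y i‖ ^ 2 + ‖-(lam i : ℂ) * x i‖ ^ 2) +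
            2 * (c + 1) ^ 2 * (wt c (lam i) * ‖x i‖ ^ 2 + ‖y i‖ ^ 2) := by
          have h9 := mul_le_mul_of_nonneg_left (hx i) (by positivity : 0 ≤ 2 * (c + 1) ^ 2)
          have h10 : 0 ≤ 2 * (c + 1) ^ 2 * ‖y i‖ ^ 2 := by positivity
          rw [h5]
          linarith
        have h11 := mul_le_mul_of_nonneg_left h8 (by positivity : 0 ≤ T * K)
        linarith
      refine h1.trans ?_
      rw [Finset.sum_add_distrib, ← Finset.mul_sum, ← Finset.mul_sum]
      have h2 : 0 ≤ 2 * (1 + ‖a₀‖ ^ 2) + 2 * (T * K * (c + 1) ^ 2) := by positivity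
      exact add_le_add (mul_le_mul_of_nonneg_left hsS h2)
        (mul_le_mul_of_nonneg_left hsS₂ (by positivity))
    have m3 : energy c lam s x (fun _ => 0) ≤ S := by
      refine le_trans (Finset.sum_le_sum fun i _ => ?_) hsS
      simp
    have hκ0 := nsq_nonneg T κ
    have p1 := mul_le_mul_of_nonneg_left m1 hC₂.le
    have p2 := mul_le_mul_of_nonneg_left m2 hC₁.le
    have p3 := mul_le_mul_of_nonneg_left (n3.trans (mul_le_mul_of_nonneg_left m3 hC₃.le)) hκ0
    have p4 := n2.trans (mul_le_mul_of_nonneg_left p3 hT0.le)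
    linarith
  · refine hp.congr fun s => nsq_congr fun t ht => ?_
    exact vs_congr fun i => (hm i).aux_deriv_eq_sw hT0 hK t ht

/-- The space of data with vanishing observation is invariant under the operator. -/
theorem kernel_invariant {T₀ : ℝ} (hT₀ : 0 ≤ T₀) (hT : T₀ < T) (hc : 0 ≤ c)
    (hlam : ∀ i, -c ≤ lam i) (hobs : ∀ T', T₀ < T' → FreeObs c lam b T')
    (hK : IsKernel T a₀ b₀ μ μ' κ) (hm : IsModes T a₀ μ lam x y z z₁ z₂)
    (hs : Summable fun i => wt c (lam i) * ‖x i‖ ^ 2 + ‖y i‖ ^ 2)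
    (h0 : Tendsto (fun s => nsq T (vs s z b)) atTop (𝓝 0)) :
    Tendsto (fun s => nsq T (vs s (fun i t => lam i * z i t) b)) atTop (𝓝 0) := by
  have hT0 : 0 < T := hT₀.trans_lt hT
  have hs2 := kernel_regularity₂ hT₀ hT hc hlam hobs hK hm hs h0
  have hp := kernel_deriv hT₀ hT hc hlam hobs hK hm hs h0
  set β := -(a₀ ^ 2 / 4 + b₀) with hβ
  obtain ⟨C, hC, hO⟩ := modes_obs hT0 hc hlam hK (hobs T hT)
  have hμ := hK.continuousOn hT0.le
  obtain ⟨D, hD, hM⟩ := memory_nsq_bounds (ι := ι) (b := b) hT0.le hμ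
  have hml := hm.smul fun i => (lam i : ℂ)
  have hzc := fun i => hm.conv_continuousOn hT0.le hμ i
  have hzlc := fun i => hml.conv_continuousOn hT0.le hμ i
  have hfc : ∀ i, ContinuousOn (force β κ (z i)) (Icc 0 T) := fun i =>
    (hm i).force_continuousOn hT0.le hK β
  have huc : ∀ i, ContinuousOn (fun t => lam i * (z i t - conv μ (z i) t)) (Icc 0 T) := fun i =>
    continuousOn_const.mul ((hm.continuousOn i).sub (hzc i))
  have hpc : ∀ i, ContinuousOn (fun t => -lam i * (z i t - conv μ (z i) t) +
      force β κ (z i) t) (Icc 0 T) := fun i =>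
    (continuousOn_const.mul ((hm.continuousOn i).sub (hzc i))).add (hfc i)
  set F := 2 * ‖β‖ ^ 2 + 2 * (T * nsq T κ) with hF
  have hF0 : 0 ≤ F := by have := nsq_nonneg T κ; positivity
  have hlu : (fun i t => (lam i : ℂ) * (z i t - conv μ (z i) t)) = fun i t =>
      lam i * z i t - conv μ (fun r => lam i * z i r) t := by
    ext i t
    rw [conv_const_mul_right, mul_sub]
  have hforce : ∀ s, nsq T (vs s (fun i => force β κ (z i)) b) ≤ F * nsq T (vs s z b) := fun s =>
    nsq_vs_force_le hT0.le hK.memLp β s hm.continuousOn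
  have hpl : ∀ (s : Finset ι) (t : ℝ), vs s (fun i t => -lam i * (z i t - conv μ (z i) t) +
      force β κ (z i) t) b t = vs s (fun i => force β κ (z i)) b t -
      vs s (fun i t => (lam i : ℂ) * (z i t - conv μ (z i) t)) b t := by
    intro s t
    rw [← vs_sub]
    exact vs_congr fun i => by ring
  -- Second differentiation: the observation of `u'' = -λ u + force` vanishes too. The second gain
  -- makes its majorant summable.
  have hq := deriv_tendsto_zero hT0 hpc (fun i t ht => (hm i).aux_deriv_eq_primitive hK ht) hp
    (r := fun i => 2 * (F * C) * (wt c (lam i) * ‖x i‖ ^ 2 + ‖y i‖ ^ 2) +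
      2 * (D * C) * (wt c (lam i) * ‖lam i * x i‖ ^ 2 + ‖lam i * y i‖ ^ 2))
    ((hs.mul_left _).add (hs2.mul_left _)) fun s => by
      rw [nsq_congr fun t _ => hpl s t, Finset.sum_add_distrib, ← Finset.mul_sum, ← Finset.mul_sum]
      have h1 := nsq_sub_le (memLp_of_continuousOn (vs_continuousOn (s := s) (b := b) hfc))
        (memLp_of_continuousOn (vs_continuousOn (s := s) (b := b) huc))
      have h2 := mul_le_mul_of_nonneg_left (hO s x y z z₁ z₂ hm).1 hF0
      have h3 := mul_le_mul_of_nonneg_left (hO s _ _ _ _ _ hml).1 hD.le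
      have h4 := (hM s _ hml.continuousOn hzlc).1
      rw [← hlu] at h4
      have h5 := hforce s
      simp only [energy] at h2 h3
      linarith
  -- Now `λ u = force - u''`, and the observed force vanishes together with the observation of `z`.
  have hl : Tendsto (fun s => nsq T (vs s (fun i t => (lam i : ℂ) *
      (z i t - conv μ (z i) t)) b)) atTop (𝓝 0) := by
    have hz := (h0.const_mul (2 * F)).add (hq.const_mul 2)
    rw [mul_zero, mul_zero, add_zero] at hz
    refine squeeze_zero (fun _ => nsq_nonneg _ _) (fun s => ?_) hz
    have e : ∀ t ∈ Icc 0 T, vs s (fun i t => (lam i : ℂ) * (z i t - conv μ (z i) t)) b t =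
        vs s (fun i => force β κ (z i)) b t - vs s (fun i t => -lam i * (z i t - conv μ (z i) t) +
          force β κ (z i) t) b t := fun t _ => by rw [hpl, sub_sub_cancel]
    rw [nsq_congr e]
    have h1 := nsq_sub_le (memLp_of_continuousOn (vs_continuousOn (s := s) (b := b) hfc))
      (memLp_of_continuousOn (vs_continuousOn (s := s) (b := b) hpc))
    have h5 := hforce s
    linarith
  -- `λ u` is the Volterra operator applied to `λ z`; inverting it gives the claim.
  rw [hlu] at hl
  exact (memory_tendsto_zero hT0.le hμ hml.continuousOn hzlc).1 hl

end Kernel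

/-! ### Bounded-below operators and synthesis operators on ℓ² -/

/-- An injective operator which is bounded below up to a finite-rank term is bounded below. -/
theorem bounded_below_of_injective {E V W : Type*} [NormedAddCommGroup E] [NormedSpace ℂ E]
    [CompleteSpace E] [NormedAddCommGroup V] [NormedSpace ℂ V] [NormedAddCommGroup W]
    [NormedSpace ℂ W] [ProperSpace W] (Γ : E →L[ℂ] V) (P : E →L[ℂ] W) {C : ℝ}
    (h : ∀ a, ‖a‖ ≤ C * (‖Γ a‖ + ‖P a‖)) (hinj : ∀ a, Γ a = 0 → a = 0) :
    ∃ K : ℝ, 0 < K ∧ ∀ a, ‖a‖ ≤ K * ‖Γ a‖ := by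
  by_contra! hcon
  have h1 : ∀ n : ℕ, ∃ a : E, ‖a‖ = 1 ∧ ‖Γ a‖ ≤ 1 / ((n : ℝ) + 1) := by
    intro n
    obtain ⟨a, ha⟩ := hcon ((n : ℝ) + 1) (by positivity)
    have ha0 : 0 < ‖a‖ := lt_of_le_of_lt (by positivity) ha
    refine ⟨((‖a‖⁻¹ : ℝ) : ℂ) • a, ?_, ?_⟩
    · rw [norm_smul, Complex.norm_real, norm_inv, norm_norm, inv_mul_cancel₀ ha0.ne']
    · rw [map_smul, norm_smul, Complex.norm_real, norm_inv, norm_norm, inv_mul_le_iff₀ ha0,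
        mul_one_div, le_div_iff₀ (by positivity)]
      linarith
  choose a ha1 ha2 using h1
  have hΓ : Tendsto (fun n => Γ (a n)) atTop (𝓝 0) :=
    squeeze_zero_norm ha2 tendsto_one_div_add_atTop_nhds_zero_nat
  obtain ⟨p, -, φ, hφ, hp⟩ := tendsto_subseq_of_bounded (Metric.isBounded_closedBall (x := (0 : W))
    (r := ‖P‖)) (x := fun n => P (a n)) fun n => by
      simpa [ha1 n] using P.le_opNorm (a n)
  have hΓφ := hΓ.comp hφ.tendsto_atTop
  -- Along the subsequence both `Γ (a n)` and `P (a n)` are Cauchy, so the estimate `h` applied to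
  -- differences makes the unit vectors themselves Cauchy. Their limit is a unit vector killed by
  -- `Γ`.
  have hC : CauchySeq (a ∘ φ) := by
    rw [Metric.cauchySeq_iff']
    intro ε hε
    obtain ⟨N₁, hN₁⟩ := (Metric.cauchySeq_iff.1 hΓφ.cauchySeq) (ε / (2 * (|C| + 1))) (by positivity)
    obtain ⟨N₂, hN₂⟩ := (Metric.cauchySeq_iff.1 hp.cauchySeq) (ε / (2 * (|C| + 1))) (by positivity)
    refine ⟨max N₁ N₂, fun n hn => ?_⟩
    have e1 := hN₁ n (le_of_max_le_left hn) (max N₁ N₂) (le_max_left _ _)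
    have e2 := hN₂ n (le_of_max_le_right hn) (max N₁ N₂) (le_max_right _ _)
    have e3 := h (a (φ n) - a (φ (max N₁ N₂)))
    simp only [dist_eq_norm, Function.comp_apply, map_sub] at e1 e2 e3 ⊢
    refine e3.trans_lt ?_
    have hC1 : C ≤ |C| + 1 := (le_abs_self C).trans (by linarith)
    have hC2 : 0 < |C| + 1 := by positivity
    calc C * (‖Γ (a (φ n)) - Γ (a (φ (max N₁ N₂)))‖ + ‖P (a (φ n)) - P (a (φ (max N₁ N₂)))‖)
        ≤ (|C| + 1) * (‖Γ (a (φ n)) - Γ (a (φ (max N₁ N₂)))‖ +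
          ‖P (a (φ n)) - P (a (φ (max N₁ N₂)))‖) :=
          mul_le_mul_of_nonneg_right hC1 (by positivity)
      _ < (|C| + 1) * (ε / (2 * (|C| + 1)) + ε / (2 * (|C| + 1))) :=
          mul_lt_mul_of_pos_left (add_lt_add e1 e2) hC2
      _ = ε := by field_simp; ring
  obtain ⟨l, hl⟩ := cauchySeq_tendsto_of_complete hC
  have hl0 : l = 0 := hinj l (tendsto_nhds_unique ((Γ.continuous.tendsto l).comp hl) hΓφ)
  have hl1 : ‖l‖ = 1 := tendsto_nhds_unique hl.norm (by simp [ha1])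
  rw [hl0, norm_zero] at hl1
  exact zero_ne_one hl1

section Synthesis

variable {ι E V : Type*} [NormedAddCommGroup E] [NormedSpace ℂ E]
  [NormedAddCommGroup V] [NormedSpace ℂ V] [CompleteSpace V]

theorem lp_summable_sq (a : lp (fun _ : ι => E) 2) : Summable fun i => ‖a i‖ ^ 2 := by
  have := (lp.memℓp a).summable (by norm_num)
  simpa using this

theorem lp_sq_norm (a : lp (fun _ : ι => E) 2) : ‖a‖ ^ 2 = ∑' i, ‖a i‖ ^ 2 := by
  have := lp.norm_rpow_eq_tsum (by norm_num : 0 < (2 : ℝ≥0∞).toReal) a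
  simpa using this

/-- A Bessel family of operators defines a bounded operator on `ℓ²`. -/
theorem exists_synthesis {u : ι → E →ₗ[ℂ] V} {C : ℝ} (hC : 0 ≤ C)
    (hu : ∀ (s : Finset ι) (a : ι → E), ‖∑ i ∈ s, u i (a i)‖ ^ 2 ≤ C * ∑ i ∈ s, ‖a i‖ ^ 2) :
    ∃ Γ : lp (fun _ : ι => E) 2 →L[ℂ] V, ∀ a, HasSum (fun i => u i (a i)) (Γ a) := by
  have hs : ∀ a : lp (fun _ : ι => E) 2, Summable fun i => u i (a i) := fun a =>
    summable_of_sq_norm_sum_le ((lp_summable_sq a).mul_left C) fun s => by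
      rw [← Finset.mul_sum]; exact hu s a
  refine ⟨LinearMap.mkContinuous
    { toFun := fun a => ∑' i, u i (a i)
      map_add' := fun a a' => by
        rw [← (hs a).tsum_add (hs a')]
        simp
      map_smul' := fun k a => by
        rw [RingHom.id_apply, ← (hs a).tsum_const_smul k]
        simp } (√C) fun a => ?_, fun a => (hs a).hasSum⟩
  have h1 : ‖∑' i, u i (a i)‖ ^ 2 ≤ C * ‖a‖ ^ 2 := by
    refine le_of_tendsto ((hs a).hasSum.norm.pow 2) (Eventually.of_forall fun s => ?_)
    refine (hu s a).trans (mul_le_mul_of_nonneg_left ?_ hC)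
    rw [lp_sq_norm]
    exact (lp_summable_sq a).sum_le_tsum s fun _ _ => by positivity
  refine le_of_sq_le_sq ?_ (by positivity)
  rwa [mul_pow, Real.sq_sqrt hC]

end Synthesis

/-! ### Unique continuation and observability for modes with memory -/

section Uniqueness

variable {ι G : Type*} [NormedAddCommGroup G] [InnerProductSpace ℂ G] [CompleteSpace G]
  {T c : ℝ} {lam : ι → ℝ} {b : ι → G} {a₀ b₀ : ℂ} {μ μ' κ : ℝ → ℂ}
  {x y : ι → ℂ} {z z₁ z₂ : ι → ℝ → ℂ}

/-- Fundamental modes for all spectral parameters. -/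
structure IsFundamental (T : ℝ) (a₀ : ℂ) (μ : ℝ → ℂ) (f f₁ f₂ g g₁ g₂ : ℝ → ℝ → ℂ) : Prop where
  fst : ∀ l, IsMode T a₀ μ l 1 0 (f l) (f₁ l) (f₂ l)
  snd : ∀ l, IsMode T a₀ μ l 0 1 (g l) (g₁ l) (g₂ l)

theorem exists_isFundamental (hT : 0 ≤ T) (hμ : ContinuousOn μ (Icc 0 T)) :
    ∃ f f₁ f₂ g g₁ g₂ : ℝ → ℝ → ℂ, IsFundamental T a₀ μ f f₁ f₂ g g₁ g₂ := by
  choose f f₁ f₂ hf using fun l => exists_isMode (a₀ := a₀) hT hμ l 1 0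
  choose g g₁ g₂ hg using fun l => exists_isMode (a₀ := a₀) hT hμ l 0 1
  exact ⟨f, f₁, f₂, g, g₁, g₂, hf, hg⟩

variable {f f₁ f₂ g g₁ g₂ : ℝ → ℝ → ℂ}

/-- The combination of the fundamental modes with given data. -/
def comb (f g : ℝ → ℝ → ℂ) (lam : ι → ℝ) (x y : ι → ℂ) (i : ι) (t : ℝ) : ℂ :=
  x i * f (lam i) t + y i * g (lam i) t

theorem IsFundamental.isModes (h : IsFundamental T a₀ μ f f₁ f₂ g g₁ g₂)
    (hμ : ContinuousOn μ (Icc 0 T)) (x y : ι → ℂ) :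
    IsModes T a₀ μ lam x y (comb f g lam x y) (comb f₁ g₁ lam x y) (comb f₂ g₂ lam x y) := by
  intro i
  have := ((h.fst (lam i)).const_mul (x i)).add hμ ((h.snd (lam i)).const_mul (y i))
  simp only [mul_one, mul_zero, add_zero, zero_add] at this
  exact this

theorem IsFundamental.continuousOn (h : IsFundamental T a₀ μ f f₁ f₂ g g₁ g₂)
    (hμ : ContinuousOn μ (Icc 0 T)) (x y : ι → ℂ) (i : ι) :
    ContinuousOn (comb f g lam x y i) (Icc 0 T) := (h.isModes hμ x y).continuousOn i

/-- The data with vanishing observation. -/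
def obsKernel (h : IsFundamental T a₀ μ f f₁ f₂ g g₁ g₂) (hμ : ContinuousOn μ (Icc 0 T)) (c : ℝ)
    (hlam : ∀ i, -c ≤ lam i) (b : ι → G) : Submodule ℂ ((ι → ℂ) × (ι → ℂ)) where
  carrier := {p | (Summable fun i => wt c (lam i) * ‖p.1 i‖ ^ 2 + ‖p.2 i‖ ^ 2) ∧
    Tendsto (fun s => nsq T (vs s (comb f g lam p.1 p.2) b)) atTop (𝓝 0)}
  zero_mem' := by
    refine ⟨by simp, ?_⟩
    have : ∀ s : Finset ι, nsq T (vs s (comb f g lam 0 0) b) = 0 := fun s => by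
      simp [nsq, vs, comb]
    simp only [Prod.fst_zero, Prod.snd_zero, this]
    exact tendsto_const_nhds
  add_mem' := by
    rintro p q ⟨hp, hp'⟩ ⟨hq, hq'⟩
    constructor
    · refine Summable.of_nonneg_of_le (fun i => ?_) (fun i => ?_) ((hp.mul_left 2).add (hq.mul_left 2))
      · have := one_le_wt (hlam i)
        positivity
      · have h1 := mul_le_mul_of_nonneg_left (sq_norm_add_le (p.1 i) (q.1 i))
          (zero_le_one.trans (one_le_wt (hlam i)))
        have h2 := sq_norm_add_le (p.2 i) (q.2 i)
        simp only [Prod.fst_add, Prod.snd_add, Pi.add_apply]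
        linarith
    · refine squeeze_zero (fun _ => nsq_nonneg _ _) (fun s => ?_)
        (by simpa using (hp'.const_mul 2).add (hq'.const_mul 2))
      have e : ∀ t ∈ Icc 0 T, vs s (comb f g lam (p + q).1 (p + q).2) b t =
          vs s (comb f g lam p.1 p.2) b t + vs s (comb f g lam q.1 q.2) b t := fun t _ => by
        rw [← vs_add]
        refine vs_congr fun i => ?_
        simp only [comb, Prod.fst_add, Prod.snd_add, Pi.add_apply]
        ring
      rw [nsq_congr e]
      exact nsq_add_le (vs_memLp fun i => memLp_of_continuousOn (h.continuousOn hμ _ _ i))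
        (vs_memLp fun i => memLp_of_continuousOn (h.continuousOn hμ _ _ i))
  smul_mem' := by
    rintro k p ⟨hp, hp'⟩
    constructor
    · refine (hp.mul_left (‖k‖ ^ 2)).congr fun i => ?_
      simp only [Prod.smul_fst, Prod.smul_snd, Pi.smul_apply, smul_eq_mul, norm_mul]
      ring
    · have e : ∀ s, nsq T (vs s (comb f g lam (k • p).1 (k • p).2) b) =
          ‖k‖ ^ 2 * nsq T (vs s (comb f g lam p.1 p.2) b) := fun s => by
        rw [← nsq_const_smul]
        refine nsq_congr fun t _ => ?_
        rw [← vs_const_mul _ fun _ => k]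
        refine vs_congr fun i => ?_
        simp only [comb, Prod.smul_fst, Prod.smul_snd, Pi.smul_apply, smul_eq_mul]
        ring
      simp only [e]
      simpa using hp'.const_mul (‖k‖ ^ 2)

/-- The energy is controlled by the observation and finitely many coefficients. -/
theorem exists_finite_defect (hT : 0 < T) (hc : 0 ≤ c) (hlam : ∀ i, -c ≤ lam i)
    (hfin : ∀ R, {i | lam i ≤ R}.Finite)
    (hK : IsKernel T a₀ b₀ μ μ' κ) (hobs : FreeObs c lam b T) :
    ∃ (C : ℝ) (F : Finset ι), 0 < C ∧ ∀ (s : Finset ι) (x y : ι → ℂ) (z z₁ z₂ : ι → ℝ → ℂ),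
      IsModes T a₀ μ lam x y z z₁ z₂ →
      nsq T (vs s z b) ≤ C * energy c lam s x y ∧
      energy c lam s x y ≤ C * nsq T (vs s z b) + C * ∑ i ∈ F, (‖x i‖ ^ 2 + ‖y i‖ ^ 2) := by
  classical
  obtain ⟨C, hC, hO⟩ := modes_obs hT hc hlam hK hobs
  -- Beyond this threshold the weight is at least `2 C`, so the lower order term is at most half of
  -- the energy and can be absorbed.
  have hF := hfin (2 * C)
  refine ⟨2 * C, hF.toFinset, by positivity, fun s x y z z₁ z₂ h => ?_⟩
  obtain ⟨h1, h2⟩ := hO s x y z z₁ z₂ h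
  have hE := energy_nonneg hlam s x y
  refine ⟨by nlinarith, ?_⟩
  have h3 : C * ∑ i ∈ s, (‖x i‖ ^ 2 + ‖y i‖ ^ 2 / wt c (lam i)) ≤
      1 / 2 * energy c lam s x y + C * ∑ i ∈ s ∩ hF.toFinset, (‖x i‖ ^ 2 + ‖y i‖ ^ 2) := by
    rw [energy, Finset.mul_sum, Finset.mul_sum, Finset.mul_sum, ← Finset.sum_ite_mem,
      ← Finset.sum_add_distrib]
    refine Finset.sum_le_sum fun i _ => ?_
    have hw := one_le_wt (hlam i)
    have hw0 : 0 < wt c (lam i) := one_pos.trans_le hw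
    split_ifs with hi
    · have h4 : ‖y i‖ ^ 2 / wt c (lam i) ≤ ‖y i‖ ^ 2 := div_le_self (by positivity) hw
      have h5 := mul_le_mul_of_nonneg_left (add_le_add_right h4 (‖x i‖ ^ 2)) hC.le
      have h6 : 0 ≤ 1 / 2 * (wt c (lam i) * ‖x i‖ ^ 2 + ‖y i‖ ^ 2) := by positivity
      linarith
    · have h4 : 2 * C ≤ wt c (lam i) := by
        rw [Finite.mem_toFinset, mem_ofPred_eq, not_le] at hi
        unfold wt; linarith
      rw [← wt_mul_eq hw0, add_zero]
      have h5 : 0 ≤ ‖x i‖ ^ 2 + ‖y i‖ ^ 2 / wt c (lam i) := by positivity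
      have h6 := mul_le_mul_of_nonneg_right h4 h5
      linarith
  have h4 : ∑ i ∈ s ∩ hF.toFinset, (‖x i‖ ^ 2 + ‖y i‖ ^ 2) ≤
      ∑ i ∈ hF.toFinset, (‖x i‖ ^ 2 + ‖y i‖ ^ 2) :=
    Finset.sum_le_sum_of_subset_of_nonneg Finset.inter_subset_right fun _ _ _ => by positivity
  have h5 := mul_le_mul_of_nonneg_left h4 hC.le
  linarith

/-- A finite combination of observation vectors for one frequency vanishes if its observation
does. -/
theorem IsFundamental.unique_of_eq (hT : 0 < T) (h : IsFundamental T a₀ μ f f₁ f₂ g g₁ g₂)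
    (l : ℝ) {p q : G} (hpq : nsq T (fun t => f l t • p + g l t • q) = 0) : p = 0 ∧ q = 0 := by
  have hfc := (h.fst l).continuous
  have hgc := (h.snd l).continuous
  have hcont : Continuous fun t => f l t • p + g l t • q :=
    (hfc.smul continuous_const).add (hgc.smul continuous_const)
  have hz : ∀ t ∈ Icc 0 T, f l t • p + g l t • q = 0 := by
    have h1 := (integral_eq_zero_iff_of_nonneg (fun _ => by positivity)
      (integrable_sq (memLp_of_continuousOn hcont.continuousOn))).1 hpq
    have h2 : (fun t => f l t • p + g l t • q) =ᵐ[volume.restrict (Icc 0 T)] fun _ => 0 := by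
      filter_upwards [h1] with t ht
      simpa using ht
    exact Measure.eqOn_Icc_of_ae_eq volume hT.ne h2 hcont.continuousOn continuousOn_const
  have hder : ∀ {v v₁ v₂ : ℝ → ℂ} {x y : ℂ}, IsMode T a₀ μ l x y v v₁ v₂ →
      HasDerivAt v (y + a₀ * x) 0 := by
    intro v v₁ v₂ x y hv
    have h1 := (hv.deriv_continuous.integral_hasStrictDerivAt 0 0).hasDerivAt.const_add x
    have h2 : (fun t => x + ∫ s in (0 : ℝ)..t, v₁ s) = v := (funext hv.eq_primitive).symm
    have h3 : v₁ 0 = y + a₀ * x := by simpa using hv.deriv_eq_primitive 0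
    rwa [h2, h3] at h1
  have hf0 : f l 0 = 1 := by simpa using (h.fst l).eq_primitive 0
  have hg0 : g l 0 = 0 := by simpa using (h.snd l).eq_primitive 0
  -- The value at `t = 0` isolates `p`; once `p = 0`, the one-sided derivative at `0` isolates `q`.
  have hp : p = 0 := by simpa [hf0, hg0] using hz 0 (left_mem_Icc.2 hT.le)
  refine ⟨hp, ?_⟩
  subst hp
  simp only [smul_zero, zero_add] at hz
  have hd : HasDerivWithinAt (fun t => g l t • q) (((1 : ℂ) + a₀ * 0) • q) (Icc 0 T) 0 :=
    ((hder (h.snd l)).smul_const q).hasDerivWithinAt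
  have hd0 : HasDerivWithinAt (fun t => g l t • q) 0 (Icc 0 T) 0 :=
    (hasDerivWithinAt_const 0 _ (0 : G)).congr hz (hz 0 (left_mem_Icc.2 hT.le))
  have := (uniqueDiffOn_Icc hT 0 (left_mem_Icc.2 hT.le)).eq_deriv _ hd hd0
  simpa using this

/-- The diagonal operator. -/
def diag (lam : ι → ℝ) : Module.End ℂ ((ι → ℂ) × (ι → ℂ)) where
  toFun p := (fun i => lam i * p.1 i, fun i => lam i * p.2 i)
  map_add' p q := by ext <;> simp [mul_add]
  map_smul' k p := by ext <;> simp [mul_left_comm]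

/-- Unique continuation: no nonzero data have vanishing observation. -/
theorem obsKernel_eq_bot {T₀ : ℝ} (hT₀ : 0 ≤ T₀) (hT : T₀ < T) (hc : 0 ≤ c)
    (hlam : ∀ i, -c ≤ lam i) (hfin : ∀ R, {i | lam i ≤ R}.Finite)
    (hobs : ∀ T', T₀ < T' → FreeObs c lam b T')
    (hK : IsKernel T a₀ b₀ μ μ' κ) (h : IsFundamental T a₀ μ f f₁ f₂ g g₁ g₂)
    (hμ : ContinuousOn μ (Icc 0 T)) : obsKernel h hμ c hlam b = ⊥ := by
  have hT0 : 0 < T := hT₀.trans_lt hT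
  set N := obsKernel h hμ c hlam b with hN
  obtain ⟨C, F, hC, hO⟩ := exists_finite_defect hT0 hc hlam hfin hK (hobs T hT)
  -- For data in `N` the observation term drops out of the estimate, so the energy is controlled by
  -- the coordinates in `F` alone. Hence `N` embeds into a finite-dimensional space.
  have hzero : ∀ p ∈ N, (∀ i ∈ F, p.1 i = 0 ∧ p.2 i = 0) → p = 0 := by
    rintro p ⟨hp, hp'⟩ hpF
    have h1 : ∀ s, energy c lam s p.1 p.2 ≤ C * nsq T (vs s (comb f g lam p.1 p.2) b) := by
      intro s
      have h2 := (hO s _ _ _ _ _ (h.isModes hμ p.1 p.2)).2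
      rwa [Finset.sum_eq_zero fun i hi => by simp [hpF i hi], mul_zero, add_zero] at h2
    have h2 : ∑' i, (wt c (lam i) * ‖p.1 i‖ ^ 2 + ‖p.2 i‖ ^ 2) ≤ 0 := by
      have h3 := hp'.const_mul C
      rw [mul_zero] at h3
      exact le_of_tendsto_of_tendsto' hp.hasSum h3 h1
    have hnn : ∀ i, 0 ≤ wt c (lam i) * ‖p.1 i‖ ^ 2 + ‖p.2 i‖ ^ 2 := fun i => by
      have := one_le_wt (hlam i)
      positivity
    have h4 : ∀ i, wt c (lam i) * ‖p.1 i‖ ^ 2 + ‖p.2 i‖ ^ 2 = 0 := fun i =>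
      le_antisymm ((hp.le_tsum i fun j _ => hnn j).trans h2) (hnn i)
    have h5 : ∀ i, p.1 i = 0 ∧ p.2 i = 0 := fun i => by
      have hw := one_le_wt (hlam i)
      have h6 := le_mul_of_one_le_left (sq_nonneg ‖p.1 i‖) hw
      have h7 := h4 i
      have h8 := sq_nonneg ‖p.1 i‖
      have h9 := sq_nonneg ‖p.2 i‖
      constructor
      · have : ‖p.1 i‖ ^ 2 = 0 := by linarith
        simpa using this
      · have : ‖p.2 i‖ ^ 2 = 0 := by linarith
        simpa using this
    exact Prod.ext (funext fun i => (h5 i).1) (funext fun i => (h5 i).2)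
  let R : N →ₗ[ℂ] (F → ℂ) × (F → ℂ) :=
    ((LinearMap.funLeft ℂ ℂ (Subtype.val : F → ι)).prodMap
      (LinearMap.funLeft ℂ ℂ (Subtype.val : F → ι))).comp N.subtype
  have hR : Function.Injective R := by
    rw [← LinearMap.ker_eq_bot, LinearMap.ker_eq_bot']
    intro p hp
    have h1 : R p = (fun i : F => p.1.1 i, fun i : F => p.1.2 i) := rfl
    rw [h1, Prod.mk_eq_zero] at hp
    exact Subtype.ext (hzero p p.2 fun i hi => ⟨congrFun hp.1 ⟨i, hi⟩, congrFun hp.2 ⟨i, hi⟩⟩)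
  have : FiniteDimensional ℂ N := FiniteDimensional.of_injective R hR
  have hinv : ∀ p ∈ N, diag lam p ∈ N := by
    rintro p ⟨hp, hp'⟩
    have hm := h.isModes (lam := lam) hμ p.1 p.2
    refine ⟨kernel_regularity₂ hT₀ hT hc hlam hobs hK hm hp hp', ?_⟩
    refine (kernel_invariant hT₀ hT hc hlam hobs hK hm hp hp').congr fun s => nsq_congr fun t _ =>
      vs_congr fun i => ?_
    simp only [comb, diag, LinearMap.coe_mk, AddHom.coe_mk]
    ring
  -- A nonzero finite-dimensional invariant space over `ℂ` contains an eigenvector of the diagonal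
  -- operator, and such data are supported on the indices of a single eigenvalue.
  by_contra hne
  have : Nontrivial N := Submodule.nontrivial_iff_ne_bot.2 hne
  obtain ⟨ν, hν⟩ := Module.End.exists_eigenvalue ((diag lam).restrict hinv)
  obtain ⟨p, hp⟩ := hν.exists_hasEigenvector
  have hp1 := hp.apply_eq_smul
  have hp0 : p ≠ 0 := hp.2
  have hc1 : ∀ i, (lam i : ℂ) * p.1.1 i = ν * p.1.1 i := fun i =>
    congrFun (congrArg (fun q : N => q.1.1) hp1) i
  have hc2 : ∀ i, (lam i : ℂ) * p.1.2 i = ν * p.1.2 i := fun i =>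
    congrFun (congrArg (fun q : N => q.1.2) hp1) i
  have hex : ∃ j, p.1.1 j ≠ 0 ∨ p.1.2 j ≠ 0 := by
    by_contra! hcon
    exact hp0 (Subtype.ext (Prod.ext (funext fun i => (hcon i).1) (funext fun i => (hcon i).2)))
  obtain ⟨j, hj⟩ := hex
  have hνj : (lam j : ℂ) = ν := by
    rcases hj with hj | hj
    · exact mul_right_cancel₀ hj (hc1 j)
    · exact mul_right_cancel₀ hj (hc2 j)
  have hsupp : ∀ i, lam i ≠ lam j → p.1.1 i = 0 ∧ p.1.2 i = 0 := fun i hi => by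
    have hi' : (lam i : ℂ) ≠ ν := by rw [← hνj]; exact_mod_cast hi
    constructor
    · by_contra h0
      exact hi' (mul_right_cancel₀ h0 (hc1 i))
    · by_contra h0
      exact hi' (mul_right_cancel₀ h0 (hc2 i))
  have hSf : {i | lam i = lam j}.Finite := (hfin (lam j)).subset fun i hi => le_of_eq hi
  set S := hSf.toFinset with hS
  have hmem : ∀ i, i ∈ S ↔ lam i = lam j := fun i => by simp [hS]
  set P := ∑ i ∈ S, p.1.1 i • b i
  set Q := ∑ i ∈ S, p.1.2 i • b i
  -- The partial sums are constant once they contain `S`, so convergence of their norms to zero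
  -- means that this function vanishes.
  have hlarge : ∀ s, S ⊆ s → ∀ t, vs s (comb f g lam p.1.1 p.1.2) b t =
      f (lam j) t • P + g (lam j) t • Q := by
    intro s hs t
    rw [vs, ← Finset.sum_subset hs fun i _ hi => by
      have := hsupp i (fun h => hi ((hmem i).2 h))
      simp [comb, this], Finset.smul_sum, Finset.smul_sum, ← Finset.sum_add_distrib]
    refine Finset.sum_congr rfl fun i hi => ?_
    rw [comb, (hmem i).1 hi, add_smul, smul_smul, smul_smul, mul_comm, mul_comm (p.1.2 i)]
  have hn : nsq T (fun t => f (lam j) t • P + g (lam j) t • Q) = 0 := by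
    refine tendsto_nhds_unique (tendsto_const_nhds.congr' ?_) p.2.2
    filter_upwards [eventually_ge_atTop S] with s hs
    exact (nsq_congr fun t _ => hlarge s hs t).symm
  obtain ⟨hP, hQ⟩ := h.unique_of_eq hT0 (lam j) hn
  -- The free evolution with the same data is observed through the same two vectors `P` and `Q`.
  -- Both are zero, so free observability makes the data vanish.
  obtain ⟨C', hC', hob⟩ := hobs T hT
  have hE := (hob S p.1.1 p.1.2).1
  have hfree : ∀ t ∈ Icc 0 T, vs S (fun i => free (lam i) (p.1.1 i) (p.1.2 i)) b t = 0 := by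
    intro t _
    have : vs S (fun i => free (lam i) (p.1.1 i) (p.1.2 i)) b t =
        cw (lam j) t • P + sw (lam j) t • Q := by
      rw [vs, Finset.smul_sum, Finset.smul_sum, ← Finset.sum_add_distrib]
      refine Finset.sum_congr rfl fun i hi => ?_
      rw [free, (hmem i).1 hi, add_smul, smul_smul, smul_smul, mul_comm, mul_comm (p.1.2 i)]
    rw [this, hP, hQ, smul_zero, smul_zero, add_zero]
  rw [nsq_congr hfree] at hE
  have hE0 : energy c lam S p.1.1 p.1.2 ≤ 0 := by simpa [nsq] using hE
  have hjS : j ∈ S := (hmem j).2 rfl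
  have hw := one_le_wt (hlam j)
  have h1 : wt c (lam j) * ‖p.1.1 j‖ ^ 2 + ‖p.1.2 j‖ ^ 2 ≤ 0 :=
    (Finset.single_le_sum (f := fun i => wt c (lam i) * ‖p.1.1 i‖ ^ 2 + ‖p.1.2 i‖ ^ 2)
      (fun i _ => by have := one_le_wt (hlam i); positivity) hjS).trans hE0
  rcases hj with hj | hj
  · have : 0 < ‖p.1.1 j‖ := norm_pos_iff.2 hj
    have : 0 < wt c (lam j) * ‖p.1.1 j‖ ^ 2 := by positivity
    have := sq_nonneg ‖p.1.2 j‖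
    linarith
  · have : 0 < ‖p.1.2 j‖ := norm_pos_iff.2 hj
    have : 0 < ‖p.1.2 j‖ ^ 2 := by positivity
    have : 0 ≤ wt c (lam j) * ‖p.1.1 j‖ ^ 2 := by positivity
    linarith

/-- The operator `(α, β) ↦ k α p + β q`. -/
def pairOp {V : Type*} [NormedAddCommGroup V] [NormedSpace ℂ V] (k : ℂ) (p q : V) :
    WithLp 2 (ℂ × ℂ) →ₗ[ℂ] V where
  toFun a := (k * a.fst) • p + a.snd • q
  map_add' a a' := by
    simp only [WithLp.add_fst, WithLp.add_snd, mul_add, add_smul]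
    abel
  map_smul' m a := by
    simp only [WithLp.smul_fst, WithLp.smul_snd, smul_eq_mul, RingHom.id_apply, smul_add, smul_smul]
    rw [mul_left_comm]

/-- Two-sided observability estimate for finite sums of modes with memory. -/
theorem modes_observability {T₀ : ℝ} (hT₀ : 0 ≤ T₀) (hT : T₀ < T) (hc : 0 ≤ c)
    (hlam : ∀ i, -c ≤ lam i) (hfin : ∀ R, {i | lam i ≤ R}.Finite)
    (hobs : ∀ T', T₀ < T' → FreeObs c lam b T') (hK : IsKernel T a₀ b₀ μ μ' κ) :
    ∃ C : ℝ, 0 < C ∧ ∀ (s : Finset ι) (x y : ι → ℂ) (z z₁ z₂ : ι → ℝ → ℂ),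
      IsModes T a₀ μ lam x y z z₁ z₂ →
      energy c lam s x y ≤ C * nsq T (vs s z b) ∧ nsq T (vs s z b) ≤ C * energy c lam s x y := by
  classical
  have hT0 : 0 < T := hT₀.trans_lt hT
  have hμ := hK.continuousOn hT0.le
  obtain ⟨f, f₁, f₂, g, g₁, g₂, h⟩ := exists_isFundamental (a₀ := a₀) hT0.le hμ
  obtain ⟨C, F, hC, hO⟩ := exists_finite_defect hT0 hc hlam hfin hK (hobs T hT)
  have hbot := obsKernel_eq_bot hT₀ hT hc hlam hfin hobs hK h hμ
  have hw : ∀ i, 0 < wt c (lam i) := fun i => one_pos.trans_le (one_le_wt (hlam i))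
  have hwC : ∀ i, ((√(wt c (lam i)) : ℝ) : ℂ) ≠ 0 := fun i => by
    exact_mod_cast (Real.sqrt_pos.2 (hw i)).ne'
  have hfm : ∀ l, MemLp (f l) 2 (vol T) := fun l =>
    memLp_of_continuousOn (h.fst l).continuous.continuousOn
  have hgm : ∀ l, MemLp (g l) 2 (vol T) := fun l =>
    memLp_of_continuousOn (h.snd l).continuous.continuousOn
  have hcm : ∀ (x y : ι → ℂ) (i : ι), MemLp (comb f g lam x y i) 2 (vol T) := fun x y i =>
    memLp_of_continuousOn (h.continuousOn hμ x y i)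
  let E := WithLp 2 (ℂ × ℂ)
  -- Dividing by the square root of the weight makes the energy norm equal to the ℓ² norm with
  -- values in the Hilbert space `ℂ × ℂ`.
  let X : (ι → E) → ι → ℂ := fun a i => (√(wt c (lam i)) : ℂ)⁻¹ * (a i).fst
  let Y : (ι → E) → ι → ℂ := fun a i => (a i).snd
  have hXY : ∀ (a : ι → E) (i : ι), wt c (lam i) * ‖X a i‖ ^ 2 + ‖Y a i‖ ^ 2 = ‖a i‖ ^ 2 := by
    intro a i
    rw [WithLp.prod_norm_sq_eq_of_L2, norm_mul, norm_inv, Complex.norm_real, Real.norm_eq_abs,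
      abs_of_nonneg (Real.sqrt_nonneg _), mul_pow, inv_pow, Real.sq_sqrt (hw i).le, ← mul_assoc,
      mul_inv_cancel₀ (hw i).ne', one_mul]
  let u : ι → E →ₗ[ℂ] Lp G 2 (vol T) := fun i => pairOp (√(wt c (lam i)) : ℂ)⁻¹
    (toL2 T (fun t => f (lam i) t • b i)) (toL2 T (fun t => g (lam i) t • b i))
  have hu : ∀ (a : ι → E) (s : Finset ι), ∑ i ∈ s, u i (a i) =
      toL2 T (vs s (comb f g lam (X a) (Y a)) b) := by
    intro a s
    rw [toL2_vs s (hcm _ _)]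
    refine Finset.sum_congr rfl fun i _ => ?_
    have e : (fun t => comb f g lam (X a) (Y a) i t • b i) = fun t =>
        X a i • (f (lam i) t • b i) + Y a i • (g (lam i) t • b i) := by
      ext t
      rw [comb, add_smul, smul_smul, smul_smul]
    have m1 : MemLp (fun t => X a i • (f (lam i) t • b i)) 2 (vol T) :=
      (memLp_smul_const (hfm _) _).const_smul _
    have m2 : MemLp (fun t => Y a i • (g (lam i) t • b i)) 2 (vol T) :=
      (memLp_smul_const (hgm _) _).const_smul _
    rw [e, toL2_add m1 m2, toL2_const_smul _ (memLp_smul_const (hfm _) _),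
      toL2_const_smul _ (memLp_smul_const (hgm _) _)]
    rfl
  have hun : ∀ (a : ι → E) (s : Finset ι), ‖∑ i ∈ s, u i (a i)‖ ^ 2 =
      nsq T (vs s (comb f g lam (X a) (Y a)) b) := fun a s => by
    rw [hu, sq_norm_toL2 (vs_memLp (hcm _ _))]
  have hen : ∀ (a : ι → E) (s : Finset ι), energy c lam s (X a) (Y a) = ∑ i ∈ s, ‖a i‖ ^ 2 :=
    fun a s => Finset.sum_congr rfl fun i _ => hXY a i
  obtain ⟨Γ, hΓ⟩ := exists_synthesis (u := u) hC.le fun s a => by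
    rw [hun, ← hen]
    exact (hO s _ _ _ _ _ (h.isModes hμ (X a) (Y a))).1
  have hΓn : ∀ a : lp (fun _ : ι => E) 2, Tendsto
      (fun s => nsq T (vs s (comb f g lam (X a) (Y a)) b)) atTop (𝓝 (‖Γ a‖ ^ 2)) := fun a => by
    simp only [← hun]
    exact (hΓ a).norm.pow 2
  have hinj : ∀ a, Γ a = 0 → a = 0 := by
    intro a ha
    have h1 : ((X a, Y a) : (ι → ℂ) × (ι → ℂ)) ∈ obsKernel h hμ c hlam b := by
      refine ⟨(lp_summable_sq a).congr fun i => (hXY a i).symm, ?_⟩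
      simpa [ha] using hΓn a
    rw [hbot, Submodule.mem_bot, Prod.mk_eq_zero] at h1
    ext i
    have h2 := hXY a i
    rw [h1.1, h1.2] at h2
    have h3 : ‖a i‖ ^ 2 = 0 := by simpa using h2.symm
    have h4 : a i = 0 := norm_eq_zero.1 (pow_eq_zero_iff two_ne_zero |>.1 h3)
    rw [h4]; rfl
  let P : lp (fun _ : ι => E) 2 →L[ℂ] (F → E) :=
    ContinuousLinearMap.pi fun i => lp.evalCLM ℂ (fun _ : ι => E) 2 i.1
  have hP : ∀ a i, P a i = a i.1 := fun a i => rfl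
  -- `P` records the coordinates in `F` with the sup norm, so the finite defect is at most `F.card *
  -- ‖P a‖²`; this explains the constant.
  obtain ⟨K, hK0, hb⟩ := bounded_below_of_injective Γ P (C := √(C * (1 + F.card)))
    (fun a => by
      have h1 : ∀ s : Finset ι, ∑ i ∈ s, ‖a i‖ ^ 2 ≤
          C * nsq T (vs s (comb f g lam (X a) (Y a)) b) + C * (F.card * ‖P a‖ ^ 2) := by
        intro s
        rw [← hen]
        refine ((hO s _ _ _ _ _ (h.isModes hμ (X a) (Y a))).2).trans
          (add_le_add_right (mul_le_mul_of_nonneg_left ?_ hC.le) _)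
        rw [← nsmul_eq_mul]
        refine Finset.sum_le_card_nsmul _ _ _ fun i hi => ?_
        have h2 := hXY a i
        have h3 := le_mul_of_one_le_left (sq_nonneg ‖X a i‖) (one_le_wt (hlam i))
        have h4 : ‖a i‖ ≤ ‖P a‖ := norm_le_pi_norm (P a) ⟨i, hi⟩
        have h5 := pow_le_pow_left₀ (norm_nonneg _) h4 2
        linarith
      have h2 : ‖a‖ ^ 2 ≤ C * ‖Γ a‖ ^ 2 + C * (F.card * ‖P a‖ ^ 2) := by
        rw [lp_sq_norm]
        exact le_of_tendsto_of_tendsto' (lp_summable_sq a).hasSum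
          (((hΓn a).const_mul C).add_const _) h1
      refine le_of_sq_le_sq ?_ (by positivity)
      rw [mul_pow, Real.sq_sqrt (by positivity)]
      have h3 : 0 ≤ C * (F.card * ‖Γ a‖ ^ 2) := by positivity
      have h4 : 0 ≤ C * ‖P a‖ ^ 2 := by positivity
      have h5 : 0 ≤ C * (1 + F.card) * (2 * (‖Γ a‖ * ‖P a‖)) := by positivity
      linarith) hinj
  refine ⟨K ^ 2 + C, by positivity, fun s x y z z₁ z₂ hm => ?_⟩
  obtain ⟨h1, -⟩ := hO s x y z z₁ z₂ hm
  have hE := energy_nonneg hlam s x y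
  have hn := nsq_nonneg T (vs s z b)
  refine ⟨?_, by nlinarith [sq_nonneg K]⟩
  -- Finite sums correspond to finitely supported sequences. The given modes agree with the
  -- combinations of fundamental modes by uniqueness for the mode equation.
  let a' : ι → E := fun i => if i ∈ s then WithLp.toLp 2 ((√(wt c (lam i)) : ℂ) * x i, y i) else 0
  have ha' : Memℓp a' 2 := memℓp_gen <| summable_of_ne_finset_zero (s := s) fun i hi => by
    simp [a', hi]
  let a : lp (fun _ : ι => E) 2 := ⟨a', ha'⟩
  have haX : ∀ i ∈ s, X a i = x i := fun i hi => by
    have : a i = WithLp.toLp 2 ((√(wt c (lam i)) : ℂ) * x i, y i) := if_pos hi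
    simp only [X, this]
    exact inv_mul_cancel_left₀ (hwC i) (x i)
  have haY : ∀ i ∈ s, Y a i = y i := fun i hi => by
    have : a i = WithLp.toLp 2 ((√(wt c (lam i)) : ℂ) * x i, y i) := if_pos hi
    simp only [Y, this]
    rfl
  have ha0 : ∀ i ∉ s, a i = 0 := fun i hi => if_neg hi
  have hna : ‖a‖ ^ 2 = energy c lam s x y := by
    rw [lp_sq_norm, tsum_eq_sum fun i hi => by rw [ha0 i hi, norm_zero, zero_pow two_ne_zero],
      ← hen]
    exact Finset.sum_congr rfl fun i hi => by rw [haX i hi, haY i hi]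
  have hΓa : Γ a = ∑ i ∈ s, u i (a i) :=
    (hΓ a).unique (hasSum_sum_of_ne_finset_zero fun i hi => by rw [ha0 i hi, map_zero])
  have hnΓ : ‖Γ a‖ ^ 2 = nsq T (vs s z b) := by
    rw [hΓa, hun]
    refine nsq_congr fun t ht => Finset.sum_congr rfl fun i hi => ?_
    congr 1
    have h2 := h.isModes (lam := lam) hμ x y i
    rw [(hm i).unique hT0 hK h2 ht, comb, comb, haX i hi, haY i hi]
  have h3 := pow_le_pow_left₀ (norm_nonneg _) (hb a) 2
  rw [mul_pow, hna, hnΓ] at h3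
  have h4 := mul_nonneg hC.le hn
  linarith

end Uniqueness

/-! ### Weak derivatives and continuous representatives of H² kernels -/

section Sobolev

variable {T : ℝ} {f g : ℝ → ℂ}

theorem integral_vol (hT : 0 ≤ T) {E : Type*} [NormedAddCommGroup E] [NormedSpace ℝ E]
    (f : ℝ → E) : ∫ t in Icc 0 T, f t = ∫ t in (0 : ℝ)..T, f t := by
  rw [integral_Icc_eq_integral_Ioc, intervalIntegral.integral_of_le hT]

/-- Reflecting the test function turns the pairing into a convolution evaluated at `T`, where a
primitive may be moved from one factor to the other. -/
theorem isWeakDeriv_primitive (hT : 0 ≤ T) (hg : MemLp g 2 (vol T)) :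
    IsWeakDeriv T (fun t => ∫ s in (0 : ℝ)..t, g s) g := by
  intro φ hφ _ hs
  have hφT : φ T = 0 := image_eq_zero_of_notMem_tsupport fun h => (lt_irrefl _ (hs h).2)
  have hd : Continuous (deriv φ) := hφ.continuous_deriv (by simp)
  have hgi := MemLp.intervalIntegrable hT hg
  set k : ℝ → ℂ := fun s => deriv φ (T - s) with hk
  have hkc : Continuous k := hd.comp (continuous_const.sub continuous_id)
  have hki : IntervalIntegrable k volume 0 T := hkc.intervalIntegrable _ _
  have h1 := (conv_primitive hT hki hgi).trans (integral_conv hT hki hgi)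
  have h2 : ∀ r, ∫ s in (0 : ℝ)..r, k s = -φ (T - r) := by
    intro r
    rw [hk, intervalIntegral.integral_comp_sub_left (fun s => deriv φ s), sub_zero,
      intervalIntegral.integral_deriv_eq_sub
        (fun x _ => (hφ.differentiable (by simp)) x) (hd.intervalIntegrable _ _), hφT, zero_sub]
  rw [integral_vol hT, integral_vol hT]
  rw [show (fun r => ∫ s in (0 : ℝ)..r, k s) = fun r => -φ (T - r) from funext h2] at h1
  simp only [conv, hk, sub_sub_cancel, smul_eq_mul, neg_mul, intervalIntegral.integral_neg] at h1
  simpa only [mul_comm] using h1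

/-- The zero mean makes the primitive vanish to the right of the support as well as to its left, so
it is again a test function. -/
theorem exists_test_primitive (hT : 0 < T) {θ : ℝ → ℝ} (hθ : ContDiff ℝ ∞ θ)
    (hs : tsupport θ ⊆ Ioo 0 T) (hc : HasCompactSupport θ) (h0 : ∫ t in (0 : ℝ)..T, θ t = 0) :
    ∃ φ : ℝ → ℝ, ContDiff ℝ ∞ φ ∧ HasCompactSupport φ ∧ tsupport φ ⊆ Ioo 0 T ∧
      ∀ t, HasDerivAt φ (θ t) t := by
  obtain ⟨a, b, ha, hb, hab⟩ : ∃ a b : ℝ, 0 < a ∧ b < T ∧ tsupport θ ⊆ Icc a b := by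
    rcases (tsupport θ).eq_empty_or_nonempty with he | hne
    · exact ⟨T / 2, T / 2, by linarith, by linarith, by simp [he]⟩
    · obtain ⟨a, ha, ha'⟩ := hc.isCompact.exists_isLeast hne
      obtain ⟨b, hb, hb'⟩ := hc.isCompact.exists_isGreatest hne
      exact ⟨a, b, (hs ha).1, (hs hb).2, fun t ht => ⟨ha' ht, hb' ht⟩⟩
  have hz : ∀ t, t ∉ Icc a b → θ t = 0 := fun t ht =>
    image_eq_zero_of_notMem_tsupport fun h => ht (hab h)
  have hder : ∀ t, HasDerivAt (fun t => ∫ s in (0 : ℝ)..t, θ s) (θ t) t := fun t =>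
    (hθ.continuous.integral_hasStrictDerivAt 0 t).hasDerivAt
  have hsupp : tsupport (fun t => ∫ s in (0 : ℝ)..t, θ s) ⊆ Icc a b := by
    refine closure_minimal (fun t ht => ?_) isClosed_Icc
    by_contra hn
    apply ht
    rw [mem_Icc, not_and_or, not_le, not_le] at hn
    rcases hn with hn | hn
    · refine intervalIntegral.integral_zero_ae (Eventually.of_forall fun s hs => hz s fun h => ?_)
      rcases mem_uIoc.1 hs with h' | h'
      · linarith [h'.2, h.1]
      · linarith [h'.2, h.1]
    · change ∫ s in (0 : ℝ)..t, θ s = 0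
      rw [← intervalIntegral.integral_add_adjacent_intervals
        (hθ.continuous.intervalIntegrable 0 T) (hθ.continuous.intervalIntegrable T t), h0, zero_add]
      refine intervalIntegral.integral_zero_ae (Eventually.of_forall fun s hs => hz s fun h => ?_)
      rcases mem_uIoc.1 hs with h' | h'
      · linarith [h'.1, h.2]
      · linarith [h'.1, h.2]
  refine ⟨_, ?_, HasCompactSupport.of_support_subset_isCompact isCompact_Icc
    (subset_closure.trans hsupp), hsupp.trans fun t ht => ⟨ha.trans_le ht.1, ht.2.trans_lt hb⟩, hder⟩
  rw [contDiff_infty_iff_deriv]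
  refine ⟨fun t => (hder t).differentiableAt, ?_⟩
  rwa [show deriv (fun t => ∫ s in (0 : ℝ)..t, θ s) = θ from funext fun t => (hder t).deriv]

/-- A function with vanishing weak derivative is constant. -/
theorem ae_eq_const_of_weakDeriv_zero (hT : 0 < T) (hf : MemLp f 2 (vol T))
    (h : IsWeakDeriv T f 0) : ∃ k : ℂ, f =ᵐ[vol T] fun _ => k := by
  have hfi : IntegrableOn f (Icc 0 T) := hf.integrable (by norm_num)
  have hint : ∀ {g : ℝ → ℝ}, Continuous g → ∀ {F : ℝ → ℂ}, IntegrableOn F (Icc 0 T) →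
      IntegrableOn (fun t => g t • F t) (Icc 0 T) := fun hg F hF =>
    IntegrableOn.continuousOn_smul hF hg.continuousOn isCompact_Icc
  let ρ : ContDiffBump (T / 2) := ⟨T / 8, T / 4, by linarith, by linarith⟩
  have hρs : tsupport ρ ⊆ Ioo 0 T := by
    rw [ρ.tsupport_eq, Real.closedBall_eq_Icc]
    intro t ht
    have h1 : T / 2 - T / 4 ≤ t := ht.1
    have h2 : t ≤ T / 2 + T / 4 := ht.2
    exact ⟨by linarith, by linarith⟩
  have hρc : ContDiff ℝ ∞ (ρ : ℝ → ℝ) := ρ.contDiff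
  set I := ∫ t in (0 : ℝ)..T, ρ t with hI
  have hIpos : I ≠ 0 := by
    have h1 : ∫ t in Icc 0 T, ρ t = ∫ t, ρ t :=
      setIntegral_eq_integral_of_forall_compl_eq_zero fun t ht =>
        image_eq_zero_of_notMem_tsupport fun h' => ht (Ioo_subset_Icc_self (hρs h'))
    rw [hI, ← integral_vol hT.le, h1]
    exact (ρ.integral_pos (μ := volume)).ne'
  set k : ℂ := (I : ℂ)⁻¹ * ∫ t in Icc 0 T, ρ t • f t with hk
  refine ⟨k, ?_⟩
  have hconst : IntegrableOn (fun _ : ℝ => k) (Icc 0 T) := continuousOn_const.integrableOn_Icc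
  have key : (fun t => f t - k) =ᵐ[vol T] 0 := by
    refine ae_eq_zero_of_integral_smul (hfi.sub hconst) fun g hg hc hs => ?_
    set J := ∫ t in (0 : ℝ)..T, g t with hJ
    -- Subtracting a multiple of the bump `ρ` gives a test function of mean zero, hence the
    -- derivative of a test function. Accordingly `k` is the `ρ`-average of `f`.
    have hθ : ContDiff ℝ ∞ fun t => g t - J / I * ρ t := hg.sub (contDiff_const.mul hρc)
    have hθsub : tsupport (fun t => g t - J / I * ρ t) ⊆ tsupport g ∪ tsupport ρ := by
      refine closure_minimal (fun t ht => ?_) ((isClosed_tsupport _).union (isClosed_tsupport _))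
      by_contra hn
      rw [mem_union, not_or] at hn
      exact ht (by simp [image_eq_zero_of_notMem_tsupport hn.1,
        image_eq_zero_of_notMem_tsupport hn.2])
    have hθc : HasCompactSupport fun t => g t - J / I * ρ t :=
      (hc.isCompact.union ρ.hasCompactSupport.isCompact).of_isClosed_subset (isClosed_tsupport _)
        hθsub
    obtain ⟨φ, hφ, hφc, hφs, hφd⟩ := exists_test_primitive hT hθ
      (hθsub.trans (union_subset hs hρs)) hθc (by
        rw [intervalIntegral.integral_sub (hg.continuous.intervalIntegrable _ _)
          ((hρc.continuous.const_mul _).intervalIntegrable _ _),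
          intervalIntegral.integral_const_mul, ← hI, ← hJ, div_mul_cancel₀ _ hIpos, sub_self])
    have h1 := h (fun t => (φ t : ℂ)) (Complex.ofRealCLM.contDiff.comp hφ)
      (hφc.comp_left (g := fun x : ℝ => (x : ℂ)) Complex.ofReal_zero)
      ((closure_mono (Function.support_comp_subset (g := fun x : ℝ => (x : ℂ))
        Complex.ofReal_zero φ)).trans hφs)
    have hd : ∀ t, deriv (fun t => (φ t : ℂ)) t = ((g t - J / I * ρ t : ℝ) : ℂ) := fun t =>
      (hφd t).ofReal_comp.deriv
    simp only [hd, Pi.zero_apply, zero_mul, integral_zero, neg_zero] at h1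
    have e1 : ∀ t, f t * ((g t - J / I * ρ t : ℝ) : ℂ) =
        g t • f t - ((J / I : ℝ) : ℂ) * (ρ t • f t) := by
      intro t
      simp only [Complex.real_smul]
      push_cast
      ring
    simp only [e1] at h1
    rw [integral_sub (hint hg.continuous hfi) ((hint hρc.continuous hfi).const_mul _),
      integral_const_mul] at h1
    simp only [smul_sub]
    rw [integral_sub (hint hg.continuous hfi) (hint hg.continuous hconst),
      integral_smul_const, integral_vol hT.le (fun t => g t), ← hJ, hk, Complex.real_smul]
    rw [← h1]
    push_cast
    ring
  filter_upwards [key] with t ht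
  exact sub_eq_zero.1 ht

/-- A function with square-integrable weak derivative is a primitive of it. -/
theorem IsWeakDeriv.exists_primitive (hT : 0 < T) (hf : MemLp f 2 (vol T)) (hg : MemLp g 2 (vol T))
    (h : IsWeakDeriv T f g) : ∃ k : ℂ, f =ᵐ[vol T] fun t => k + ∫ s in (0 : ℝ)..t, g s := by
  have hP := continuousOn_primitive_Icc hT.le (MemLp.intervalIntegrable hT.le hg)
  have hPm := memLp_of_continuousOn hP
  have h1 := isWeakDeriv_primitive hT.le hg
  obtain ⟨k, hk⟩ := ae_eq_const_of_weakDeriv_zero hT (hf.sub hPm) fun φ hφ hc hs => by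
    have hd : Continuous (deriv φ) := hφ.continuous_deriv (by simp)
    have i1 : IntegrableOn (fun t => f t * deriv φ t) (Icc 0 T) :=
      (show IntegrableOn f (Icc 0 T) volume from hf.integrable (by norm_num)).mul_continuousOn
        hd.continuousOn isCompact_Icc
    have i2 : IntegrableOn (fun t => (∫ s in (0 : ℝ)..t, g s) * deriv φ t) (Icc 0 T) :=
      (hP.mul hd.continuousOn).integrableOn_Icc
    simp only [Pi.sub_apply, sub_mul, Pi.zero_apply, zero_mul, integral_zero, neg_zero]
    rw [integral_sub i1 i2, h φ hφ hc hs, h1 φ hφ hc hs, sub_self]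
  refine ⟨k, ?_⟩
  filter_upwards [hk] with t ht
  rw [← ht, Pi.sub_apply, sub_add_cancel]

/-- The product rule: the smooth exponential is absorbed into the test function. -/
theorem IsWeakDeriv.exp_mul (a : ℂ) (hf : MemLp f 2 (vol T)) (hg : MemLp g 2 (vol T))
    (h : IsWeakDeriv T f g) : IsWeakDeriv T (fun t => Complex.exp (a * t) * f t)
      (fun t => Complex.exp (a * t) * g t + a * (Complex.exp (a * t) * f t)) := by
  intro φ hφ hc hs
  have hE : ContDiff ℝ ∞ fun t : ℝ => Complex.exp (a * t) :=
    (contDiff_const.mul Complex.ofRealCLM.contDiff).cexp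
  have hEd : ∀ t : ℝ, HasDerivAt (fun t : ℝ => Complex.exp (a * t)) (a * Complex.exp (a * t)) t := by
    intro t
    have h1 : HasDerivAt (fun t : ℝ => a * (t : ℂ)) a t := by
      simpa using (Complex.ofRealCLM.hasDerivAt (x := t)).const_mul a
    exact h1.cexp.congr_deriv (mul_comm _ _)
  have hsub : tsupport (fun t : ℝ => Complex.exp (a * t) * φ t) ⊆ tsupport φ :=
    closure_mono (Function.support_mul_subset_right _ _)
  have h1 := h (fun t => Complex.exp (a * t) * φ t) (hE.mul hφ) hc.mul_left (hsub.trans hs)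
  have hd : ∀ t : ℝ, deriv (fun t : ℝ => Complex.exp (a * t) * φ t) t =
      a * Complex.exp (a * t) * φ t + Complex.exp (a * t) * deriv φ t := fun t =>
    ((hEd t).mul ((hφ.differentiable (by simp)) t).hasDerivAt).deriv
  have hdc : Continuous (deriv φ) := hφ.continuous_deriv (by simp)
  have hint : ∀ {F : ℝ → ℂ}, MemLp F 2 (vol T) → ∀ {k : ℝ → ℂ}, Continuous k →
      IntegrableOn (fun t => F t * k t) (Icc 0 T) := fun hF k hk =>
    (show IntegrableOn _ (Icc 0 T) volume from hF.integrable (by norm_num)).mul_continuousOn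
      hk.continuousOn isCompact_Icc
  have c1 : Continuous fun t : ℝ => a * Complex.exp (a * t) * φ t :=
    (continuous_const.mul hE.continuous).mul hφ.continuous
  have c2 : Continuous fun t : ℝ => Complex.exp (a * t) * deriv φ t := hE.continuous.mul hdc
  have c3 : Continuous fun t : ℝ => Complex.exp (a * t) * φ t := hE.continuous.mul hφ.continuous
  simp only [hd, mul_add] at h1
  rw [integral_add (hint hf c1) (hint hf c2)] at h1
  have e1 : ∀ t : ℝ, (Complex.exp (a * t) * g t + a * (Complex.exp (a * t) * f t)) * φ t =
      g t * (Complex.exp (a * t) * φ t) + f t * (a * Complex.exp (a * t) * φ t) := fun t => by ring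
  have e2 : ∀ t : ℝ, Complex.exp (a * t) * f t * deriv φ t =
      f t * (Complex.exp (a * t) * deriv φ t) := fun t => by ring
  simp only [e1, e2]
  rw [integral_add (hint hg c3) (hint hf c1), neg_add, ← h1]
  ring

theorem memLp_exp_mul (a : ℂ) (hf : MemLp f 2 (vol T)) :
    MemLp (fun t : ℝ => Complex.exp (a * t) * f t) 2 (vol T) := by
  have hc : Continuous fun t : ℝ => Complex.exp (a * t) := by fun_prop
  obtain ⟨C, hC⟩ := (isCompact_Icc (a := (0 : ℝ)) (b := T)).exists_bound_of_continuousOn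
    hc.continuousOn
  refine MemLp.of_le_mul (c := C) hf (hc.aestronglyMeasurable.mul hf.1) ?_
  refine (ae_restrict_iff' measurableSet_Icc).2 (Eventually.of_forall fun t ht => ?_)
  rw [norm_mul]
  exact mul_le_mul_of_nonneg_right (hC t ht) (norm_nonneg _)

theorem MemH2.exp_mul {M : ℝ → ℂ} (a : ℂ) (hM : MemH2 T M) :
    MemH2 T fun t => Complex.exp (a * t) * M t := by
  obtain ⟨M₁, M₂, h0, h1, h2, d1, d2⟩ := hM
  have m0 := memLp_exp_mul a h0
  have m1 := memLp_exp_mul a h1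
  have m2 := memLp_exp_mul a h2
  refine ⟨fun t => Complex.exp (a * t) * M₁ t + a * (Complex.exp (a * t) * M t),
    fun t => (Complex.exp (a * t) * M₂ t + a * (Complex.exp (a * t) * M₁ t)) +
      a * (Complex.exp (a * t) * M₁ t + a * (Complex.exp (a * t) * M t)), m0,
    m1.add (m0.const_mul a), (m2.add (m1.const_mul a)).add ((m1.add (m0.const_mul a)).const_mul a),
    d1.exp_mul a h0 h1, fun φ hφ hc hs => ?_⟩
  have e1 := d2.exp_mul a h1 h2 φ hφ hc hs
  have e2 := d1.exp_mul a h0 h1 φ hφ hc hs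
  have hint : ∀ {F : ℝ → ℂ}, MemLp F 2 (vol T) → ∀ {k : ℝ → ℂ}, Continuous k →
      IntegrableOn (fun t => F t * k t) (Icc 0 T) := fun hF k hk =>
    (show IntegrableOn _ (Icc 0 T) volume from hF.integrable (by norm_num)).mul_continuousOn
      hk.continuousOn isCompact_Icc
  have hdc : Continuous (deriv φ) := hφ.continuous_deriv (by simp)
  have i1 := hint m1 hdc
  have i2 := (hint m0 hdc).const_mul a
  have i3 : IntegrableOn (fun t : ℝ => (Complex.exp (a * t) * M₂ t +
      a * (Complex.exp (a * t) * M₁ t)) * φ t) (Icc 0 T) :=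
    hint (m2.add (m1.const_mul a)) hφ.continuous
  have i4 : IntegrableOn (fun t : ℝ => a * ((Complex.exp (a * t) * M₁ t +
      a * (Complex.exp (a * t) * M t)) * φ t)) (Icc 0 T) :=
    (hint (m1.add (m0.const_mul a)) hφ.continuous).const_mul a
  have s1 : ∀ t : ℝ, (Complex.exp (a * t) * M₁ t + a * (Complex.exp (a * t) * M t)) * deriv φ t =
      Complex.exp (a * t) * M₁ t * deriv φ t + a * (Complex.exp (a * t) * M t * deriv φ t) :=
    fun t => by ring
  have s2 : ∀ t : ℝ, ((Complex.exp (a * t) * M₂ t + a * (Complex.exp (a * t) * M₁ t)) +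
      a * (Complex.exp (a * t) * M₁ t + a * (Complex.exp (a * t) * M t))) * φ t =
      (Complex.exp (a * t) * M₂ t + a * (Complex.exp (a * t) * M₁ t)) * φ t +
      a * ((Complex.exp (a * t) * M₁ t + a * (Complex.exp (a * t) * M t)) * φ t) :=
    fun t => by ring
  simp only [s1, s2]
  rw [integral_add i1 i2, integral_add i3 i4, integral_const_mul, integral_const_mul, e1, e2]
  ring

/-- Functions in `H²` have a continuously differentiable representative. -/
theorem MemH2.exists_repr (hT : 0 < T) {M : ℝ → ℂ} (hM : MemH2 T M) :
    ∃ (m m' κ : ℝ → ℂ) (a₀ b₀ : ℂ), M =ᵐ[vol T] m ∧ IsKernel T a₀ b₀ m m' κ := by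
  obtain ⟨M₁, M₂, h0, h1, h2, d1, d2⟩ := hM
  obtain ⟨a₀, ha⟩ := d1.exists_primitive hT h0 h1
  obtain ⟨b₀, hb⟩ := d2.exists_primitive hT h1 h2
  refine ⟨fun t => a₀ + ∫ s in (0 : ℝ)..t, M₁ s, fun t => b₀ + ∫ s in (0 : ℝ)..t, M₂ s,
    fun t => -M₂ t, a₀, b₀, ha, fun t ht => ?_, fun t _ => by simp, h2.neg⟩
  congr 1
  refine intervalIntegral.integral_congr_ae ?_
  filter_upwards [(ae_restrict_iff' measurableSet_Icc).1 hb] with s hs hst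
  rw [uIoc_of_le ht.1] at hst
  exact hs ⟨hst.1.le, hst.2.trans ht.2⟩

/-- The representative of an `H²` kernel, and the kernel after an exponential shift which removes
the first-order term. -/
theorem MemH2.exists_kernel (hT : 0 < T) {M : ℝ → ℂ} (hM : MemH2 T M) :
    ∃ (m μ μ' κ : ℝ → ℂ) (a₀ b₀ : ℂ), M =ᵐ[vol T] m ∧ ContinuousOn m (Icc 0 T) ∧
      IsKernel T a₀ b₀ μ μ' κ ∧ ∀ t ∈ Icc 0 T, μ t = Complex.exp (a₀ / 2 * t) * m t := by
  obtain ⟨m, m', κ₀, k₀, l₀, hMm, hm⟩ := hM.exists_repr hT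
  obtain ⟨μ, μ', κ, a₀, b₀, hμ, hK⟩ := (hM.exp_mul (k₀ / 2)).exists_repr hT
  have hmc := hm.continuousOn hT.le
  have hE : Continuous fun t : ℝ => Complex.exp (k₀ / 2 * t) := by fun_prop
  have h1 : EqOn μ (fun t => Complex.exp (k₀ / 2 * t) * m t) (Icc 0 T) := by
    refine Measure.eqOn_Icc_of_ae_eq volume hT.ne ?_ (hK.continuousOn hT.le)
      (hE.continuousOn.mul hmc)
    filter_upwards [hμ, hMm] with t ht ht'
    rw [← ht, ht']
  have h0 : (0 : ℝ) ∈ Icc 0 T := left_mem_Icc.2 hT.le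
  -- The exponential equals `1` at `0`, so the modified kernel starts at the same value. This makes
  -- the exponent `a₀ / 2` consistent with the initial value of the kernel it produces.
  have h2 : a₀ = k₀ := by
    have := h1 h0
    rw [hK.eq_primitive 0 h0] at this
    simpa [hm.eq_primitive 0 h0] using this
  subst h2
  exact ⟨m, μ, μ', κ, a₀, b₀, hMm, hmc, hK, h1⟩

end Sobolev

/-! ### Spectral decomposition of the operator -/

section Spectral

universe u

variable {H : Type u} [NormedAddCommGroup H] [InnerProductSpace ℂ H] [CompleteSpace H]
  {A : H →ₗ.[ℂ] H}

theorem graph_symm (hA : IsSelfAdjoint A) {u v f g : H} (h : (u, f) ∈ A.graph)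
    (h' : (v, g) ∈ A.graph) : ⟪f, v⟫_ℂ = ⟪u, g⟫_ℂ := by
  obtain ⟨u, rfl, rfl⟩ := (LinearPMap.mem_graph_iff A).1 h
  obtain ⟨v, rfl, rfl⟩ := (LinearPMap.mem_graph_iff A).1 h'
  have h1 := LinearPMap.adjoint_isFormalAdjoint hA.dense_domain
  rw [LinearPMap.isSelfAdjoint_def.1 hA] at h1
  exact h1 u v

theorem graph_lower {c : ℝ} (hc : ∀ u : A.domain, -c * ‖(u : H)‖ ^ 2 ≤ (⟪A u, (u : H)⟫_ℂ).re)
    {u f : H} (h : (u, f) ∈ A.graph) : -c * ‖u‖ ^ 2 ≤ (⟪f, u⟫_ℂ).re := by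
  obtain ⟨u, rfl, rfl⟩ := (LinearPMap.mem_graph_iff A).1 h
  exact hc u

/-- A semibounded self-adjoint operator with compact resolvent has a compact inverse after a
real shift. -/
theorem exists_compact_inverse {c : ℝ} (hR : HasCompactResolvent A)
    (hc : ∀ u : A.domain, -c * ‖(u : H)‖ ^ 2 ≤ (⟪A u, (u : H)⟫_ℂ).re) :
    ∃ S : H →L[ℂ] H, IsCompactOperator S ∧ (∀ f, (S f, f - ((c + 1 : ℝ) : ℂ) • S f) ∈ A.graph) ∧
      ∀ u f, (u, f) ∈ A.graph → S (f + ((c + 1 : ℝ) : ℂ) • u) = u := by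
  obtain ⟨z, R, ⟨hR1, hR2⟩, hRc⟩ := hR
  set k : ℂ := ((c + 1 : ℝ) : ℂ) with hk
  have hRg : ∀ f, (R f, f + z • R f) ∈ A.graph := fun f => by
    obtain ⟨h, he⟩ := hR1 f
    exact (LinearPMap.mem_graph_iff A).2 ⟨⟨R f, h⟩, rfl, sub_eq_iff_eq_add.1 he⟩
  -- Semiboundedness forbids the eigenvalue `-(c + 1)`, lying strictly below the lower bound `-c`.
  have hinj : ∀ u, (u, -(k • u)) ∈ A.graph → u = 0 := fun u hu => by
    have h1 := graph_lower hc hu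
    rw [inner_neg_left, inner_smul_left, inner_self_eq_norm_sq_to_K, hk, Complex.conj_ofReal] at h1
    have h2 : (-(((c + 1 : ℝ) : ℂ) * ((‖u‖ : ℝ) : ℂ) ^ 2)).re = -((c + 1) * ‖u‖ ^ 2) := by
      rw [← Complex.ofReal_pow, ← Complex.ofReal_mul, ← Complex.ofReal_neg, Complex.ofReal_re]
    have h3 : -c * ‖u‖ ^ 2 ≤ -((c + 1) * ‖u‖ ^ 2) := h1.trans_eq h2
    have h4 : ‖u‖ ^ 2 = 0 := by nlinarith [sq_nonneg ‖u‖]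
    simpa using h4
  have hinj' : ∀ f, f + (k + z) • R f = 0 → f = 0 := fun f hf => by
    have h1 := hRg f
    have h2 : f + z • R f = -(k • R f) := by
      rw [add_smul] at hf
      rw [eq_neg_iff_add_eq_zero, ← hf]
      abel
    rw [h2] at h1
    have h3 := hinj _ h1
    simpa [h3] using hf
  -- Fredholm alternative: formally `(A + k) R = 1 + (k + z) R`, and as `R` is compact, injectivity
  -- gives invertibility. The inverse of `A + k` is then `R (1 + (k + z) R)⁻¹`.
  have hunit : IsUnit (1 + (k + z) • R) := by
    by_cases h0 : k + z = 0
    · simp [h0]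
    have hν : -(k + z)⁻¹ ≠ 0 := neg_ne_zero.2 (inv_ne_zero h0)
    rcases hRc.hasEigenvalue_or_mem_resolventSet hν with h | h
    · obtain ⟨f, hf⟩ := h.exists_hasEigenvector
      have h1 : R f = -(k + z)⁻¹ • f := hf.apply_eq_smul
      refine absurd (hinj' f ?_) hf.2
      rw [h1, smul_smul, mul_neg, mul_inv_cancel₀ h0, neg_smul, one_smul, add_neg_cancel]
    · have h1 : IsUnit (algebraMap ℂ (H →L[ℂ] H) (-(k + z)⁻¹) - R) := h
      have h2 : 1 + (k + z) • R = (Units.mk0 (-(k + z)) (neg_ne_zero.2 h0)) •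
          (algebraMap ℂ (H →L[ℂ] H) (-(k + z)⁻¹) - R) := by
        rw [Units.smul_mk0, smul_sub, Algebra.algebraMap_eq_smul_one, smul_smul, neg_mul_neg,
          mul_inv_cancel₀ h0, one_smul, neg_smul, sub_neg_eq_add]
      rw [h2]
      exact h1.smul _
  obtain ⟨U, hU⟩ := hunit
  have hUr : ∀ f, (U⁻¹ : (H →L[ℂ] H)ˣ).1 f + (k + z) • R ((U⁻¹ : (H →L[ℂ] H)ˣ).1 f) = f := by
    intro f
    have h1 : (U.1 * (U⁻¹ : (H →L[ℂ] H)ˣ).1) f = f := by rw [Units.mul_inv]; rfl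
    rw [hU] at h1
    simpa using h1
  have hSg : ∀ f, (R ((U⁻¹ : (H →L[ℂ] H)ˣ).1 f), f - k • R ((U⁻¹ : (H →L[ℂ] H)ˣ).1 f)) ∈
      A.graph := by
    intro f
    have h1 := hRg ((U⁻¹ : (H →L[ℂ] H)ˣ).1 f)
    have h2 : f - k • R ((U⁻¹ : (H →L[ℂ] H)ˣ).1 f) =
        (U⁻¹ : (H →L[ℂ] H)ˣ).1 f + z • R ((U⁻¹ : (H →L[ℂ] H)ˣ).1 f) := by
      rw [sub_eq_iff_eq_add]
      nth_rewrite 1 [← hUr f]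
      rw [add_smul]
      abel
    rw [h2]
    exact h1
  refine ⟨R * (U⁻¹ : (H →L[ℂ] H)ˣ).1, hRc.comp_clm _, hSg, fun u f h => ?_⟩
  have h1 := A.graph.sub_mem (hSg (f + k • u)) h
  rw [Prod.mk_sub_mk] at h1
  have h2 : f + k • u - k • R ((U⁻¹ : (H →L[ℂ] H)ˣ).1 (f + k • u)) - f =
      -(k • (R ((U⁻¹ : (H →L[ℂ] H)ˣ).1 (f + k • u)) - u)) := by
    rw [smul_sub]; abel
  rw [h2] at h1
  exact sub_eq_zero.1 (hinj _ h1)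

/-- An orthonormal basis of eigenvectors of a semibounded operator, with finitely many eigenvalues
below any bound. -/
structure IsEigenbasis {ι : Type*} (A : H →ₗ.[ℂ] H) (c : ℝ) (e : HilbertBasis ι ℂ H)
    (lam : ι → ℝ) : Prop where
  mem_graph : ∀ i, (e i, (lam i : ℂ) • e i) ∈ A.graph
  lower : ∀ i, -c ≤ lam i
  finite : ∀ R, {i | lam i ≤ R}.Finite
  symm : ∀ i u f, (u, f) ∈ A.graph → ⟪e i, f⟫_ℂ = lam i * ⟪e i, u⟫_ℂ

theorem HilbertBasis.eq_zero_of_inner {ι : Type*} (e : HilbertBasis ι ℂ H) {x : H}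
    (h : ∀ i, ⟪e i, x⟫_ℂ = 0) : x = 0 := by
  have h1 := e.hasSum_repr x
  simp only [e.repr_apply_apply, h, zero_smul] at h1
  exact h1.unique hasSum_zero

/-- The spectral theorem for compact symmetric operators, with Hilbert bases of all eigenspaces
glued together. The kernel of `S` is included, which is why the eigenspaces get Hilbert bases and
not finite ones. -/
theorem exists_eigenbasis_of_compact (S : H →L[ℂ] H) (hS : IsCompactOperator S)
    (hsym : (S : H →ₗ[ℂ] H).IsSymmetric) :
    ∃ (ι : Type u) (e : HilbertBasis ι ℂ H) (ν : ι → ℂ), ∀ i, S (e i) = ν i • e i := by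
  set V : ℂ → Submodule ℂ H := fun ν => Module.End.eigenspace (S : H →ₗ[ℂ] H) ν with hV
  have hcl : ∀ ν, IsClosed (V ν : Set H) := fun ν => by
    have : (V ν : Set H) = {u | S u = ν • u} := by
      ext u
      exact Module.End.mem_eigenspace_iff
    rw [this]
    exact isClosed_eq S.continuous (continuous_const_smul ν)
  have hcomp : ∀ ν, CompleteSpace (V ν) := fun ν => (hcl ν).completeSpace_coe
  choose w b hb using fun ν => exists_hilbertBasis ℂ (V ν)
  have hof : OrthogonalFamily ℂ (fun ν => V ν) fun ν => (V ν).subtypeₗᵢ :=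
    hsym.orthogonalFamily_eigenspaces
  have hon := hof.orthonormal_sigma_orthonormal fun ν => (b ν).orthonormal
  have hbot : (Submodule.span ℂ (range fun a : Σ ν, w ν => (V a.1).subtypeₗᵢ (b a.1 a.2)))ᗮ = ⊥ := by
    rw [eq_bot_iff, ← ContinuousLinearMap.orthogonalComplement_iSup_eigenspaces_eq_bot hS hsym]
    intro x hx
    rw [Submodule.mem_orthogonal] at hx
    have hxb : ∀ (ν : ℂ) (j : w ν), ⟪((b ν j : V ν) : H), x⟫_ℂ = 0 := fun ν j =>
      hx _ (Submodule.subset_span ⟨⟨ν, j⟩, rfl⟩)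
    rw [← Submodule.iInf_orthogonal, Submodule.mem_iInf]
    intro ν
    rw [Submodule.mem_orthogonal]
    intro v hv
    have h1 := ((b ν).hasSum_repr ⟨v, hv⟩).mapL (V ν).subtypeL
    have h2 := (h1.mapL (innerSL ℂ x))
    have h3 : ∀ j, innerSL ℂ x ((V ν).subtypeL ((b ν).repr ⟨v, hv⟩ j • b ν j)) = 0 := fun j => by
      rw [map_smul, map_smul, innerSL_apply_apply, Submodule.subtypeL_apply,
        inner_eq_zero_symm.1 (hxb ν j), smul_zero]
    simp only [h3] at h2
    exact inner_eq_zero_symm.1 (h2.unique hasSum_zero)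
  refine ⟨Σ ν, w ν, HilbertBasis.mkOfOrthogonalEqBot hon hbot, fun a => a.1, fun a => ?_⟩
  rw [HilbertBasis.coe_mkOfOrthogonalEqBot]
  exact Module.End.mem_eigenspace_iff.1 (b a.1 a.2).2

/-- The compact inverse `S` of `A + (c + 1)` is diagonalised, and an eigenvalue `ν` of `S`
corresponds to `ν⁻¹ - (c + 1)`, which is real by symmetry. -/
theorem AssumptionA.exists_isEigenbasis (hA : AssumptionA A) :
    ∃ (ι : Type u) (e : HilbertBasis ι ℂ H) (lam : ι → ℝ) (c : ℝ), 0 < c ∧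
      IsEigenbasis A c e lam := by
  obtain ⟨c, hc, hsb⟩ := hA.semibounded
  obtain ⟨S, hS, hSg, hSi⟩ := exists_compact_inverse hA.compactResolvent hsb
  set k : ℂ := ((c + 1 : ℝ) : ℂ) with hk
  have hsa := hA.selfAdjoint
  have hsym : (S : H →ₗ[ℂ] H).IsSymmetric := by
    intro f g
    have h1 := graph_symm hsa (hSg f) (hSg g)
    rw [inner_sub_left, inner_sub_right, inner_smul_left, inner_smul_right, hk,
      Complex.conj_ofReal, sub_left_inj] at h1
    exact h1.symm
  obtain ⟨ι, e, ν, hν⟩ := exists_eigenbasis_of_compact S hS hsym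
  have hne : ∀ i, e i ≠ 0 := fun i => e.orthonormal.ne_zero i
  have hne1 : ∀ i, ‖e i‖ = 1 := fun i => e.orthonormal.1 i
  -- A zero eigenvalue would put `(0, e i)` into the graph of `A`.
  have hν0 : ∀ i, ν i ≠ 0 := fun i h0 => by
    have h1 := hSg (e i)
    rw [hν, h0, zero_smul, smul_zero, sub_zero] at h1
    exact hne i (LinearPMap.mem_graph_snd_inj A h1 A.graph.zero_mem rfl)
  have hg : ∀ i, (e i, ((ν i)⁻¹ - k) • e i) ∈ A.graph := fun i => by
    have h1 := A.graph.smul_mem (ν i)⁻¹ (hSg (e i))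
    rw [hν, Prod.smul_mk, smul_smul, inv_mul_cancel₀ (hν0 i), one_smul, smul_sub, smul_smul,
      smul_smul, mul_right_comm, inv_mul_cancel₀ (hν0 i), one_mul, ← sub_smul] at h1
    exact h1
  have hreal : ∀ i, ((((ν i)⁻¹ - k).re : ℝ) : ℂ) = (ν i)⁻¹ - k := fun i => by
    have h1 := graph_symm hsa (hg i) (hg i)
    rw [inner_smul_left, inner_smul_right, inner_self_eq_norm_sq_to_K, hne1] at h1
    exact Complex.conj_eq_iff_re.1 (by simpa using h1)
  set lam : ι → ℝ := fun i => ((ν i)⁻¹ - k).re with hlam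
  have hmem : ∀ i, (e i, (lam i : ℂ) • e i) ∈ A.graph := fun i => by rw [hreal i]; exact hg i
  have hlow : ∀ i, -c ≤ lam i := fun i => by
    have h1 := graph_lower hsb (hmem i)
    rw [inner_smul_left, inner_self_eq_norm_sq_to_K, hne1, Complex.conj_ofReal] at h1
    simpa using h1
  refine ⟨ι, e, lam, c, hc, hmem, hlow, fun R => ?_, fun i u f h => ?_⟩
  -- Infinitely many eigenvalues below `R` would give an orthonormal sequence whose images under `S`
  -- have norms bounded below. By compactness a subsequence of the images converges, and its limit
  -- is zero since all its coefficients are.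
  · by_contra hinf
    have hinf : {i | lam i ≤ R}.Infinite := hinf
    set φ : ℕ ↪ {i | lam i ≤ R} := hinf.natEmbedding
    have hSe : ∀ i, ‖S (e i)‖ = 1 / (lam i + (c + 1)) := fun i => by
      have h2 : 0 < lam i + (c + 1) := by linarith [hlow i]
      have h1 := hSi _ _ (hmem i)
      rw [← add_smul, hk, ← Complex.ofReal_add, map_smul] at h1
      have h3 := congrArg norm h1
      rw [norm_smul, hne1, Complex.norm_real, Real.norm_eq_abs, abs_of_pos h2] at h3
      rw [eq_div_iff h2.ne', mul_comm, h3]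
    obtain ⟨K, hK, hSK⟩ := hS.image_closedBall_subset_compact 1
    obtain ⟨y, -, ψ, hψ, hy⟩ := hK.tendsto_subseq (x := fun n => S (e (φ n))) fun n =>
      hSK ⟨e (φ n), by simp [hne1], rfl⟩
    have hy0 : y = 0 := by
      refine HilbertBasis.eq_zero_of_inner e fun j => ?_
      have h1 : Tendsto (fun n => ⟪e j, S (e (φ (ψ n)))⟫_ℂ) atTop (𝓝 ⟪e j, y⟫_ℂ) :=
        ((continuous_const.inner continuous_id).tendsto y).comp hy
      refine tendsto_nhds_unique h1 (tendsto_const_nhds.congr' ?_)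
      have hinj : Function.Injective fun n => (φ (ψ n) : ι) :=
        Subtype.val_injective.comp (φ.injective.comp hψ.injective)
      have h2 : ∀ᶠ n in atTop, (φ (ψ n) : ι) ≠ j := by
        have h3 : {n | (φ (ψ n) : ι) = j}.Finite :=
          Set.Subsingleton.finite fun a ha b hb => hinj (ha.trans hb.symm)
        have h4 := h3.eventually_cofinite_notMem
        rw [Nat.cofinite_eq_atTop] at h4
        exact h4
      filter_upwards [h2] with n hn
      rw [hν, inner_smul_right, e.orthonormal.2 hn.symm, mul_zero]
    have hR : ∀ n, 1 / (|R| + (c + 1)) ≤ ‖S (e (φ (ψ n)))‖ := fun n => by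
      rw [hSe]
      have h1 : lam (φ (ψ n)) ≤ R := (φ (ψ n)).2
      have h2 := hlow (φ (ψ n))
      exact one_div_le_one_div_of_le (by linarith) (by linarith [le_abs_self R])
    have h3 := ge_of_tendsto' hy.norm hR
    rw [hy0, norm_zero] at h3
    have : 0 < 1 / (|R| + (c + 1)) := by positivity
    linarith
  · have h1 := graph_symm hsa (hmem i) h
    rw [inner_smul_left, Complex.conj_ofReal] at h1
    exact h1.symm

end Spectral

/-! ### The energy norm in coordinates -/

section Energy

variable {ι H : Type*} [NormedAddCommGroup H] [InnerProductSpace ℂ H] [CompleteSpace H]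
  {A : H →ₗ.[ℂ] H} {c : ℝ} {e : HilbertBasis ι ℂ H} {lam : ι → ℝ}

theorem HilbertBasis.hasSum_sq_norm (e : HilbertBasis ι ℂ H) (x : H) :
    HasSum (fun i => ‖⟪e i, x⟫_ℂ‖ ^ 2) (‖x‖ ^ 2) := by
  have h1 := (lp_summable_sq (e.repr x)).hasSum
  rw [← lp_sq_norm, LinearIsometryEquiv.norm_map] at h1
  simpa only [e.repr_apply_apply] using h1

theorem IsEigenbasis.inner_of_mem_closure (h : IsEigenbasis A c e lam) {μ : ℝ} {u : H}
    (hu : u ∈ (eigenspace A μ).topologicalClosure) {i : ι} (hi : lam i ≠ μ) : ⟪e i, u⟫_ℂ = 0 := by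
  have hcl : IsClosed {u : H | ⟪e i, u⟫_ℂ = 0} :=
    isClosed_eq (continuous_const.inner continuous_id) continuous_const
  refine closure_minimal (fun v hv => ?_) hcl hu
  have h1 := h.symm i v ((μ : ℂ) • v) hv
  rw [inner_smul_right] at h1
  by_contra h0
  have h2 : (μ : ℂ) = lam i := mul_right_cancel₀ h0 h1
  exact hi (by exact_mod_cast h2.symm)

/-- The basis vectors with eigenvalue `μ`, finite in number, span the range of the projection,
because every other basis vector is orthogonal to the eigenspace. This links the basis-free
definition of H¹ with the coefficients. -/
theorem IsEigenbasis.sq_norm_eigenproj (h : IsEigenbasis A c e lam) (μ : ℝ) (x : H) :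
    ‖eigenproj A μ x‖ ^ 2 = ∑' i : {i // lam i = μ}, ‖⟪e i, x⟫_ℂ‖ ^ 2 := by
  have hf : Finite {i // lam i = μ} :=
    ((h.finite μ).subset fun i (hi : lam i = μ) => hi.le).to_subtype
  have := Fintype.ofFinite {i // lam i = μ}
  set p : H := ∑ i : {i // lam i = μ}, ⟪e i, x⟫_ℂ • e i with hp
  have hon : Orthonormal ℂ fun i : {i // lam i = μ} => e i :=
    e.orthonormal.comp _ Subtype.val_injective
  have hmem : p ∈ eigenspace A μ := by
    refine Submodule.sum_mem _ fun i _ => Submodule.smul_mem _ _ ?_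
    have := h.mem_graph i
    rw [i.2] at this
    exact this
  have hproj : eigenproj A μ x = p := by
    refine Submodule.eq_starProjection_of_mem_of_inner_eq_zero
      (Submodule.le_topologicalClosure _ hmem) fun u hu => ?_
    refine (e.hasSum_inner_mul_inner (x - p) u).unique ?_
    convert hasSum_zero using 2 with i
    by_cases hi : lam i = μ
    · have h1 : ⟪e i, p⟫_ℂ = ⟪e i, x⟫_ℂ := by
        have := hon.inner_right_fintype (fun j => ⟪e j, x⟫_ℂ) ⟨i, hi⟩
        exact this
      rw [inner_eq_zero_symm.1 (show ⟪e i, x - p⟫_ℂ = 0 by rw [inner_sub_right, h1, sub_self]),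
        zero_mul]
    · rw [h.inner_of_mem_closure hu hi, mul_zero]
  rw [hproj, tsum_fintype, hp]
  have h1 := hon.inner_sum (fun j => ⟪e j, x⟫_ℂ) (fun j => ⟪e j, x⟫_ℂ) Finset.univ
  rw [inner_self_eq_norm_sq_to_K] at h1
  have h2 : ((‖∑ i : {i // lam i = μ}, ⟪e i, x⟫_ℂ • e i‖ ^ 2 : ℝ) : ℂ) =
      ((∑ i : {i // lam i = μ}, ‖⟪e i, x⟫_ℂ‖ ^ 2 : ℝ) : ℂ) := by
    push_cast
    refine h1.trans (Finset.sum_congr rfl fun i _ => ?_)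
    exact Complex.conj_mul' _
  exact_mod_cast h2

/-- Group the nonnegative series over the basis by the fibres of `lam`; each fibre sum is one term
of the defining series. -/
theorem IsEigenbasis.memH1_iff (h : IsEigenbasis A c e lam) (x : H) :
    MemH1 A x ↔ Summable fun i => |lam i| * ‖⟪e i, x⟫_ℂ‖ ^ 2 := by
  rw [← (Equiv.sigmaFiberEquiv lam).summable_iff,
    summable_sigma_of_nonneg fun a => by simp only [Function.comp_apply]; positivity]
  have h1 : ∀ μ : ℝ, ∑' i : {i // lam i = μ}, |lam i| * ‖⟪e i, x⟫_ℂ‖ ^ 2 =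
      |μ| * ‖eigenproj A μ x‖ ^ 2 := fun μ => by
    rw [h.sq_norm_eigenproj, ← tsum_mul_left]
    exact tsum_congr fun i => by rw [i.2]
  have h2 : ∀ μ : ℝ, Summable fun i : {i // lam i = μ} => |lam i| * ‖⟪e i, x⟫_ℂ‖ ^ 2 := fun μ => by
    have hf : Finite {i // lam i = μ} :=
      ((h.finite μ).subset fun i (hi : lam i = μ) => hi.le).to_subtype
    exact Summable.of_finite
  constructor
  · exact fun hx => ⟨h2, hx.congr fun μ => (h1 μ).symm⟩
  · exact fun hx => hx.2.congr fun μ => h1 μ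

theorem IsEigenbasis.absSqrtNormSq_eq (h : IsEigenbasis A c e lam) {x : H} (hx : MemH1 A x) :
    absSqrtNormSq A x = ∑' i, |lam i| * ‖⟪e i, x⟫_ℂ‖ ^ 2 := by
  have hs := (h.memH1_iff x).1 hx
  have hs' : Summable fun p => |lam (Equiv.sigmaFiberEquiv lam p)| *
      ‖⟪e (Equiv.sigmaFiberEquiv lam p), x⟫_ℂ‖ ^ 2 :=
    (Equiv.sigmaFiberEquiv lam).summable_iff.2 hs
  rw [← (Equiv.sigmaFiberEquiv lam).tsum_eq fun i => |lam i| * ‖⟪e i, x⟫_ℂ‖ ^ 2, hs'.tsum_sigma]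
  refine tsum_congr fun μ => ?_
  rw [h.sq_norm_eigenproj, ← tsum_mul_left]
  refine tsum_congr fun i => ?_
  rw [show (Equiv.sigmaFiberEquiv lam) ⟨μ, i⟩ = i.1 from rfl, i.2]

theorem IsEigenbasis.hasSum_energyNorm (h : IsEigenbasis A c e lam) {x : H} (hx : MemH1 A x)
    (y : H) : HasSum (fun i => (1 + |lam i|) * ‖⟪e i, x⟫_ℂ‖ ^ 2 + ‖⟪e i, y⟫_ℂ‖ ^ 2)
      (energyNorm A x y ^ 2) := by
  have h1 := (HilbertBasis.hasSum_sq_norm e x).add ((h.memH1_iff x).1 hx).hasSum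
  have h2 := h1.add (HilbertBasis.hasSum_sq_norm e y)
  rw [← h.absSqrtNormSq_eq hx] at h2
  have h3 : 0 ≤ absSqrtNormSq A x := tsum_nonneg fun μ => by positivity
  rw [energyNorm, Real.sq_sqrt (by positivity)]
  exact h2.congr_fun fun i => by ring

theorem one_add_abs_le {c l : ℝ} (hc : 0 ≤ c) (hl : -c ≤ l) : 1 + |l| ≤ (1 + c) * wt c l := by
  unfold wt
  rcases abs_cases l with h | h <;> nlinarith

theorem wt_le {c l : ℝ} (hc : 0 ≤ c) : wt c l ≤ (1 + c) * (1 + |l|) := by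
  unfold wt
  nlinarith [le_abs_self l, abs_nonneg l]

end Energy

/-! ### From the abstract observability assumption to estimates for coefficients -/

section Observation

variable {ι H G : Type*} [NormedAddCommGroup H] [InnerProductSpace ℂ H] [CompleteSpace H]
  [NormedAddCommGroup G] [InnerProductSpace ℂ G] [CompleteSpace G]
  {A : H →ₗ.[ℂ] H} {B : H →ₗ.[ℂ] G} {c : ℝ} {e : HilbertBasis ι ℂ H} {lam : ι → ℝ}

theorem ae_eq_of_integral_eq {T : ℝ} (hT : 0 ≤ T) {f g : ℝ → G} (hf : IntegrableOn f (Icc 0 T))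
    (hg : IntegrableOn g (Icc 0 T))
    (h : ∀ t ∈ Icc 0 T, ∫ s in (0 : ℝ)..t, f s = ∫ s in (0 : ℝ)..t, g s) : f =ᵐ[vol T] g := by
  have hfI := (intervalIntegrable_iff_integrableOn_Icc_of_le hT).2 hf
  have hgI := (intervalIntegrable_iff_integrableOn_Icc_of_le hT).2 hg
  have hne : ∀ᵐ t : ℝ ∂volume, t ≠ 0 ∧ t ≠ T := by
    have h0 : ∀ᵐ t : ℝ ∂volume, t ≠ 0 := by simp [ae_iff]
    have h1 : ∀ᵐ t : ℝ ∂volume, t ≠ T := by simp [ae_iff]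
    filter_upwards [h0, h1] with t a b using ⟨a, b⟩
  refine (ae_restrict_iff' measurableSet_Icc).2 ?_
  filter_upwards [hfI.ae_hasDerivAt_integral, hgI.ae_hasDerivAt_integral, hne] with t h1 h2 h3 ht
  have hmem : t ∈ uIcc 0 T := by rwa [uIcc_of_le hT]
  have d1 := h1 hmem 0 left_mem_uIcc
  have d2 := h2 hmem 0 left_mem_uIcc
  refine d1.unique (d2.congr_of_eventuallyEq ?_)
  filter_upwards [Icc_mem_nhds (lt_of_le_of_ne ht.1 (Ne.symm h3.1)) (lt_of_le_of_ne ht.2 h3.2)]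
    with r hr using h r hr

theorem exists_sw_ne_zero {T : ℝ} (hT : 0 < T) (l : ℝ) : ∃ t ∈ Icc 0 T, sw l t ≠ 0 := by
  by_contra! hcon
  have h0 : (0 : ℝ) ∈ Icc 0 T := left_mem_Icc.2 hT.le
  have h1 : HasDerivWithinAt (sw l) 0 (Icc 0 T) 0 :=
    (hasDerivWithinAt_const 0 _ (0 : ℂ)).congr hcon (hcon 0 h0)
  have h2 := (uniqueDiffOn_Icc hT 0 h0).eq_deriv _ h1 (sw_hasDerivAt l 0).hasDerivWithinAt
  rw [cw_zero] at h2
  exact zero_ne_one h2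

theorem inner_basis_sum (e : HilbertBasis ι ℂ H) (s : Finset ι) (x : ι → ℂ) (i : ι) :
    ⟪e i, ∑ j ∈ s, x j • e j⟫_ℂ = (s : Set ι).indicator x i := by
  classical
  rw [indicator_apply]
  split_ifs with hi
  · exact e.orthonormal.inner_right_sum x hi
  · rw [inner_sum]
    refine Finset.sum_eq_zero fun j hj => ?_
    have hij : i ≠ j := by rintro rfl; exact hi (Finset.mem_coe.2 hj)
    rw [inner_smul_right, e.orthonormal.2 hij, mul_zero]

theorem IsEigenbasis.memH1_sum (h : IsEigenbasis A c e lam) (s : Finset ι) (x : ι → ℂ) :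
    MemH1 A (∑ i ∈ s, x i • e i) := by
  rw [h.memH1_iff]
  refine summable_of_ne_finset_zero (s := s) fun i hi => ?_
  rw [inner_basis_sum, indicator_of_notMem (by exact_mod_cast hi), norm_zero,
    zero_pow two_ne_zero, mul_zero]

theorem IsEigenbasis.energyNorm_sum (h : IsEigenbasis A c e lam) (s : Finset ι) (x y : ι → ℂ) :
    energyNorm A (∑ i ∈ s, x i • e i) (∑ i ∈ s, y i • e i) ^ 2 =
      ∑ i ∈ s, ((1 + |lam i|) * ‖x i‖ ^ 2 + ‖y i‖ ^ 2) := by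
  refine (h.hasSum_energyNorm (h.memH1_sum s x) _).unique ?_
  have h1 : HasSum (fun i => (1 + |lam i|) * ‖⟪e i, ∑ i ∈ s, x i • e i⟫_ℂ‖ ^ 2 +
      ‖⟪e i, ∑ i ∈ s, y i • e i⟫_ℂ‖ ^ 2) (∑ i ∈ s, ((1 + |lam i|) *
      ‖⟪e i, ∑ i ∈ s, x i • e i⟫_ℂ‖ ^ 2 + ‖⟪e i, ∑ i ∈ s, y i • e i⟫_ℂ‖ ^ 2)) :=
    hasSum_sum_of_ne_finset_zero fun i hi => by
      rw [inner_basis_sum, inner_basis_sum,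
        indicator_of_notMem (by exact_mod_cast hi), indicator_of_notMem (by exact_mod_cast hi)]
      simp
  convert h1 using 1
  refine Finset.sum_congr rfl fun i hi => ?_
  rw [inner_basis_sum, inner_basis_sum,
    indicator_of_mem (by exact_mod_cast hi), indicator_of_mem (by exact_mod_cast hi)]

/-- Finite sums of free modes solve the memoryless equation. -/
theorem IsEigenbasis.isSolution_free (h : IsEigenbasis A c e lam) (T : ℝ) (s : Finset ι)
    (x y : ι → ℂ) : IsSolution A 0 T (∑ i ∈ s, x i • e i) (∑ i ∈ s, y i • e i)
      (vs s (fun i => free (lam i) (x i) (y i)) e) := by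
  refine ⟨vs s (fun i => free (lam i) (y i) (-lam i * x i)) e, fun t _ => ?_,
    (vs_free_continuous s _ _).continuousOn, ?_, ?_, fun v t _ => ?_⟩
  · exact (HasDerivAt.fun_sum fun i _ =>
      (free_hasDerivAt (lam i) (x i) (y i) t).smul_const (e i)).hasDerivWithinAt
  · simp only [vs, free_zero]
  · simp only [vs, free_zero]
  · have h1 : HasDerivAt (fun r => ⟪(v : H), vs s (fun i => free (lam i) (y i) (-lam i * x i)) e r⟫_ℂ)
        (∑ i ∈ s, free (lam i) (-lam i * x i) (-lam i * y i) t * ⟪(v : H), e i⟫_ℂ) t := by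
      simp only [vs, inner_sum, inner_smul_right]
      exact HasDerivAt.fun_sum fun i _ => (free_hasDerivAt _ _ _ t).mul_const _
    refine h1.hasDerivWithinAt.congr_deriv ?_
    simp only [Pi.zero_apply, zero_mul, intervalIntegral.integral_zero, add_zero, vs, inner_sum,
      inner_smul_right]
    rw [← Finset.sum_neg_distrib]
    refine Finset.sum_congr rfl fun i _ => ?_
    have h2 : ⟪A v, e i⟫_ℂ = lam i * ⟪(v : H), e i⟫_ℂ := by
      rw [← inner_conj_symm, h.symm i v (A v) (A.mem_graph v), map_mul, Complex.conj_ofReal,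
        inner_conj_symm]
    rw [h2, free, free]
    ring

/-- That eigenvectors lie in the domain of `B` is deduced from the observation of the single mode
`cw · e i`: its time integral `sw t • e i` lies in the domain, and `t` can be chosen with `sw t ≠
0`. -/
theorem AssumptionB.exists_eigenvector_obs {T₀ : ℝ} (hB : AssumptionB A B T₀)
    (h : IsEigenbasis A c e lam) : ∃ b : ι → G, ∀ i, (e i, b i) ∈ B.graph := by
  classical
  suffices ∀ i, ∃ b, (e i, b) ∈ B.graph from ⟨fun i => (this i).choose, fun i => (this i).choose_spec⟩
  intro i
  obtain ⟨C, hC, hobs⟩ := hB.obsReg (T₀ + 1) (by linarith)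
  obtain ⟨Y, hY, -⟩ := hobs _ _ _ (h.memH1_sum {i} fun _ => 1)
    (h.isSolution_free (T₀ + 1) {i} (fun _ => 1) fun _ => 0)
  obtain ⟨t, ht, hs⟩ := exists_sw_ne_zero (by linarith [hB.nonneg] : 0 < T₀ + 1) (lam i)
  have h1 := hY t ht
  have h2 : ∫ r in (0 : ℝ)..t, vs {i} (fun i => free (lam i) 1 0) e r = sw (lam i) t • e i := by
    rw [integral_vs fun j => (free_continuous _ _ _).intervalIntegrable _ _, Finset.sum_singleton,
      sw_eq_integral, zero_add]
    simp [free]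
  rw [h2] at h1
  have h3 := B.graph.smul_mem (sw (lam i) t)⁻¹ h1
  rw [Prod.smul_mk, smul_smul, inv_mul_cancel₀ hs, one_smul] at h3
  exact ⟨_, h3⟩

/-- For finite sums the observation must be the obvious one, as `B` is single-valued and a function
is determined almost everywhere by its integrals. The factor `1 + c` compares the weights `1 + |λ|`
and `λ + c + 1`. -/
theorem AssumptionB.freeObs {T₀ : ℝ} (hB : AssumptionB A B T₀) (hc : 0 ≤ c)
    (h : IsEigenbasis A c e lam) {b : ι → G} (hb : ∀ i, (e i, b i) ∈ B.graph) {T : ℝ}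
    (hT : T₀ < T) : FreeObs c lam b T := by
  have hT0 : 0 < T := hB.nonneg.trans_lt hT
  obtain ⟨C, hC, hobs⟩ := hB.obsReg T hT
  refine ⟨(1 + c) * C ^ 2, by positivity, fun s x y => ?_⟩
  obtain ⟨Y, hY, hlow, hup⟩ := hobs _ _ _ (h.memH1_sum s x) (h.isSolution_free T s x y)
  have hae : Y =ᵐ[vol T] vs s (fun i => free (lam i) (x i) (y i)) b := by
    refine ae_eq_of_integral_eq hT0.le ((Lp.memLp Y).integrable (by norm_num))
      (vs_free_continuous s x y).continuousOn.integrableOn_Icc fun t ht => ?_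
    have h1 := hY t ht
    have hi : ∀ i, IntervalIntegrable (free (lam i) (x i) (y i)) volume 0 t := fun i =>
      (free_continuous _ _ _).intervalIntegrable _ _
    have h2 : (∑ i ∈ s, (∫ r in (0 : ℝ)..t, free (lam i) (x i) (y i) r) • e i,
        ∑ i ∈ s, (∫ r in (0 : ℝ)..t, free (lam i) (x i) (y i) r) • b i) ∈ B.graph := by
      have := B.graph.sum_mem fun i (_ : i ∈ s) =>
        B.graph.smul_mem (∫ r in (0 : ℝ)..t, free (lam i) (x i) (y i) r) (hb i)
      convert this using 1
      exact Prod.ext (by simp [Prod.fst_sum]) (by simp [Prod.snd_sum])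
    rw [integral_vs hi] at h1 ⊢
    exact LinearPMap.mem_graph_snd_inj B h1 h2 rfl
  have hY2 : nsq T (vs s (fun i => free (lam i) (x i) (y i)) b) = ‖Y‖ ^ 2 := by
    rw [← nsq_congr_ae hae, sq_norm_eq_nsq]
  have hen := h.energyNorm_sum s x y
  set N := energyNorm A (∑ i ∈ s, x i • e i) (∑ i ∈ s, y i • e i)
  have hN : 0 ≤ N := Real.sqrt_nonneg _
  have h1 : energy c lam s x y ≤ (1 + c) * N ^ 2 := by
    rw [hen, energy, Finset.mul_sum]
    refine Finset.sum_le_sum fun i _ => ?_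
    have h2 := mul_le_mul_of_nonneg_right (wt_le (l := lam i) hc) (sq_nonneg ‖x i‖)
    have h3 : 0 ≤ c * ‖y i‖ ^ 2 := by positivity
    linarith
  have h2 : N ^ 2 ≤ (1 + c) * energy c lam s x y := by
    rw [hen, energy, Finset.mul_sum]
    refine Finset.sum_le_sum fun i _ => ?_
    have h2 := mul_le_mul_of_nonneg_right (one_add_abs_le hc (h.lower i)) (sq_nonneg ‖x i‖)
    have h3 : 0 ≤ c * ‖y i‖ ^ 2 := by positivity
    linarith
  rw [hY2]
  constructor
  · rw [inv_mul_le_iff₀ hC] at hlow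
    have h3 := pow_le_pow_left₀ hN hlow 2
    rw [mul_pow] at h3
    refine h1.trans ?_
    rw [mul_assoc]
    exact mul_le_mul_of_nonneg_left h3 (by linarith)
  · have h3 := pow_le_pow_left₀ (norm_nonneg _) hup 2
    rw [mul_pow] at h3
    have h4 := mul_le_mul_of_nonneg_left h2 (sq_nonneg C)
    linarith

end Observation

/-! ### Scalar modes of the original equation -/

section MemoryMode

/-- `U` solves `U'' + λ U = λ (m * U)` on `[0, T]`, and `V` is its derivative. -/
structure IsMemoryMode (T : ℝ) (m : ℝ → ℂ) (lam : ℝ) (U V : ℝ → ℂ) : Prop where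
  hasDeriv : ∀ t ∈ Icc 0 T, HasDerivWithinAt U (V t) (Icc 0 T) t
  hasDeriv₂ : ∀ t ∈ Icc 0 T, HasDerivWithinAt V (-lam * (U t - conv m U t)) (Icc 0 T) t

theorem eq_add_integral_of_hasDerivWithinAt {T : ℝ} {F F' : ℝ → ℂ}
    (hF' : ContinuousOn F' (Icc 0 T))
    (hF : ∀ t ∈ Icc 0 T, HasDerivWithinAt F (F' t) (Icc 0 T) t) {t : ℝ} (ht : t ∈ Icc 0 T) :
    F t = F 0 + ∫ s in (0 : ℝ)..t, F' s := by
  have hsub : Icc 0 t ⊆ Icc 0 T := Icc_subset_Icc_right ht.2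
  rw [intervalIntegral.integral_eq_sub_of_hasDerivAt_of_le ht.1
    (fun s hs => ((hF s (hsub hs)).continuousWithinAt).mono hsub)
    (fun s hs => (hF s ⟨hs.1.le, hs.2.le.trans ht.2⟩).hasDerivAt
      (Icc_mem_nhds hs.1 (hs.2.trans_le ht.2)))
    ((hF'.mono hsub).intervalIntegrable_of_Icc ht.1)]
  ring

variable {T : ℝ} {m : ℝ → ℂ} {lam : ℝ} {U V : ℝ → ℂ}

namespace IsMemoryMode

theorem continuousOn (h : IsMemoryMode T m lam U V) : ContinuousOn U (Icc 0 T) :=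
  fun t ht => (h.hasDeriv t ht).continuousWithinAt

theorem deriv_continuousOn (h : IsMemoryMode T m lam U V) : ContinuousOn V (Icc 0 T) :=
  fun t ht => (h.hasDeriv₂ t ht).continuousWithinAt

theorem conv_continuousOn (h : IsMemoryMode T m lam U V) (hT : 0 ≤ T)
    (hm : ContinuousOn m (Icc 0 T)) : ContinuousOn (conv m U) (Icc 0 T) :=
  Visco.conv_continuousOn hT (hm.intervalIntegrable_of_Icc hT)
    (h.deriv_continuousOn.intervalIntegrable_of_Icc hT)
    fun _ hr => eq_add_integral_of_hasDerivWithinAt h.deriv_continuousOn h.hasDeriv hr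

/-- Multiplication by `exp (a₀ t / 2)` removes the damping term. -/
theorem exists_isMode (h : IsMemoryMode T m lam U V) (hT : 0 ≤ T) (hm : ContinuousOn m (Icc 0 T))
    {a₀ : ℂ} {μ : ℝ → ℂ} (hμ : ∀ t ∈ Icc 0 T, μ t = Complex.exp (a₀ / 2 * t) * m t) :
    ∃ z z₁ z₂, IsMode T a₀ μ lam (U 0) (V 0 - a₀ / 2 * U 0) z z₁ z₂ ∧ ∀ t ∈ Icc 0 T,
      z t = Complex.exp (a₀ / 2 * t) * U t ∧
      z₁ t = Complex.exp (a₀ / 2 * t) * (V t + a₀ / 2 * U t) := by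
  set E : ℝ → ℂ := fun t => Complex.exp (a₀ / 2 * t) with hE
  have hEc : Continuous E := by fun_prop
  have hEd : ∀ t : ℝ, HasDerivAt E (a₀ / 2 * E t) t := fun t => by
    have h1 := (((hasDerivAt_id (t : ℂ)).const_mul (a₀ / 2)).cexp).comp_ofReal
    refine h1.congr_deriv ?_
    simp only [id, hE]
    ring
  set W : ℝ → ℂ := fun t => E t * (-lam * (U t - conv m U t) + a₀ * V t + a₀ ^ 2 / 4 * U t) with hW
  have hWc : ContinuousOn W (Icc 0 T) := by
    refine hEc.continuousOn.mul (((continuousOn_const.mul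
      (h.continuousOn.sub (h.conv_continuousOn hT hm))).add
      (continuousOn_const.mul h.deriv_continuousOn)).add (continuousOn_const.mul h.continuousOn))
  have hZ : ∀ t ∈ Icc 0 T, HasDerivWithinAt (fun t => E t * U t) (E t * (V t + a₀ / 2 * U t))
      (Icc 0 T) t := fun t ht => by
    refine ((hEd t).hasDerivWithinAt.mul (h.hasDeriv t ht)).congr_deriv ?_
    ring
  have hZ₁ : ∀ t ∈ Icc 0 T, HasDerivWithinAt (fun t => E t * (V t + a₀ / 2 * U t)) (W t)
      (Icc 0 T) t := fun t ht => by
    refine ((hEd t).hasDerivWithinAt.mul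
      ((h.hasDeriv₂ t ht).add ((h.hasDeriv t ht).const_mul (a₀ / 2)))).congr_deriv ?_
    simp only [hW, Pi.add_apply]
    ring
  have hZ₁c : ContinuousOn (fun t => E t * (V t + a₀ / 2 * U t)) (Icc 0 T) :=
    fun t ht => (hZ₁ t ht).continuousWithinAt
  have hE0 : E 0 = 1 := by simp [hE]
  -- `IsMode` requires a globally continuous `z₂` and primitives on the whole line. The second
  -- derivative is therefore extended by its endpoint values, and `z₁`, `z` are rebuilt from it by
  -- integration.
  set z₂ : ℝ → ℂ := IccExtend hT ((Icc 0 T).domRestrict W) with hz₂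
  have hz₂W : ∀ t ∈ Icc 0 T, z₂ t = W t := fun t ht => by rw [hz₂, IccExtend_of_mem _ _ ht]; rfl
  set z₁ : ℝ → ℂ := fun t => (V 0 - a₀ / 2 * U 0 + a₀ * U 0) + ∫ s in (0 : ℝ)..t, z₂ s with hz₁
  have hz₁e : ∀ t ∈ Icc 0 T, z₁ t = E t * (V t + a₀ / 2 * U t) := fun t ht => by
    rw [eq_add_integral_of_hasDerivWithinAt hWc hZ₁ ht, hz₁, hE0]
    have : ∫ s in (0 : ℝ)..t, z₂ s = ∫ s in (0 : ℝ)..t, W s :=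
      intervalIntegral.integral_congr fun s hs => by
        rw [uIcc_of_le ht.1] at hs
        exact hz₂W s ⟨hs.1, hs.2.trans ht.2⟩
    simp only [this]
    ring
  have hze : ∀ t ∈ Icc 0 T, U 0 + ∫ s in (0 : ℝ)..t, z₁ s = E t * U t := fun t ht => by
    rw [eq_add_integral_of_hasDerivWithinAt hZ₁c hZ ht, hE0, one_mul]
    congr 1
    refine intervalIntegral.integral_congr fun s hs => ?_
    rw [uIcc_of_le ht.1] at hs
    exact hz₁e s ⟨hs.1, hs.2.trans ht.2⟩
  refine ⟨fun t => U 0 + ∫ s in (0 : ℝ)..t, z₁ s, z₁, z₂,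
    ⟨(continuousOn_iff_continuous_domRestrict.1 hWc).Icc_extend', fun _ => rfl, fun _ => rfl,
      fun t ht => ?_⟩, fun t ht => ⟨hze t ht, hz₁e t ht⟩⟩
  -- The exponential factors over `t = (t - s) + s`, one piece going to the kernel and one to the
  -- mode.
  have hconv : conv μ (fun t => U 0 + ∫ s in (0 : ℝ)..t, z₁ s) t = E t * conv m U t := by
    rw [conv_congr ht.1 (fun s hs => hμ s ⟨hs.1, hs.2.trans ht.2⟩)
      fun s hs => hze s ⟨hs.1, hs.2.trans ht.2⟩, conv, conv, ← intervalIntegral.integral_const_mul]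
    refine intervalIntegral.integral_congr fun s _ => ?_
    have : E t = Complex.exp (a₀ / 2 * (t - s : ℝ)) * E s := by
      simp only [hE]
      rw [← Complex.exp_add]
      congr 1
      push_cast
      ring
    simp only [smul_eq_mul, this]
    ring
  simp only [hconv, hze t ht, hz₁e t ht, hz₂W t ht, hW]
  ring

end IsMemoryMode

/-- `λ ∫₀ᵗ U` is controlled by the derivative of `U`. -/
theorem IsMemoryMode.exists_bound_integral (hT : 0 ≤ T) (hm : ContinuousOn m (Icc 0 T)) :
    ∃ K : ℝ, 0 < K ∧ ∀ (lam : ℝ) (U V : ℝ → ℂ) (D : ℝ), IsMemoryMode T m lam U V →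
      (∀ t ∈ Icc 0 T, ‖V t‖ ^ 2 ≤ D) →
      ∀ t ∈ Icc 0 T, ‖(lam : ℂ) * ∫ s in (0 : ℝ)..t, U s‖ ^ 2 ≤ K * D := by
  have hm2 := memLp_of_continuousOn hm
  set k := 2 * nsq T m with hk
  have hk0 : 0 ≤ k := by have := nsq_nonneg T m; positivity
  refine ⟨(1 + k * (Real.exp (k * T) * T)) * 8, by positivity, fun lam U V D h hD => ?_⟩
  have hD0 : 0 ≤ D := (sq_nonneg _).trans (hD 0 (left_mem_Icc.2 hT))
  have hUi : ∀ t ∈ Icc 0 T, IntervalIntegrable U volume 0 t := fun t ht =>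
    (h.continuousOn.mono (Icc_subset_Icc_right ht.2)).intervalIntegrable_of_Icc ht.1
  have hcc := h.conv_continuousOn hT hm
  set g : ℝ → ℂ := fun t => lam * ∫ s in (0 : ℝ)..t, U s with hg
  have hgc : ContinuousOn g (Icc 0 T) :=
    continuousOn_const.mul (continuousOn_primitive_Icc hT (hUi T (right_mem_Icc.2 hT)))
  -- The once integrated equation, solved for `g = λ ∫ U`. It is a Volterra equation whose
  -- right-hand side involves only `V`, so Gronwall bounds `g` uniformly in `λ`.
  have key : ∀ t ∈ Icc 0 T, g t = (V 0 - V t) + conv m g t := fun t ht => by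
    have h1 : V t = V 0 + ∫ s in (0 : ℝ)..t, -lam * (U s - conv m U s) :=
      eq_add_integral_of_hasDerivWithinAt
        (continuousOn_const.mul (h.continuousOn.sub hcc)) h.hasDeriv₂ ht
    have hsub : Icc 0 t ⊆ Icc 0 T := Icc_subset_Icc_right ht.2
    have h2 : ∫ s in (0 : ℝ)..t, -lam * (U s - conv m U s) =
        -lam * ((∫ s in (0 : ℝ)..t, U s) - ∫ s in (0 : ℝ)..t, conv m U s) := by
      rw [intervalIntegral.integral_const_mul, intervalIntegral.integral_sub (hUi t ht)
        ((hcc.mono hsub).intervalIntegrable_of_Icc ht.1)]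
    have h3 : conv m g t = lam * ∫ s in (0 : ℝ)..t, conv m U s := by
      rw [hg, conv_const_mul_right, conv_primitive ht.1
        ((hm.mono hsub).intervalIntegrable_of_Icc ht.1) (hUi t ht)]
    rw [h2] at h1
    rw [h3, h1, hg]
    ring
  have h8 := norm_le_of_sq_gronwall (A := 8 * D) hT hk0 hgc (by positivity) fun t ht => ?_
  · intro t ht
    exact (h8 t ht).trans_eq (by ring)
  · have hgt : MemLp g 2 (vol t) := memLp_mono_interval ht.2 (memLp_of_continuousOn hgc)
    have h1 := sq_norm_conv_le (T := t) ⟨ht.1, le_rfl⟩ (memLp_mono_interval ht.2 hm2) hgt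
    have h2 := nsq_mono_interval ht.2 hm2
    have h3 : nsq t g = ∫ s in (0 : ℝ)..t, ‖g s‖ ^ 2 := integral_vol ht.1 _
    have h4 := sq_norm_add_le (V 0 - V t) (conv m g t)
    have h5 := sq_norm_add_le (V 0) (-V t)
    rw [← sub_eq_add_neg, norm_neg] at h5
    have h6 := mul_le_mul_of_nonneg_right h2 (nsq_nonneg t g)
    rw [key t ht, hk, ← h3]
    linarith [hD t ht, hD 0 (left_mem_Icc.2 hT)]

end MemoryMode

/-! ### Coefficients of a solution -/

section Projection

variable {ι H : Type*} [NormedAddCommGroup H] [InnerProductSpace ℂ H] [CompleteSpace H]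
  {A : H →ₗ.[ℂ] H} {c : ℝ} {e : HilbertBasis ι ℂ H} {lam : ι → ℝ}

theorem conv_congr_ae {T t : ℝ} (ht : t ∈ Icc 0 T) {k k' : ℝ → ℂ} (h : k =ᵐ[vol T] k')
    (f : ℝ → ℂ) : conv k f t = conv k' f t := by
  rw [conv_comm, conv_comm k']
  refine intervalIntegral.integral_congr_ae ?_
  rw [uIoc_of_le ht.1]
  filter_upwards [(ae_restrict_iff' measurableSet_Icc).1 h] with s hs hst
  rw [hs ⟨hst.1.le, hst.2.trans ht.2⟩]

/-- The coefficients of a solution in an eigenbasis are scalar modes. -/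
theorem IsSolution.exists_isMemoryMode (h : IsEigenbasis A c e lam) {T : ℝ} {M m : ℝ → ℂ}
    (hM : M =ᵐ[vol T] m) {w₀ w₁ : H} {w : ℝ → H} (hw : IsSolution A M T w₀ w₁ w) :
    ∃ V : ι → ℝ → ℂ, ∀ i, V i 0 = ⟪e i, w₁⟫_ℂ ∧
      IsMemoryMode T m (lam i) (fun t => ⟪e i, w t⟫_ℂ) (V i) := by
  obtain ⟨w', hd, -, -, h1, hode⟩ := hw
  refine ⟨fun i t => ⟪e i, w' t⟫_ℂ, fun i => ⟨by simp only [h1], fun t ht => ?_, fun t ht => ?_⟩⟩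
  · exact (innerSL ℂ (e i)).restrictScalars ℝ |>.hasFDerivAt.comp_hasDerivWithinAt t (hd t ht)
  · have hmem := h.mem_graph i
    have hdom : e i ∈ A.domain := LinearPMap.mem_domain_of_mem_graph hmem
    have hAe : A ⟨e i, hdom⟩ = (lam i : ℂ) • e i :=
      LinearPMap.mem_graph_snd_inj A (A.mem_graph ⟨e i, hdom⟩) hmem rfl
    have h2 := hode ⟨e i, hdom⟩ t ht
    refine h2.congr_deriv ?_
    simp only [hAe, inner_smul_left, Complex.conj_ofReal]
    have h3 : ∫ s in (0 : ℝ)..t, M (t - s) * (lam i * ⟪e i, w s⟫_ℂ) =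
        lam i * conv m (fun t => ⟪e i, w t⟫_ℂ) t := by
      rw [← conv_congr_ae ht hM, conv, ← intervalIntegral.integral_const_mul]
      refine intervalIntegral.integral_congr fun s _ => ?_
      simp only [smul_eq_mul]
      ring
    rw [h3]
    ring

end Projection

theorem nsq_le_of_norm_le {E : Type*} [NormedAddCommGroup E] {T N : ℝ} {f g : ℝ → E}
    (hg : MemLp g 2 (vol T)) (h : ∀ t ∈ Icc 0 T, ‖f t‖ ≤ N * ‖g t‖) :
    nsq T f ≤ N ^ 2 * nsq T g := by
  refine (nsq_le_integral ((integrable_sq hg).const_mul (N ^ 2)) fun t ht => ?_).trans_eq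
    (integral_const_mul _ _)
  rw [← mul_pow]
  exact pow_le_pow_left₀ (norm_nonneg _) (h t ht) 2

theorem exists_norm_exp_le (a : ℂ) (T : ℝ) : ∃ N : ℝ, 0 < N ∧ ∀ t ∈ Icc 0 T,
    ‖Complex.exp (a * t)‖ ≤ N ∧ ‖(Complex.exp (a * t))⁻¹‖ ≤ N := by
  refine ⟨Real.exp (‖a‖ * T), Real.exp_pos _, fun t ht => ?_⟩
  have h1 : ‖a * t‖ ≤ ‖a‖ * T := by
    rw [norm_mul, Complex.norm_real, Real.norm_of_nonneg ht.1]
    exact mul_le_mul_of_nonneg_left ht.2 (norm_nonneg a)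
  refine ⟨(Complex.norm_exp_le_exp_norm _).trans (Real.exp_le_exp.2 h1), ?_⟩
  rw [← Complex.exp_neg]
  refine (Complex.norm_exp_le_exp_norm _).trans (Real.exp_le_exp.2 ?_)
  rwa [norm_neg]

/-! ### Passage to infinite sums -/

section Limit

variable {ι H G : Type*} [NormedAddCommGroup H] [InnerProductSpace ℂ H] [CompleteSpace H]
  [NormedAddCommGroup G] [InnerProductSpace ℂ G] [CompleteSpace G]
  {A : H →ₗ.[ℂ] H} {B : H →ₗ.[ℂ] G} {c : ℝ} {e : HilbertBasis ι ℂ H} {lam : ι → ℝ} {b : ι → G}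
  {T : ℝ}

/-- The upper bound for finite sums makes the observed series summable in L², and the lower bound
survives in the limit. -/
theorem exists_tendsto_toL2 {φ : ι → ℝ → ℂ} (hφ : ∀ i, ContinuousOn (φ i) (Icc 0 T)) {r : ι → ℝ}
    {K : ℝ} (hr : Summable r) (hup : ∀ s, nsq T (vs s φ b) ≤ K * ∑ i ∈ s, r i)
    (hlow : ∀ s, ∑ i ∈ s, r i ≤ K * nsq T (vs s φ b)) :
    ∃ Y : Lp G 2 (vol T), Tendsto (fun s => toL2 T (vs s φ b)) atTop (𝓝 Y) ∧
      ∑' i, r i ≤ K * ‖Y‖ ^ 2 := by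
  have hm := fun i => memLp_of_continuousOn (hφ i)
  have hsq : ∀ s, ‖toL2 T (vs s φ b)‖ ^ 2 = nsq T (vs s φ b) := fun s => sq_norm_toL2 (vs_memLp hm)
  obtain ⟨Y, hY⟩ : Summable fun i => toL2 T fun t => φ i t • b i :=
    summable_of_sq_norm_sum_le (hr.mul_left K) fun s => by
      rw [← toL2_vs s hm, hsq, ← Finset.mul_sum]
      exact hup s
  have hY' : Tendsto (fun s => toL2 T (vs s φ b)) atTop (𝓝 Y) := by
    simp only [toL2_vs _ hm]
    exact hY
  refine ⟨Y, hY', le_of_tendsto_of_tendsto' hr.hasSum ((hY'.norm.pow 2).const_mul K) fun s => ?_⟩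
  rw [hsq]
  exact hlow s

theorem summable_smul_basis (e : HilbertBasis ι ℂ H) {a : ι → ℂ}
    (ha : Summable fun i => ‖a i‖ ^ 2) : Summable fun i => a i • e i :=
  summable_of_sq_norm_sum_le ha fun s => by
    have h1 := e.orthonormal.inner_sum a a s
    rw [inner_self_eq_norm_sq_to_K] at h1
    have h2 : ((‖∑ i ∈ s, a i • e i‖ ^ 2 : ℝ) : ℂ) = ((∑ i ∈ s, ‖a i‖ ^ 2 : ℝ) : ℂ) := by
      push_cast
      exact h1.trans (Finset.sum_congr rfl fun i _ => Complex.conj_mul' _)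
    exact (Complex.ofReal_injective h2).le

/-- The sum of the observed modes is the observation of the sum. -/
theorem IsEigenbasis.isObservation (h : IsEigenbasis A c e lam) (hb : ∀ i, (e i, b i) ∈ B.graph)
    (hcl : IsRelClosed A B) {w : ℝ → H} (hw : ContinuousOn w (Icc 0 T)) {Y : Lp G 2 (vol T)}
    (hY : Tendsto (fun s => toL2 T (vs s (fun i t => ⟪e i, w t⟫_ℂ) b)) atTop (𝓝 Y))
    (hsum : ∀ t ∈ Icc 0 T,
      Summable fun i => ‖(lam i : ℂ) * ∫ r in (0 : ℝ)..t, ⟪e i, w r⟫_ℂ‖ ^ 2) :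
    IsObservation B T w Y := by
  intro t ht
  set φ : ι → ℝ → ℂ := fun i t => ⟪e i, w t⟫_ℂ with hφ
  have hsub : Icc 0 t ⊆ Icc 0 T := Icc_subset_Icc_right ht.2
  have hφc : ∀ i, ContinuousOn (φ i) (Icc 0 T) := fun i => continuousOn_const.inner hw
  have hφi : ∀ i, IntervalIntegrable (φ i) volume 0 t := fun i =>
    ((hφc i).mono hsub).intervalIntegrable_of_Icc ht.1
  have hm := fun i => memLp_of_continuousOn (hφc i)
  set g : ι → ℂ := fun i => ∫ r in (0 : ℝ)..t, φ i r with hg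
  have hgi : ∀ i, g i = e.repr (∫ r in (0 : ℝ)..t, w r) i := fun i => by
    rw [e.repr_apply_apply]
    exact (innerSL ℂ (e i)).intervalIntegral_comp_comm
      ((hw.mono hsub).intervalIntegrable_of_Icc ht.1)
  have h1 : Tendsto (fun s => ∑ i ∈ s, g i • e i) atTop (𝓝 (∫ r in (0 : ℝ)..t, w r)) := by
    simp only [hgi]
    exact e.hasSum_repr _
  -- Convergence of the images under `A`: relative closedness can be used only if all three
  -- components of the partial sums converge.
  obtain ⟨f, h2⟩ := summable_smul_basis e (hsum t ht)
  have h3 : Tendsto (fun s => ∑ i ∈ s, g i • b i) atTop (𝓝 (∫ r in (0 : ℝ)..t, Y r)) := by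
    rw [tendsto_iff_norm_sub_tendsto_zero]
    have h4 : Tendsto (fun s => √T * ‖toL2 T (vs s φ b) - Y‖) atTop (𝓝 0) := by
      have := (tendsto_iff_norm_sub_tendsto_zero.1 hY).const_mul √T
      rwa [mul_zero] at this
    refine squeeze_zero (fun _ => norm_nonneg _) (fun s => ?_) h4
    have hv : MemLp (vs s φ b) 2 (vol T) := vs_memLp hm
    have h5 : (∑ i ∈ s, g i • b i) - ∫ r in (0 : ℝ)..t, Y r =
        ∫ r in (0 : ℝ)..t, (vs s φ b r - Y r) := by
      rw [intervalIntegral.integral_sub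
        (MemLp.intervalIntegrable ht.1 (memLp_mono_interval ht.2 hv))
        (MemLp.intervalIntegrable ht.1 (memLp_mono_interval ht.2 (Lp.memLp Y))), integral_vs hφi]
    have h6 := sq_norm_integral_le ht (hv.sub (Lp.memLp Y))
    have h7 : nsq T (vs s φ b - ⇑Y) = ‖toL2 T (vs s φ b) - Y‖ ^ 2 := by
      rw [sq_norm_eq_nsq]
      refine nsq_congr_ae ?_
      filter_upwards [coeFn_toL2 hv, Lp.coeFn_sub (toL2 T (vs s φ b)) Y] with r hr hr'
      rw [hr', Pi.sub_apply, Pi.sub_apply, hr]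
    rw [h7] at h6
    rw [h5]
    refine (abs_le_of_sq_le_sq' ?_ (by positivity)).2
    rw [mul_pow, Real.sq_sqrt (ht.1.trans ht.2)]
    exact h6
  refine (IsClosed.mem_of_tendsto hcl (h1.prodMk_nhds (h2.prodMk_nhds h3))
    (Eventually.of_forall fun s => ⟨?_, ?_⟩)).2
  · have := A.graph.sum_mem fun i (_ : i ∈ s) => A.graph.smul_mem (g i) (h.mem_graph i)
    convert this using 1
    exact Prod.ext (by simp [Prod.fst_sum]) (by
      rw [Prod.snd_sum]
      exact Finset.sum_congr rfl fun i _ => by rw [Prod.smul_snd, smul_smul, mul_comm])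
  · have := B.graph.sum_mem fun i (_ : i ∈ s) => B.graph.smul_mem (g i) (hb i)
    convert this using 1
    exact Prod.ext (by simp [Prod.fst_sum]) (by simp [Prod.snd_sum])

end Limit

/-- The exponential shift changes the initial velocity by `α x` with `α = a₀ / 2`. This and the
converse inequality below show that the energies of the original and of the shifted data are
comparable. -/
theorem modal_energy_le {c l : ℝ} (hc : 0 ≤ c) (α x w : ℂ) :
    wt c l * ‖x‖ ^ 2 + ‖w - α * x‖ ^ 2 ≤
      (2 + c + 2 * ‖α‖ ^ 2) * ((1 + |l|) * ‖x‖ ^ 2 + ‖w‖ ^ 2) := by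
  have h1 := sq_norm_add_le w (-(α * x))
  rw [← sub_eq_add_neg, norm_neg, norm_mul, mul_pow] at h1
  have h2 := mul_le_mul_of_nonneg_right (wt_le (l := l) hc) (sq_nonneg ‖x‖)
  have h3 : 0 ≤ |l| * (‖α‖ ^ 2 * ‖x‖ ^ 2) := by positivity
  have h4 : 0 ≤ (1 + |l|) * ‖x‖ ^ 2 := by positivity
  have h5 : 0 ≤ (c + 2 * ‖α‖ ^ 2) * ‖w‖ ^ 2 := by positivity
  nlinarith

theorem energy_le_modal {c l : ℝ} (hc : 0 ≤ c) (hl : -c ≤ l) (α x w : ℂ) :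
    (1 + |l|) * ‖x‖ ^ 2 + ‖w‖ ^ 2 ≤
      (2 + c + 2 * ‖α‖ ^ 2) * (wt c l * ‖x‖ ^ 2 + ‖w - α * x‖ ^ 2) := by
  have h1 := sq_norm_add_le (w - α * x) (α * x)
  rw [sub_add_cancel, norm_mul, mul_pow] at h1
  have h2 := mul_le_mul_of_nonneg_right (one_add_abs_le hc hl) (sq_nonneg ‖x‖)
  have h3 := mul_le_mul_of_nonneg_right (one_le_wt hl)
    (by positivity : 0 ≤ ‖α‖ ^ 2 * ‖x‖ ^ 2)
  have h4 := mul_le_mul_of_nonneg_right (one_le_wt hl) (sq_nonneg ‖x‖)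
  have h5 : 0 ≤ (c + 2 * ‖α‖ ^ 2) * ‖w - α * x‖ ^ 2 := by positivity
  have h6 : 0 ≤ wt c l * ‖x‖ ^ 2 := (sq_nonneg ‖x‖).trans (by linarith)
  nlinarith

/-- The derivatives of the undamped modes are bounded by the energy. -/
theorem exists_bound_undamped_deriv {c T : ℝ} (hc : 0 ≤ c) (hT : 0 < T) {a₀ b₀ : ℂ}
    {μ μ' κ : ℝ → ℂ} (hK : IsKernel T a₀ b₀ μ μ' κ) :
    ∃ K : ℝ, 0 < K ∧ ∀ (lam : ℝ) (x y : ℂ) (z z₁ z₂ U V : ℝ → ℂ), -c ≤ lam →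
      IsMode T a₀ μ lam x y z z₁ z₂ → (∀ t ∈ Icc 0 T, z t = Complex.exp (a₀ / 2 * t) * U t ∧
        z₁ t = Complex.exp (a₀ / 2 * t) * (V t + a₀ / 2 * U t)) →
      ∀ t ∈ Icc 0 T, ‖V t‖ ^ 2 ≤ K * (wt c lam * ‖x‖ ^ 2 + ‖y‖ ^ 2) := by
  obtain ⟨K₁, hK₁, h1⟩ := IsMode.exists_bound hc hT hK
  obtain ⟨K₂, hK₂, h2⟩ := IsMode.exists_bound_deriv hc hT hK
  obtain ⟨N, hN, hexp⟩ := exists_norm_exp_le (a₀ / 2) T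
  refine ⟨N ^ 2 * (2 * K₂ + 2 * ‖a₀ / 2‖ ^ 2 * K₁), by positivity,
    fun lam x y z z₁ z₂ U V hl hz hUV t ht => ?_⟩
  have hw := one_le_wt hl
  have b1 := h1 lam x y z z₁ z₂ hl hz t ht
  have b2 := h2 lam x y z z₁ z₂ hl hz t ht
  obtain ⟨e1, e2⟩ := hUV t ht
  have hV : V t = (Complex.exp (a₀ / 2 * t))⁻¹ * (z₁ t + -(a₀ / 2 * z t)) := by
    rw [e1, e2]
    field_simp [Complex.exp_ne_zero]
    ring
  have b3 : K₁ * (‖x‖ ^ 2 + ‖y‖ ^ 2 / wt c lam) ≤ K₁ * (wt c lam * ‖x‖ ^ 2 + ‖y‖ ^ 2) := by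
    refine mul_le_mul_of_nonneg_left (add_le_add ?_ ?_) hK₁.le
    · exact le_mul_of_one_le_left (sq_nonneg _) hw
    · exact div_le_self (sq_nonneg _) hw
  have b4 := sq_norm_add_le (z₁ t) (-(a₀ / 2 * z t))
  rw [norm_neg, norm_mul, mul_pow] at b4
  have b5 := mul_le_mul_of_nonneg_left (b1.trans b3) (sq_nonneg ‖a₀ / 2‖)
  have b6 := pow_le_pow_left₀ (norm_nonneg _) (hexp t ht).2 2
  rw [hV, norm_mul, mul_pow, mul_assoc]
  exact mul_le_mul b6 (by linarith) (sq_nonneg _) (sq_nonneg N)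

/-- Observability of the system with memory. -/
theorem exists_observation_with_memory {H G : Type*}
    [NormedAddCommGroup H] [InnerProductSpace ℂ H] [CompleteSpace H]
    [NormedAddCommGroup G] [InnerProductSpace ℂ G] [CompleteSpace G]
    {A : H →ₗ.[ℂ] H} {B : H →ₗ.[ℂ] G} {T₀ : ℝ} (hA : AssumptionA A) (hB : AssumptionB A B T₀)
    {T : ℝ} (hT : T₀ < T) {M : ℝ → ℂ} (hM : MemH2 T M) :
    ∃ C : ℝ, 0 < C ∧ ∀ (w₀ w₁ : H) (w : ℝ → H), MemH1 A w₀ → IsSolution A M T w₀ w₁ w →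
      ∃ y : Lp G 2 (vol T), IsObservation B T w y ∧ energyNorm A w₀ w₁ ≤ C * ‖y‖ := by
  have hT0 : 0 < T := hB.nonneg.trans_lt hT
  obtain ⟨ι, e, lam, c, hc, h⟩ := hA.exists_isEigenbasis
  obtain ⟨b, hb⟩ := hB.exists_eigenvector_obs h
  obtain ⟨m, μ, μ', κ, a₀, b₀, hMm, hmc, hK, hμ⟩ := hM.exists_kernel hT0
  obtain ⟨C₁, hC₁, hobs⟩ := modes_observability hB.nonneg hT hc.le h.lower h.finite
    (fun T' hT' => hB.freeObs hc.le h hb hT') hK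
  obtain ⟨N, hN, hexp⟩ := exists_norm_exp_le (a₀ / 2) T
  obtain ⟨K₁, hK₁, hV⟩ := exists_bound_undamped_deriv hc.le hT0 hK
  obtain ⟨K₂, hK₂, hI⟩ := IsMemoryMode.exists_bound_integral hT0.le hmc
  set L := 2 + c + 2 * ‖a₀ / 2‖ ^ 2 with hL
  have hL0 : 0 < L := by positivity
  -- `L` compares the energies before and after the shift, `N` bounds the exponential factor and its
  -- inverse, and `C₁` is the observability constant of the modes.
  refine ⟨√(L * (N ^ 2 * C₁)), Real.sqrt_pos.2 (by positivity), fun w₀ w₁ w hw₀ hw => ?_⟩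
  obtain ⟨V, hVm⟩ := hw.exists_isMemoryMode h hMm
  have hwc : ContinuousOn w (Icc 0 T) := by
    obtain ⟨w', hd, -⟩ := hw
    exact fun t ht => (hd t ht).continuousWithinAt
  have hw0 : w 0 = w₀ := by
    obtain ⟨w', -, -, h0, -⟩ := hw
    exact h0
  set φ : ι → ℝ → ℂ := fun i t => ⟪e i, w t⟫_ℂ with hφ
  choose z z₁ z₂ hz hzφ using fun i => (hVm i).2.exists_isMode hT0.le hmc hμ
  set x : ι → ℂ := fun i => φ i 0 with hx
  set y : ι → ℂ := fun i => V i 0 - a₀ / 2 * φ i 0 with hy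
  have hmodes : IsModes T a₀ μ lam x y z z₁ z₂ := hz
  set r : ι → ℝ := fun i => wt c (lam i) * ‖x i‖ ^ 2 + ‖y i‖ ^ 2 with hr
  have hen : HasSum (fun i => (1 + |lam i|) * ‖x i‖ ^ 2 + ‖V i 0‖ ^ 2)
      (energyNorm A w₀ w₁ ^ 2) := by
    have := h.hasSum_energyNorm hw₀ w₁
    simp only [hx, hφ, hw0, (hVm _).1]
    exact this
  have hr0 : ∀ i, 0 ≤ r i := fun i => by
    have := one_le_wt (h.lower i)
    simp only [hr]
    positivity
  have hrs : Summable r := Summable.of_nonneg_of_le hr0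
    (fun i => modal_energy_le hc.le (a₀ / 2) (x i) (V i 0)) (hen.summable.mul_left L)
  have hφc : ∀ i, ContinuousOn (φ i) (Icc 0 T) := fun i => continuousOn_const.inner hwc
  have hzE : ∀ s, ∀ t ∈ Icc 0 T, vs s z b t = Complex.exp (a₀ / 2 * t) • vs s φ b t :=
    fun s t ht => by
      rw [← vs_const_mul φ fun t : ℝ => Complex.exp (a₀ / 2 * t)]
      exact vs_congr fun i => (hzφ i t ht).1
  have hφz : ∀ s, nsq T (vs s φ b) ≤ N ^ 2 * nsq T (vs s z b) := fun s => by
    refine nsq_le_of_norm_le (memLp_of_continuousOn (vs_continuousOn hmodes.continuousOn))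
      fun t ht => ?_
    have h1 : vs s φ b t = (Complex.exp (a₀ / 2 * t))⁻¹ • vs s z b t := by
      rw [hzE s t ht, inv_smul_smul₀ (Complex.exp_ne_zero _)]
    rw [h1, norm_smul]
    exact mul_le_mul_of_nonneg_right (hexp t ht).2 (norm_nonneg _)
  have hzφ' : ∀ s, nsq T (vs s z b) ≤ N ^ 2 * nsq T (vs s φ b) := fun s => by
    refine nsq_le_of_norm_le (memLp_of_continuousOn (vs_continuousOn hφc)) fun t ht => ?_
    rw [hzE s t ht, norm_smul]
    exact mul_le_mul_of_nonneg_right (hexp t ht).1 (norm_nonneg _)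
  obtain ⟨Y, hY, hlow⟩ := exists_tendsto_toL2 (b := b) (K := N ^ 2 * C₁) hφc hrs
    (fun s => (hφz s).trans <| by
      rw [mul_assoc]
      exact mul_le_mul_of_nonneg_left (hobs s x y z z₁ z₂ hmodes).2 (sq_nonneg N))
    (fun s => (hobs s x y z z₁ z₂ hmodes).1.trans <| by
      rw [mul_comm (N ^ 2), mul_assoc]
      exact mul_le_mul_of_nonneg_left (hzφ' s) hC₁.le)
  refine ⟨Y, h.isObservation hb hB.relClosed hwc hY fun t ht => ?_, ?_⟩
  -- This places `∫₀ᵗ w` in the domain of `A`: the eigenvalue times the integrated coefficient is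
  -- bounded by the modal energy `r i`, which is summable.
  · refine Summable.of_nonneg_of_le (fun _ => sq_nonneg _) (fun i => ?_)
      ((hrs.mul_left K₁).mul_left K₂)
    exact hI (lam i) (φ i) (V i) _ (hVm i).2
      (hV (lam i) (x i) (y i) _ _ _ _ _ (h.lower i) (hz i) (hzφ i)) t ht
  · refine (abs_le_of_sq_le_sq' ?_ (by positivity)).2
    rw [mul_pow, Real.sq_sqrt (by positivity), mul_assoc]
    calc energyNorm A w₀ w₁ ^ 2 ≤ L * ∑' i, r i := by
          rw [← tsum_mul_left, ← hen.tsum_eq]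
          exact hen.summable.tsum_le_tsum
            (fun i => energy_le_modal hc.le (h.lower i) (a₀ / 2) (x i) (V i 0)) (hrs.mul_left L)
      _ ≤ _ := mul_le_mul_of_nonneg_left hlow hL0.le

end Visco

end

theorem theorem1p1 {H G : Type*}
    [NormedAddCommGroup H] [InnerProductSpace ℂ H] [CompleteSpace H]
    [NormedAddCommGroup G] [InnerProductSpace ℂ G] [CompleteSpace G]
    (A : H →ₗ.[ℂ] H) (B : H →ₗ.[ℂ] G) (T₀ : ℝ)
    (hA : Visco.AssumptionA A) (hB : Visco.AssumptionB A B T₀)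
    (T : ℝ) (hT : T₀ < T) (M : ℝ → ℂ) (hM : Visco.MemH2 T M) :
    ∃ C : ℝ, 0 < C ∧ ∀ (w₀ w₁ : H) (w : ℝ → H),
      Visco.MemH1 A w₀ → Visco.IsSolution A M T w₀ w₁ w →
      ∃ y : MeasureTheory.Lp G 2 (Visco.vol T), Visco.IsObservation B T w y ∧
        Visco.energyNorm A w₀ w₁ ≤ C * ‖y‖ := by
  exact Visco.exists_observation_with_memory hA hB hT hM
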